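/- Let $F_2=\langle\alpha,\beta\rangle$ be the fundamental group of the one-holed torus, and let $\mathcal S$ be the set of free homotopy classes of essential unoriented simple closed curves, that is, the set of classes of primitive elements of $F_2$ up to conjugation and inversion. Two distinct curves are adjacent if they intersect once, that is, if they are represented by a pair of free generators; a triangle is a triple of pairwise adjacent curves. Let $\mathcal E$ be the graph whose vertices are the unordered pairs $(X,Y)$ of adjacent curves, two distinct vertices being joined if they are contained in a common triangle. For a vertex $v$ of $\mathcal E$ and $X\in\mathcal S$ let $d_v(X)$ be the minimal distance in $\mathcal E$ from $v$ to a vertex containing $X$. The Fibonacci function $F_v:\mathcal S\to\mathbb N$ is defined by $F_v(Z)=1$ if $d_v(Z)=0$, and otherwise $F_v(Z)=F_v(X)+F_v(Y)$, where $\{X,Y\}$ is the unique pair such that $X,Y,Z$ form a triangle and $d_v(X),d_v(Y)<d_v(Z)$. A function $g:\mathcal S\to[0,\infty)$ has an upper (resp. lower) Fibonacci bound with respect to $v$ if there is $\kappa>0$ with $g(X)\le\kappa F_v(X)$ (resp. $g(X)\ge\kappa F_v(X)$) for all $X\in\mathcal S$; it has Fibonacci growth if it has both. Let $\mathrm{SU}(2,1)=\{A\in\mathrm{SL}(3,\mathbb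 C): A^{-1}=J\overline{A}^{\,T}J\}$ with $J=\mathrm{diag}(1,1,-1)$; an element is loxodromic if it fixes exactly two points of the boundary of the complex hyperbolic plane. For a homomorphism $\rho:F_2\to\mathrm{SU}(2,1)$ put $\phi_\rho^+(X)=\max\{\log|\mathrm{tr}\,\rho(X)|,0\}$ for $X\in\mathcal S$; this depends only on the conjugacy class of $\rho$. Let $f(t)=|t|^4-8\,\mathrm{Re}(t^3)+18|t|^2-27$. For $c\in\mathbb C$, call a real number $D$ admissible for $c$ if for every $\rho$ with $\mathrm{tr}\,\rho([\alpha,\beta])=c$ and every pair $a,b$ of free generators of $F_2$ with $f(\mathrm{tr}\,\rho(a))>0$, the following holds: if the sequence $u_n=\mathrm{tr}\,\rho(a^nb)$, $n\in\mathbb Z$, does not grow exponentially in both directions (that is, if there are no $k>0$, $r>1$ with $|u_n|\ge k\,r^{|n|}$ for all but finitely many $n$), then $|u_n|<D$ for infinitely many $n$. Given a choice of an admissible $D(c)$ for each $c\in\mathbb C$, put $M(c)=\max\{6,\sqrt{|\mathrm{Re}(c)|},D(c)\}$, and call $\rho$ a Bowditch representation if $\rho(\gamma)$ is loxodromic for every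 $\gamma\in\mathcal S$ and the set $\{\gamma\in\mathcal S:|\mathrm{tr}\,\rho(\gamma)|<M(c)\}$, where $c=\mathrm{tr}\,\rho([\alpha,\beta])$, is finite. **Theorem.** (i) For every homomorphism $\rho:F_2\to\mathrm{SU}(2,1)$ and every vertex $v$ of $\mathcal E$, the function $\phi_\rho^+$ has an upper Fibonacci bound on $\mathcal S$ with respect to $v$. (ii) For every $c\in\mathbb C$ an admissible constant exists; and, for every choice of admissible constants $D(c)$, every Bowditch representation $\rho$ and every vertex $v$ of $\mathcal E$, the function $\phi_\rho^+$ has a lower Fibonacci bound on $\mathcal S$ with respect to $v$, and hence Fibonacci growth. -/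

import Mathlib

open scoped Matrix LinearAlgebra.Projectivization

noncomputable section

namespace OneHoledTorus

/-! ### Simple closed curves on the one-holed torus -/

/-- The fundamental group of the one-holed torus: the free group on `α` and `β`. -/
abbrev F2 : Type := FreeGroup (Fin 2)

/-- The first standard generator. -/
def genA : F2 := FreeGroup.of 0

/-- The second standard generator. -/
def genB : F2 := FreeGroup.of 1

/-- `g ∼ h` if and only if `g` is conjugate to `h` or to `h⁻¹`: two elements are related exactly
when they define the same unoriented free homotopy class of closed curves. -/
def freeHomotopySetoid : Setoid F2 where
  r g h := IsConj g h ∨ IsConj g h⁻¹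
  iseqv := by
    have inv : ∀ {g h : F2}, IsConj g h → IsConj g⁻¹ h⁻¹ := by
      intro g h hgh
      obtain ⟨c, hc⟩ := isConj_iff.1 hgh
      exact isConj_iff.2 ⟨c, by rw [← hc]; group⟩
    refine ⟨fun g => Or.inl (IsConj.refl g), ?_, ?_⟩
    · rintro g h (hgh | hgh)
      · exact Or.inl hgh.symm
      · refine Or.inr ?_
        have := inv hgh.symm
        rwa [inv_inv] at this
    · rintro g h k (hgh | hgh) (hhk | hhk)
      · exact Or.inl (hgh.trans hhk)
      · exact Or.inr (hgh.trans hhk)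
      · exact Or.inr (hgh.trans (inv hhk))
      · refine Or.inl ?_
        have := hgh.trans (inv hhk)
        rwa [inv_inv] at this

/-- An element of `F2` is primitive if it belongs to a pair of free generators. -/
def IsPrimitive (g : F2) : Prop := ∃ φ : MulAut F2, φ genA = g

/-- The set of free homotopy classes of essential unoriented simple closed curves, as the subset
of `F2 / ∼` given by the classes of primitive elements. It is also the set `Ω` of regions. -/
def Curve : Type :=
  {q : Quotient freeHomotopySetoid // ∃ g : F2, IsPrimitive g ∧ Quotient.mk _ g = q}

/-- The class of the image of the first generator under an automorphism. -/
def curveA (φ : MulAut F2) : Curve := ⟨Quotient.mk _ (φ genA), φ genA, ⟨φ, rfl⟩, rfl⟩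

/-- The automorphism exchanging the two generators. -/
def swapAut : MulAut F2 := FreeGroup.freeGroupCongr (Equiv.swap 0 1)

/-- The class of the image of the second generator under an automorphism. -/
def curveB (φ : MulAut F2) : Curve := ⟨Quotient.mk _ (φ genB), φ genB,
  ⟨φ * swapAut, by simp [swapAut, genA, genB, MulAut.mul_apply]⟩, rfl⟩

/-- The `1`-skeleton of the complex of curves `𝒞` (the Farey graph): two distinct simple closed
curves are joined when they intersect once, that is, when they are represented by a pair of free
generators. The `2`-simplices of `𝒞` are the triples of pairwise adjacent curves. -/
def curveGraph : SimpleGraph Curve :=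
  SimpleGraph.fromRel fun X Y => ∃ φ : MulAut F2, curveA φ = X ∧ curveB φ = Y

/-- `X, Y, Z` are the vertices of a triangle of `𝒞`: they are the three regions meeting at a
vertex of the dual tree. -/
def IsTriangle (X Y Z : Curve) : Prop :=
  curveGraph.Adj X Y ∧ curveGraph.Adj X Z ∧ curveGraph.Adj Y Z

/-- The vertices of the edge graph `ℰ`: the edges of `𝒞`. -/
abbrev EdgeVertex : Type := {e : Sym2 Curve // e ∈ curveGraph.edgeSet}

/-- The edge graph `ℰ`: two distinct edges of `𝒞` are joined when they lie in a common triangle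
of `𝒞`. -/
def edgeGraph : SimpleGraph EdgeVertex :=
  SimpleGraph.fromRel fun e f =>
    ∃ X Y Z : Curve, IsTriangle X Y Z ∧ e.1 = s(X, Y) ∧ f.1 = s(X, Z)

/-- The distance `d_v(X)`: the minimal distance in `ℰ` from `v` to a vertex of the form
`(X, Y)`. -/
def regionDist (v : EdgeVertex) (X : Curve) : ℕ :=
  sInf {n | ∃ w : EdgeVertex, X ∈ w.1 ∧ edgeGraph.dist v w = n}

/-- `X` and `Y` are two regions which form a triangle with `Z` and are closer to `v`. -/
def AreParents (v : EdgeVertex) (Z X Y : Curve) : Prop :=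
  IsTriangle X Y Z ∧ regionDist v X < regionDist v Z ∧ regionDist v Y < regionDist v Z

open Classical in
/-- The Fibonacci function `F_v`: it is `1` at the two regions of `v`, and `F_v(X) + F_v(Y)` at
any other region, where `X` and `Y` are its two parents. (The two regions of `v` have
`d_v = 0`, hence no parents; any other region has exactly one pair of parents.) -/
def fib (v : EdgeVertex) (Z : Curve) : ℕ :=
  if h : ∃ p : Curve × Curve, AreParents v Z p.1 p.2 then
    have := h.choose_spec.2.1
    have := h.choose_spec.2.2
    fib v h.choose.1 + fib v h.choose.2
  else 1
termination_by regionDist v Z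

/-- `g` has an upper Fibonacci bound on `Ω'`. -/
def HasUpperFibBound (v : EdgeVertex) (g : Curve → ℝ) (Ω' : Set Curve) : Prop :=
  ∃ κ : ℝ, 0 < κ ∧ ∀ X ∈ Ω', g X ≤ κ * fib v X

/-- `g` has a lower Fibonacci bound on `Ω'`. -/
def HasLowerFibBound (v : EdgeVertex) (g : Curve → ℝ) (Ω' : Set Curve) : Prop :=
  ∃ κ : ℝ, 0 < κ ∧ ∀ X ∈ Ω', κ * fib v X ≤ g X

/-- `g` has Fibonacci growth on `Ω'`. -/
def HasFibGrowth (v : EdgeVertex) (g : Curve → ℝ) (Ω' : Set Curve) : Prop :=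
  HasUpperFibBound v g Ω' ∧ HasLowerFibBound v g Ω'

/-! ### The group `SU(2,1)` and its representations -/

/-- The matrix of the Hermitian form of signature `(2,1)`. -/
def J : Matrix (Fin 3) (Fin 3) ℂ := Matrix.diagonal ![1, 1, -1]

theorem J_mul_J : J * J = 1 := by
  rw [J, Matrix.diagonal_mul_diagonal, ← Matrix.diagonal_one]
  congr 1
  funext i
  fin_cases i <;> simp

/-- `SU(2,1)`: the matrices `A` of determinant one with `A⁻¹ = J Aᴴ J`. -/
def SU21 : Subgroup (Matrix.SpecialLinearGroup (Fin 3) ℂ) where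
  carrier := {A | (A⁻¹).1 = J * A.1ᴴ * J}
  one_mem' := by simp [J_mul_J]
  mul_mem' := by
    intro A B hA hB
    simp only [Set.mem_ofPred_eq] at hA hB ⊢
    rw [mul_inv_rev, Matrix.SpecialLinearGroup.coe_mul, hA, hB,
      Matrix.SpecialLinearGroup.coe_mul, Matrix.conjTranspose_mul]
    calc J * B.1ᴴ * J * (J * A.1ᴴ * J) = J * B.1ᴴ * (J * J) * A.1ᴴ * J := by
          simp only [Matrix.mul_assoc]
      _ = J * (B.1ᴴ * A.1ᴴ) * J := by rw [J_mul_J, Matrix.mul_one]; simp only [Matrix.mul_assoc]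
  inv_mem' := by
    intro A hA
    simp only [Set.mem_ofPred_eq] at hA ⊢
    have hJ : Jᴴ = J := by
      rw [J, Matrix.diagonal_conjTranspose]
      congr 1
      funext i
      fin_cases i <;> simp
    rw [inv_inv, hA, Matrix.conjTranspose_mul, Matrix.conjTranspose_mul, hJ,
      Matrix.conjTranspose_conjTranspose]
    calc A.1 = (J * J) * A.1 * (J * J) := by rw [J_mul_J, Matrix.one_mul, Matrix.mul_one]
      _ = J * (J * (A.1 * J)) * J := by simp only [Matrix.mul_assoc]

/-- The trace of an element of `SU(2,1)`. -/
def tr (A : SU21) : ℂ := A.1.1.trace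

theorem tr_inv (A : SU21) : tr A⁻¹ = star (tr A) := by
  have h : (A.1⁻¹).1 = J * A.1.1ᴴ * J := A.2
  have h' : tr A⁻¹ = ((A.1⁻¹).1).trace := rfl
  rw [h', h, Matrix.mul_assoc, Matrix.trace_mul_comm, Matrix.mul_assoc, J_mul_J, Matrix.mul_one,
    Matrix.trace_conjTranspose]
  rfl

theorem tr_conj (A C : SU21) : tr (C * A * C⁻¹) = tr A := by
  have h' : tr (C * A * C⁻¹) = (C.1.1 * A.1.1 * (C.1⁻¹).1).trace := rfl
  rw [h', Matrix.trace_mul_comm, ← Matrix.mul_assoc, ← Matrix.SpecialLinearGroup.coe_mul,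
    inv_mul_cancel, Matrix.SpecialLinearGroup.coe_one, Matrix.one_mul]
  rfl

/-- The Hermitian form of signature `(2,1)` on `ℂ³`. -/
def hermForm (v w : Fin 3 → ℂ) : ℂ := v 0 * star (w 0) + v 1 * star (w 1) - v 2 * star (w 2)

/-- The fixed points of `A` on the boundary of the complex hyperbolic plane, the latter being the
set of isotropic lines of `ℂ³`. -/
def boundaryFixedPoints (A : SU21) : Set (ℙ ℂ (Fin 3 → ℂ)) :=
  {p | hermForm p.rep p.rep = 0 ∧ ∃ μ : ℂ, A.1.1 *ᵥ p.rep = μ • p.rep}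

/-- `A` is loxodromic: it fixes exactly two points on the boundary of the complex hyperbolic
plane. -/
def IsLoxodromic (A : SU21) : Prop := (boundaryFixedPoints A).encard = 2

/-- The modulus `|tr ρ(X)|` for a simple closed curve `X`. -/
def absTrace (ρ : F2 →* SU21) (X : Curve) : ℝ :=
  Quotient.lift (s := freeHomotopySetoid) (fun g => ‖tr (ρ g)‖) (by
    have key : ∀ g h : F2, IsConj g h → ‖tr (ρ g)‖ = ‖tr (ρ h)‖ := by
      intro g h hgh
      obtain ⟨c, rfl⟩ := isConj_iff.1 hgh
      rw [map_mul, map_mul, map_inv, tr_conj]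
    rintro g h (hgh | hgh)
    · exact key g h hgh
    · show ‖tr (ρ g)‖ = ‖tr (ρ h)‖
      rw [key g _ hgh, map_inv, tr_inv, norm_star]) X.1

/-- The function `φ_ρ⁺(X) = max (log |tr ρ(X)|) 0`. -/
def logPlusTrace (ρ : F2 →* SU21) (X : Curve) : ℝ := Real.posLog (absTrace ρ X)

/-- The trace of the peripheral element `[α, β] = α β α⁻¹ β⁻¹`. -/
def boundaryTrace (ρ : F2 →* SU21) : ℂ := tr (ρ (genA * genB * genA⁻¹ * genB⁻¹))

/-! ### Bowditch representations -/

/-- The function `f(t) = |t|⁴ - 8 Re(t³) + 18 |t|² - 27`, the resultant of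
`x³ - t x² + t̄ x - 1` and its derivative. -/
def resultantFn (t : ℂ) : ℝ := ‖t‖ ^ 4 - 8 * (t ^ 3).re + 18 * ‖t‖ ^ 2 - 27

/-- A sequence indexed by `ℤ` grows exponentially in both directions. -/
def GrowsExponentially (u : ℤ → ℂ) : Prop :=
  ∃ k : ℝ, 0 < k ∧ ∃ r : ℝ, 1 < r ∧ ∃ N : ℕ, ∀ n : ℤ, N ≤ n.natAbs → k * r ^ n.natAbs ≤ ‖u n‖

/-- `D` is a possible value of the constant `D(c)`: for each representation with boundary trace
`c` and each pair of free generators `α, β` with `f(tr ρ(α)) > 0`, if the sequence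
`tr ρ(αⁿ β)`, `n ∈ ℤ`, of traces around the region of `α` does not grow exponentially in both
directions, then infinitely many of its terms have modulus smaller than `D`. -/
def IsNeighborConstant (c : ℂ) (D : ℝ) : Prop :=
  ∀ ρ : F2 →* SU21, boundaryTrace ρ = c → ∀ φ : MulAut F2, 0 < resultantFn (tr (ρ (φ genA))) →
    ¬ GrowsExponentially (fun n : ℤ => tr (ρ (φ genA ^ n * φ genB))) →
    {n : ℤ | ‖tr (ρ (φ genA ^ n * φ genB))‖ < D}.Infinite

/-- The threshold `M(c) = max {6, √|Re c|, D(c)}`. -/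
def threshold (D : ℂ → ℝ) (c : ℂ) : ℝ := max 6 (max √|c.re| (D c))

/-- Bowditch representations: every simple closed curve is sent to a loxodromic element (for
primitive `g` this depends only on the class of `g`), and only finitely many simple closed curves
have a trace of modulus smaller than `M(c)`, where `c` is the boundary trace. -/
def IsBowditch (D : ℂ → ℝ) (ρ : F2 →* SU21) : Prop :=
  (∀ g : F2, IsPrimitive g → IsLoxodromic (ρ g)) ∧
    {X : Curve | absTrace ρ X < threshold D (boundaryTrace ρ)}.Finite

end OneHoledTorus

end

/-! Both bounds reduce to arithmetic in homology. Nielsen's theorem shows that an automorphism of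
`F2` acting trivially on homology is inner (`inner_of_vec_eq`), so a simple closed curve is
determined by its homology class up to sign (`isConj_of_vec_eq`). In the basis given by the vertex
v, a curve is a pair of coprime integers up to sign, adjacent curves have determinant ±1, the
distance d_v counts steps of the subtractive Euclidean algorithm (`regionDist_eq_depth`), and F_v is
the sum of the moduli of the two coordinates (`fib_eq_coord`). It remains to compare log |tr| with p
+ q on two cones of nonnegative coordinates (`inCone_or`), which transvections subdivide as the
Euclidean algorithm does (`InCone.cases`).

Upper bound: a curve with coordinates (p, q) is represented by a positive word with p letters a and
q letters b, and a submultiplicative matrix norm bounds its trace by exp(ps + qt)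
(`absTrace_le_exp`).

Lower bound: a polarised Cayley–Hamilton identity gives an edge relation between the traces of A, B,
AB and AB⁻¹ (`edge_relation`). If |tr A| and |tr B| are at least M, one of |tr AB|, |tr AB⁻¹| is
therefore at least 2/7 |tr A tr B| (`TraceConditions.fork`). Once the larger one lies inside the
cone, this persists in all subcones, so log(2/7 |tr|) is superadditive there
(`TraceConditions.add_le_log`) and growth is linear. A descent argument treats the other cones with
large traces.

A cone may also be bounded by a curve a of small trace, where the fork estimate fails. Diagonalising
the loxodromic A gives tr(AⁿB) = aⁿα + bⁿβ + cⁿγ with |a| > 1, |b| = 1/|a|, |c| = 1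
(`exists_trace_formula`). Either αβ ≠ 0 and the sequence grows exponentially in both directions, or
unitarity forces |γ| = 1 and infinitely many terms have modulus below 2. Hence 2 is always
admissible. For any admissible constant, the finiteness condition on a Bowditch representation
excludes non-growth, so log |tr| grows linearly around each region. Finally, the finitely many
curves of small trace disappear from the cones after finitely many subdivisions
(`TraceConditions.hasLinearGrowth_of_le`). -/

noncomputable section

namespace OneHoledTorus

/-! ### Lengths and cancellation in free groups -/

section FreeGroupLength

open FreeGroup

variable {α : Type*} [DecidableEq α]

/-- The length of the longest common prefix of two lists. -/
def commonPrefix {β : Type*} [DecidableEq β] : List β → List β → ℕ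
  | a :: s, b :: t => if a = b then commonPrefix s t + 1 else 0
  | _, _ => 0

theorem commonPrefix_comm {β : Type*} [DecidableEq β] (s t : List β) :
    commonPrefix s t = commonPrefix t s := by
  induction s generalizing t with
  | nil => cases t <;> simp [commonPrefix]
  | cons a s ih => cases t with
    | nil => simp [commonPrefix]
    | cons b t => simp [commonPrefix, ih t, eq_comm]

theorem commonPrefix_min {β : Type*} [DecidableEq β] (s t u : List β) :
    min (commonPrefix s t) (commonPrefix t u) ≤ commonPrefix s u := by
  induction s generalizing t u with
  | nil => cases t <;> simp [commonPrefix]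
  | cons a s ih => cases t with
    | nil => simp [commonPrefix]
    | cons b t => cases u with
      | nil => simp [commonPrefix]
      | cons c u =>
        have := ih t u
        simp only [commonPrefix]
        split_ifs <;> grind

theorem exists_commonPrefix {β : Type*} [DecidableEq β] (s t : List β) :
    ∃ p s' t', s = p ++ s' ∧ t = p ++ t' ∧ p.length = commonPrefix s t ∧
      ∀ a ∈ s'.head?, ∀ b ∈ t'.head?, a ≠ b := by
  induction s generalizing t with
  | nil => exact ⟨[], [], t, by simp [commonPrefix]⟩
  | cons a s ih => cases t with
    | nil => exact ⟨[], a :: s, [], by simp [commonPrefix]⟩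
    | cons b t =>
      by_cases h : a = b
      · obtain ⟨p, s', t', h1, h2, h3, h4⟩ := ih t
        refine ⟨a :: p, s', t', ?_, ?_, ?_, h4⟩
        · simpa using h1
        · simpa [h] using h2
        · simp [commonPrefix, h, h3]
      · exact ⟨[], a :: s, b :: t, by simp [commonPrefix, h]⟩

/-- The length of the common initial segment of two elements of a free group. -/
def gromovProd (x y : FreeGroup α) : ℕ := commonPrefix x.toWord y.toWord

theorem gromovProd_comm (x y : FreeGroup α) : gromovProd x y = gromovProd y x :=
  commonPrefix_comm _ _

theorem gromovProd_min (x y z : FreeGroup α) :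
    min (gromovProd x y) (gromovProd y z) ≤ gromovProd x z := commonPrefix_min _ _ _

theorem invRev_append_isReduced {s t : List (α × Bool)} (hs : FreeGroup.IsReduced s) (ht : FreeGroup.IsReduced t)
    (h : ∀ a ∈ s.head?, ∀ b ∈ t.head?, a ≠ b) : FreeGroup.IsReduced (invRev s ++ t) := by
  have hs' : FreeGroup.IsReduced (invRev s) := by
    rw [isReduced_iff_reduce_eq] at hs ⊢
    rw [reduce_invRev, hs]
  unfold FreeGroup.IsReduced at *
  rw [List.isChain_append]
  refine ⟨hs', ht, ?_⟩
  intro x hx y hy hxy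
  cases s with
  | nil => simp [invRev] at hx
  | cons a s =>
    simp [invRev] at hx
    have := h a (by simp) y hy
    subst hx
    obtain ⟨a1, a2⟩ := a
    obtain ⟨y1, y2⟩ := y
    simp at hxy this ⊢
    have := this hxy
    cases a2 <;> cases y2 <;> simp_all

/-- The common initial segment cancels, and what remains is already reduced because the two tails
start with different letters. -/
theorem norm_inv_mul (x y : FreeGroup α) :
    FreeGroup.norm (x⁻¹ * y) + 2 * gromovProd x y = FreeGroup.norm x + FreeGroup.norm y := by
  obtain ⟨p, s, t, hs, ht, hp, hd⟩ := exists_commonPrefix x.toWord y.toWord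
  have hx : x = mk p * mk s := by rw [← mk_toWord (x := x), hs, mul_mk]
  have hy : y = mk p * mk t := by rw [← mk_toWord (x := y), ht, mul_mk]
  have hxs : FreeGroup.IsReduced s := (isReduced_toWord (x := x)).infix ⟨p, [], by simp [hs]⟩
  have hyt : FreeGroup.IsReduced t := (isReduced_toWord (x := y)).infix ⟨p, [], by simp [ht]⟩
  have h1 : x⁻¹ * y = mk (invRev s ++ t) := by
    rw [← mul_mk, ← inv_mk, hx, hy]; group
  have h2 : FreeGroup.norm (x⁻¹ * y) = s.length + t.length := by
    rw [h1, FreeGroup.norm, toWord_mk, (invRev_append_isReduced hxs hyt hd).reduce_eq]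
    simp
  have h3 : FreeGroup.norm x = p.length + s.length := by rw [FreeGroup.norm, hs, List.length_append]
  have h4 : FreeGroup.norm y = p.length + t.length := by rw [FreeGroup.norm, ht, List.length_append]
  rw [gromovProd, ← hp]
  omega

theorem norm_mul_add (x y : FreeGroup α) :
    FreeGroup.norm (x * y) + 2 * gromovProd x⁻¹ y = FreeGroup.norm x + FreeGroup.norm y := by
  have := norm_inv_mul x⁻¹ y
  rwa [inv_inv, norm_inv_eq] at this

/-- Write x = c r c⁻¹ with r cyclically reduced and nonempty; squaring doubles r and leaves c alone.
-/
theorem norm_lt_norm_sq {x : FreeGroup α} (hx : x ≠ 1) : FreeGroup.norm x < FreeGroup.norm (x * x) := by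
  have h := toWord_pow x 2
  have h2 := reduceCyclically.reduce_flatten_replicate (isReduced_toWord (x := x)) 2
  rw [h2] at h
  have h3 := reduceCyclically.conj_conjugator_reduceCyclically x.toWord
  set c := reduceCyclically.conjugator x.toWord
  set r := reduceCyclically x.toWord
  have hr : r ≠ [] := by
    intro h0
    apply hx
    rw [← mk_toWord (x := x), ← h3, h0, List.append_nil, ← mul_mk, ← inv_mk, mul_inv_cancel]
  have hr' : 0 < r.length := List.length_pos_iff.2 hr
  have e1 : FreeGroup.norm x = c.length + r.length + c.length := by
    rw [FreeGroup.norm, ← h3]; simp [add_assoc]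
  have e2 : FreeGroup.norm (x * x) = c.length + (r.length + r.length) + c.length := by
    rw [← pow_two, FreeGroup.norm, h]; simp [List.replicate, add_assoc]
  omega

theorem two_mul_gromovProd_inv_lt {x : FreeGroup α} (hx : x ≠ 1) :
    2 * gromovProd x⁻¹ x < FreeGroup.norm x := by
  have := norm_mul_add x x
  have := norm_lt_norm_sq hx
  omega

/-- An element with letters of total length `n` splits at every position. -/
theorem exists_mul_of_le_norm (x : FreeGroup α) {n : ℕ} (hn : n ≤ FreeGroup.norm x) :
    ∃ p s : FreeGroup α, x = p * s ∧ FreeGroup.norm p = n ∧ FreeGroup.norm s = FreeGroup.norm x - n ∧ gromovProd p x = n := by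
  have key : ∀ w : List (α × Bool), n ≤ w.length → commonPrefix (w.take n) w = n := by
    clear hn
    induction n with
    | zero => intro w _; cases w <;> simp [commonPrefix]
    | succ n ih =>
      intro w hw
      cases w with
      | nil => simp at hw
      | cons a w => simp [commonPrefix, ih w (by simpa using hw)]
  have h1 : FreeGroup.IsReduced (x.toWord.take n) :=
    (isReduced_toWord (x := x)).infix ⟨[], x.toWord.drop n, by simp⟩
  have h2 : FreeGroup.IsReduced (x.toWord.drop n) :=
    (isReduced_toWord (x := x)).infix ⟨x.toWord.take n, [], by simp⟩
  refine ⟨mk (x.toWord.take n), mk (x.toWord.drop n), ?_, ?_, ?_, ?_⟩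
  · rw [mul_mk, List.take_append_drop, mk_toWord]
  · rw [FreeGroup.norm, toWord_mk, h1.reduce_eq, List.length_take]; exact min_eq_left hn
  · rw [FreeGroup.norm, toWord_mk, h2.reduce_eq, List.length_drop]; rfl
  · rw [gromovProd, toWord_mk, h1.reduce_eq]; exact key _ hn

theorem gromovProd_le_left (x y : FreeGroup α) : gromovProd x y ≤ FreeGroup.norm x := by
  have h1 := norm_inv_mul x y
  have h2 := norm_mul_le x (x⁻¹ * y)
  rw [mul_inv_cancel_left] at h2
  omega

end FreeGroupLength

/-! ### Nielsen's theorem in rank two -/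

/-- The value of a letter. -/
def letter (x : Fin 2 × Bool) : F2 := FreeGroup.mk [x]

theorem letter_inv (x : Fin 2 × Bool) : (letter x)⁻¹ = letter (x.1, !x.2) := rfl

theorem letter_norm_map (φ : MulAut F2) (x : Fin 2 × Bool) :
    FreeGroup.norm (φ (letter x)) = FreeGroup.norm (φ (FreeGroup.of x.1)) := by
  obtain ⟨i, b⟩ := x
  cases b
  · have : letter (i, false) = (FreeGroup.of i)⁻¹ := rfl
    rw [this, map_inv, FreeGroup.norm_inv_eq]
  · rfl

/-- Two letters may follow each other in a reduced word. -/
def Composable (x y : Fin 2 × Bool) : Prop := x.1 = y.1 → x.2 = y.2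

/-- Nielsen's condition for the images of the generators. -/
def NielsenReduced (φ : MulAut F2) : Prop :=
  ∀ x y z, Composable x y → Composable y z →
    gromovProd (φ (letter x))⁻¹ (φ (letter y)) + gromovProd (φ (letter y))⁻¹ (φ (letter z)) <
      FreeGroup.norm (φ (letter y))

/-- Cancellation on the two sides of each φ(y) never meets, so at least one letter of every φ(y)
survives. The first conjunct, that the initial cancellation sees only φ(y), is what lets the
induction continue. -/
theorem NielsenReduced.word {φ : MulAut F2} (h : NielsenReduced φ) (w : List (Fin 2 × Bool)) :
    ∀ y, FreeGroup.IsReduced (y :: w) → ∀ x, Composable x y →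
      gromovProd (φ (letter x))⁻¹ (φ (FreeGroup.mk (y :: w))) =
        gromovProd (φ (letter x))⁻¹ (φ (letter y)) ∧
      w.length + 1 + gromovProd (φ (letter x))⁻¹ (φ (letter y)) ≤
        FreeGroup.norm (φ (FreeGroup.mk (y :: w))) := by
  induction w with
  | nil =>
    intro y _ x hxy
    refine ⟨rfl, ?_⟩
    have := h x y y hxy (fun _ => rfl)
    change _ ≤ FreeGroup.norm (φ (letter y))
    simp only [List.length_nil]
    omega
  | cons z w ih =>
    intro y hy x hxy
    have hyz : Composable y z := (List.isChain_cons_cons.1 hy).1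
    obtain ⟨ih1, ih2⟩ := ih z (List.isChain_cons_cons.1 hy).2 y hyz
    have hprod : FreeGroup.mk (y :: z :: w) = letter y * FreeGroup.mk (z :: w) := by
      rw [letter, FreeGroup.mul_mk]; rfl
    rw [hprod, map_mul]
    set u := φ (letter y)
    set U := φ (FreeGroup.mk (z :: w))
    set v := (φ (letter x))⁻¹
    have h1 := norm_mul_add u U
    have h2 := norm_inv_mul u (u * U)
    rw [inv_mul_cancel_left] at h2
    have h3 : gromovProd v u + gromovProd u⁻¹ (φ (letter z)) < FreeGroup.norm u := h x y z hxy hyz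
    have h4 := gromovProd_min v u (u * U)
    have h5 := gromovProd_min v (u * U) u
    rw [gromovProd_comm (u * U) u] at h5
    simp only [List.length_cons]
    omega

theorem NielsenReduced.norm_le {φ : MulAut F2} (h : NielsenReduced φ) (g : F2) :
    FreeGroup.norm g ≤ FreeGroup.norm (φ g) := by
  have hr := FreeGroup.isReduced_toWord (x := g)
  rcases hw : g.toWord with _ | ⟨y, w⟩
  · simp [FreeGroup.norm, hw]
  · rw [hw] at hr
    have := (h.word w y hr y (fun _ => rfl)).2
    rw [← hw, FreeGroup.mk_toWord] at this
    rw [FreeGroup.norm, hw, List.length_cons]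
    omega

/-- An endomorphism of `F2` given by the images of the two generators. -/
def endo (g h : F2) : F2 →* F2 := FreeGroup.lift ![g, h]

@[simp] theorem endo_genA (g h : F2) : endo g h genA = g := by simp [endo, genA]

@[simp] theorem endo_genB (g h : F2) : endo g h genB = h := by simp [endo, genB]

theorem hom_ext {G : Type*} [Monoid G] {f f' : F2 →* G} (hA : f genA = f' genA)
    (hB : f genB = f' genB) : f = f' := by
  apply FreeGroup.ext_hom
  intro i
  fin_cases i
  · exact hA
  · exact hB

theorem aut_ext {φ ψ : MulAut F2} (hA : φ genA = ψ genA) (hB : φ genB = ψ genB) : φ = ψ := by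
  have : φ.toMonoidHom = ψ.toMonoidHom := hom_ext hA hB
  ext x
  exact DFunLike.congr_fun this x

/-- The automorphism inverting the second generator. -/
def invAut : MulAut F2 :=
  MonoidHom.toMulEquiv (endo genA genB⁻¹) (endo genA genB⁻¹) (hom_ext (by simp) (by simp))
    (hom_ext (by simp) (by simp))

/-- The transvection `α ↦ α`, `β ↦ α β`. -/
def mulAut : MulAut F2 :=
  MonoidHom.toMulEquiv (endo genA (genA * genB)) (endo genA (genA⁻¹ * genB))
    (hom_ext (by simp) (by simp)) (hom_ext (by simp) (by simp))

@[simp] theorem invAut_genA : invAut genA = genA := endo_genA genA genB⁻¹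
@[simp] theorem invAut_genB : invAut genB = genB⁻¹ := endo_genB genA genB⁻¹
@[simp] theorem mulAut_genA : mulAut genA = genA := endo_genA genA (genA * genB)
@[simp] theorem mulAut_genB : mulAut genB = genA * genB := endo_genB genA (genA * genB)
@[simp] theorem swapAut_genA : swapAut genA = genB := by simp [swapAut, genA, genB]
@[simp] theorem swapAut_genB : swapAut genB = genA := by simp [swapAut, genA, genB]

/-- The group generated by the elementary automorphisms and the inner ones. -/
def elementarySubgroup : Subgroup (MulAut F2) :=
  Subgroup.closure ({swapAut, invAut, mulAut} ∪ Set.range MulAut.conj)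

theorem swapAut_mem : swapAut ∈ elementarySubgroup := Subgroup.subset_closure (by simp)
theorem invAut_mem : invAut ∈ elementarySubgroup := Subgroup.subset_closure (by simp)
theorem mulAut_mem : mulAut ∈ elementarySubgroup := Subgroup.subset_closure (by simp)
theorem conj_mem (g : F2) : MulAut.conj g ∈ elementarySubgroup :=
  Subgroup.subset_closure (by simp)

theorem exists_signedPerm {x y : Fin 2 × Bool} (h : x.1 ≠ y.1) :
    ∃ δ ∈ elementarySubgroup, δ genA = letter x ∧ δ genB = letter y := by
  have s := swapAut_mem
  have i := invAut_mem
  have la : letter (0, true) = genA := rfl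
  have lb : letter (1, true) = genB := rfl
  have la' : letter (0, false) = genA⁻¹ := rfl
  have lb' : letter (1, false) = genB⁻¹ := rfl
  obtain ⟨x1, x2⟩ := x
  obtain ⟨y1, y2⟩ := y
  fin_cases x1 <;> fin_cases y1 <;> cases x2 <;> cases y2 <;> simp [la, lb, la', lb'] at h ⊢
  · exact ⟨_, mul_mem s (mul_mem i (mul_mem s i)), by simp⟩
  · exact ⟨_, mul_mem s (mul_mem i s), by simp⟩
  · exact ⟨_, i, by simp⟩
  · exact ⟨_, one_mem _, by simp⟩
  · exact ⟨_, mul_mem i (mul_mem s i), by simp⟩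
  · exact ⟨_, mul_mem i s, by simp⟩
  · exact ⟨_, mul_mem s i, by simp⟩
  · exact ⟨_, s, by simp⟩

/-- The total length of the images of the two generators. -/
def totalNorm (φ : MulAut F2) : ℕ := FreeGroup.norm (φ genA) + FreeGroup.norm (φ genB)

theorem totalNorm_eq (φ : MulAut F2) {x y : Fin 2 × Bool} (h : x.1 ≠ y.1) :
    totalNorm φ = FreeGroup.norm (φ (letter x)) + FreeGroup.norm (φ (letter y)) := by
  rw [letter_norm_map, letter_norm_map, totalNorm]
  obtain ⟨x1, x2⟩ := x
  obtain ⟨y1, y2⟩ := y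
  fin_cases x1 <;> fin_cases y1 <;> simp at h ⊢
  · rfl
  · exact add_comm _ _

theorem letter_ne_one (x : Fin 2 × Bool) : letter x ≠ 1 := by
  intro h
  have : (letter x).toWord = [x] := by rw [letter, FreeGroup.toWord_mk, FreeGroup.reduce_singleton]
  rw [h] at this
  simp at this

/-- Since φ does not decrease length, φ⁻¹ sends each generator to a single letter, so it is a signed
permutation. -/
theorem NielsenReduced.mem {φ : MulAut F2} (h : NielsenReduced φ) : φ ∈ elementarySubgroup := by
  have key : ∀ i : Fin 2, ∃ x, φ⁻¹ (FreeGroup.of i) = letter x := by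
    intro i
    have h1 := h.norm_le (φ⁻¹ (FreeGroup.of i))
    rw [MulAut.apply_inv_self, FreeGroup.norm_of] at h1
    have h2 : FreeGroup.norm (φ⁻¹ (FreeGroup.of i)) ≠ 0 := by
      rw [Ne, FreeGroup.norm_eq_zero, map_eq_one_iff _ (φ⁻¹ : MulAut F2).injective]
      exact FreeGroup.of_ne_one i
    have h3 : (φ⁻¹ (FreeGroup.of i)).toWord.length = 1 := by
      change FreeGroup.norm _ = 1; omega
    obtain ⟨x, hx⟩ := List.length_eq_one_iff.1 h3
    exact ⟨x, by rw [letter, ← hx, FreeGroup.mk_toWord]⟩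
  obtain ⟨x, hx⟩ := key 0
  obtain ⟨y, hy⟩ := key 1
  have hxy : x.1 ≠ y.1 := by
    intro hne
    have : x = y ∨ x = (y.1, !y.2) := by
      obtain ⟨x1, x2⟩ := x
      obtain ⟨y1, y2⟩ := y
      cases x2 <;> cases y2 <;> simp_all
    rcases this with rfl | rfl
    · have := (φ⁻¹ : MulAut F2).injective (hx.trans hy.symm)
      exact absurd (FreeGroup.of_injective this) (by decide)
    · rw [← letter_inv, ← hy, ← map_inv] at hx
      have := congrArg FreeGroup.toWord ((φ⁻¹ : MulAut F2).injective hx)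
      simp [FreeGroup.toWord_inv, FreeGroup.invRev] at this
  obtain ⟨δ, hδ, hA, hB⟩ := exists_signedPerm hxy
  have : φ⁻¹ = δ := aut_ext (hx.trans hA.symm) (hy.trans hB.symm)
  rw [← inv_mem_iff, this]
  exact hδ

theorem mem_of_move {φ δ : MulAut F2} (hδ : δ ∈ elementarySubgroup) (g : F2)
    (h : MulAut.conj g * φ * δ * mulAut ∈ elementarySubgroup) : φ ∈ elementarySubgroup := by
  rwa [Subgroup.mul_mem_cancel_right _ mulAut_mem, Subgroup.mul_mem_cancel_right _ hδ,
    Subgroup.mul_mem_cancel_left _ (conj_mem g)] at h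

/-- The second Nielsen move: if the two halves of `h` cancel on both sides of `g`, then
conjugation shortens the pair. -/
theorem norm_conj_lt {g h : F2} (hh : h ≠ 1) (h1 : 2 * gromovProd g⁻¹ h = FreeGroup.norm h)
    (h2 : 2 * gromovProd h⁻¹ g = FreeGroup.norm h) (h3 : FreeGroup.norm h ≤ FreeGroup.norm g) :
    ∃ p : F2, FreeGroup.norm (p⁻¹ * h * p) + FreeGroup.norm (p⁻¹ * (h * g) * p) <
      FreeGroup.norm h + FreeGroup.norm g := by
  have hpos : FreeGroup.norm h ≠ 0 := by rwa [Ne, FreeGroup.norm_eq_zero]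
  set n := gromovProd g⁻¹ h with hn
  obtain ⟨p, t, rfl, hp, ht, hpg⟩ := exists_mul_of_le_norm h (n := n) (by omega)
  -- Here h = p t with halves of equal length, and g begins with t⁻¹ and ends with p⁻¹. Conjugation
  -- turns h into t p, no longer than h, and h g into t g p, where g loses both ends; the two ends
  -- are disjoint because |h| ≤ |g|.
  refine ⟨p, ?_⟩
  have e1 : p⁻¹ * (p * t) * p = t * p := by group
  have e2 : p⁻¹ * (p * t * g) * p = t * (g * p) := by group
  rw [e1, e2]
  have a1 := FreeGroup.norm_mul_le t p
  have a2 := norm_mul_add g p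
  have a3 := gromovProd_min g⁻¹ (p * t) p
  rw [gromovProd_comm (p * t) p] at a3
  have a4 := gromovProd_le_left p g⁻¹
  rw [gromovProd_comm] at a4
  have a5 := norm_inv_mul t⁻¹ (p * t)⁻¹
  have e3 : t⁻¹⁻¹ * (p * t)⁻¹ = p⁻¹ := by group
  rw [e3, FreeGroup.norm_inv_eq, FreeGroup.norm_inv_eq, FreeGroup.norm_inv_eq] at a5
  have a6 := gromovProd_min t⁻¹ (p * t)⁻¹ g
  have a7 := norm_inv_mul g (g * p)
  rw [inv_mul_cancel_left] at a7
  have a8 := gromovProd_min t⁻¹ g (g * p)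
  have a9 := norm_mul_add t (g * p)
  omega

/-- Nielsen's descent on the total length of the images: either a transvection, possibly followed by
a conjugation, shortens the pair, or the pair is Nielsen reduced. -/
theorem mem_elementarySubgroup (φ : MulAut F2) : φ ∈ elementarySubgroup := by
  induction hT : totalNorm φ using Nat.strong_induction_on generalizing φ with
  | _ n ih =>
  subst hT
  have hne : ∀ x, φ (letter x) ≠ 1 := fun x => by
    rw [Ne, map_eq_one_iff _ φ.injective]; exact letter_ne_one x
  by_cases hN1 : ∀ x y : Fin 2 × Bool, x.1 ≠ y.1 →
      FreeGroup.norm (φ (letter y)) ≤ FreeGroup.norm (φ (letter x) * φ (letter y))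
  swap
  · push Not at hN1
    obtain ⟨x, y, hxy, hlt⟩ := hN1
    obtain ⟨δ, hδ, hA, hB⟩ := exists_signedPerm hxy
    apply mem_of_move hδ 1
    apply ih _ _ _ rfl
    rw [totalNorm_eq φ hxy, totalNorm]
    simpa [hA, hB] using hlt
  by_cases hN2 : ∀ x y : Fin 2 × Bool, x.1 ≠ y.1 →
      ¬ (2 * gromovProd (φ (letter x))⁻¹ (φ (letter y)) = FreeGroup.norm (φ (letter y)) ∧
        2 * gromovProd (φ (letter y))⁻¹ (φ (letter x)) = FreeGroup.norm (φ (letter y)))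
  swap
  · push Not at hN2
    obtain ⟨y, x, hxy, h1, h2⟩ := hN2
    have h3 := hN1 y x hxy
    have h4 := norm_mul_add (φ (letter y)) (φ (letter x))
    obtain ⟨p, hp⟩ := norm_conj_lt (hne x) h1 h2 (by omega)
    obtain ⟨δ, hδ, hA, hB⟩ := exists_signedPerm hxy.symm
    apply mem_of_move hδ p⁻¹
    apply ih _ _ _ rfl
    rw [totalNorm_eq φ hxy.symm, totalNorm]
    simpa [hA, hB] using hp
  apply NielsenReduced.mem
  have half : ∀ x y : Fin 2 × Bool, x.1 ≠ y.1 →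
      2 * gromovProd (φ (letter x))⁻¹ (φ (letter y)) ≤ FreeGroup.norm (φ (letter y)) ∧
      2 * gromovProd (φ (letter x))⁻¹ (φ (letter y)) ≤ FreeGroup.norm (φ (letter x)) := by
    intro x y hxy
    have h1 := hN1 x y hxy
    have h2 := hN1 (y.1, !y.2) (x.1, !x.2) hxy.symm
    rw [← letter_inv, ← letter_inv, map_inv, map_inv, ← mul_inv_rev, FreeGroup.norm_inv_eq,
      FreeGroup.norm_inv_eq] at h2
    have h4 := norm_mul_add (φ (letter x)) (φ (letter y))
    omega
  intro x y z hxy hyz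
  have hyy := two_mul_gromovProd_inv_lt (hne y)
  by_cases h1 : x.1 = y.1
  · have : x = y := Prod.ext h1 (hxy h1)
    subst this
    by_cases h2 : x.1 = z.1
    · have : x = z := Prod.ext h2 (hyz h2)
      subst this
      omega
    · have := (half x z h2).2
      omega
  · have hx := (half x y h1).1
    by_cases h2 : y.1 = z.1
    · have : y = z := Prod.ext h2 (hyz h2)
      subst this
      omega
    · have hz := (half y z h2).2
      by_contra hcon
      -- In rank two both neighbours of y use the other generator. If they agree, exactly half of
      -- φ(y) cancels on each side, which `hN2` forbids. If they are inverse, φ(y) and its inverse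
      -- share an initial half, against `hyy`.
      have hxz : x = z ∨ x = (z.1, !z.2) := by
        obtain ⟨x1, x2⟩ := x
        obtain ⟨y1, y2⟩ := y
        obtain ⟨z1, z2⟩ := z
        simp only [Prod.mk.injEq]
        simp only at h1 h2
        have : x1 = z1 := by omega
        cases x2 <;> cases z2 <;> simp [this]
      rcases hxz with rfl | rfl
      · exact hN2 x y h1 ⟨by omega, by omega⟩
      · rw [← letter_inv, map_inv, inv_inv] at hcon hx
        have := gromovProd_min (φ (letter y))⁻¹ (φ (letter z)) (φ (letter y))
        omega

/-! ### Outer automorphisms of `F2` and integer matrices -/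

section NormalForm

variable {G : Type*} [Group G] {s i l : G}

/-- Signed permutations permute the four elementary transvections, so they can be moved past them
when an element is put in normal form. -/
theorem transvection_conj (hs : s * s = 1) (hi : i * i = 1) (h1 : i * l * i = l⁻¹)
    (h2 : s * i * s * l * (s * i * s) = l⁻¹) {δ : G} (hδ : δ ∈ Subgroup.closure {s, i}) :
    ∀ t ∈ ({l, l⁻¹, s * l * s, (s * l * s)⁻¹} : Set G),
      δ * t * δ⁻¹ ∈ ({l, l⁻¹, s * l * s, (s * l * s)⁻¹} : Set G) := by
  have hs' : s⁻¹ = s := inv_eq_of_mul_eq_one_left hs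
  have hi' : i⁻¹ = i := inv_eq_of_mul_eq_one_left hi
  have hss : ∀ x, s * (s * x) = x := fun x => by rw [← mul_assoc, hs, one_mul]
  have hii : ∀ x, i * (i * x) = x := fun x => by rw [← mul_assoc, hi, one_mul]
  have h1' : i * l⁻¹ * i = l := by rw [← h1]; simp [mul_assoc, hi, hii]
  have h3 : i * (s * l * s) * i = (s * l * s)⁻¹ := by
    have := congrArg (fun x => s * x * s) h2
    simp only [mul_assoc, hss, hs, mul_one] at this
    simp only [mul_inv_rev, hs', mul_assoc, this]
  have h3' : i * (s * l * s)⁻¹ * i = s * l * s := by rw [← h3]; simp [mul_assoc, hi, hii]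
  have base : ∀ x ∈ ({s, i} : Set G), x⁻¹ = x ∧
      ∀ t ∈ ({l, l⁻¹, s * l * s, (s * l * s)⁻¹} : Set G),
        x * t * x ∈ ({l, l⁻¹, s * l * s, (s * l * s)⁻¹} : Set G) := by
    rintro x (rfl | rfl)
    · refine ⟨hs', ?_⟩
      rintro t (rfl | rfl | rfl | rfl)
      · simp
      · right; right; right; simp [hs', mul_assoc]
      · left; simp [mul_assoc, hs, hss]
      · right; left; simp [hs', mul_assoc, hs, hss]
    · refine ⟨hi', ?_⟩
      rintro t (rfl | rfl | rfl | rfl)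
      · rw [h1]; simp
      · rw [h1']; simp
      · rw [h3]; simp
      · rw [h3']; simp
  induction hδ using Subgroup.closure_induction_left with
  | one => intro t ht; simpa using ht
  | mul_left x hx y _ hy =>
    intro t ht
    have := (base x hx).2 _ (hy t ht)
    rw [show x * y * t * (x * y)⁻¹ = x * (y * t * y⁻¹) * x⁻¹ by group, (base x hx).1]
    exact this
  | inv_mul_cancel x hx y _ hy =>
    intro t ht
    have := (base x hx).2 _ (hy t ht)
    rw [(base x hx).1, show x * y * t * (x * y)⁻¹ = x * (y * t * y⁻¹) * x⁻¹ by group,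
      (base x hx).1]
    exact this

/-- Only a negative factor needs an argument. It cancels against an equal last letter of P; against
the other letter, the relation `h3` replaces the product by a positive letter times a signed
permutation; if P is trivial, conjugation by i makes it positive. -/
theorem positive_mul_transvection (hs : s * s = 1) (h1 : i * l * i = l⁻¹)
    (h2 : s * i * s * l * (s * i * s) = l⁻¹) (h3 : s * l * s * l⁻¹ = l * (s * i)) {P : G}
    (hP : P ∈ Submonoid.closure {l, s * l * s}) {t : G}
    (ht : t ∈ ({l, l⁻¹, s * l * s, (s * l * s)⁻¹} : Set G)) :
    ∃ ε ∈ Subgroup.closure {s, i}, ∃ Q ∈ Submonoid.closure {l, s * l * s},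
      ∃ δ ∈ Subgroup.closure {s, i}, P * t = ε * Q * δ := by
  have hs' : s⁻¹ = s := inv_eq_of_mul_eq_one_left hs
  have hss : ∀ x, s * (s * x) = x := fun x => by rw [← mul_assoc, hs, one_mul]
  have sD : s ∈ Subgroup.closure {s, i} := Subgroup.subset_closure (by simp)
  have iD : i ∈ Subgroup.closure {s, i} := Subgroup.subset_closure (by simp)
  have lP : l ∈ Submonoid.closure {l, s * l * s} := Submonoid.subset_closure (by simp)
  have rP : s * l * s ∈ Submonoid.closure {l, s * l * s} := Submonoid.subset_closure (by simp)
  have h4 : i * (s * l * s) * i = (s * l * s)⁻¹ := by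
    have := congrArg (fun x => s * x * s) h2
    simp only [mul_assoc, hss, hs, mul_one] at this
    simp only [mul_inv_rev, hs', mul_assoc, this]
  have h5 : l * (s * l * s)⁻¹ = s * l * s * (i * s) := by
    have := congrArg (fun x => s * x * s) h3
    simp only [mul_assoc, hss] at this
    simp only [mul_inv_rev, hs', mul_assoc, this]
  rcases ht with rfl | rfl | rfl | rfl
  · exact ⟨1, one_mem _, _, mul_mem hP lP, 1, one_mem _, by simp⟩
  · induction hP using Submonoid.closure_induction_right with
    | one => exact ⟨i, iD, _, lP, i, iD, by rw [one_mul, h1]⟩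
    | mul_right x hx y hy _ =>
      rcases hy with rfl | rfl
      · exact ⟨1, one_mem _, x, hx, 1, one_mem _, by simp⟩
      · exact ⟨1, one_mem _, _, mul_mem hx lP, _, mul_mem sD iD, by
          rw [mul_assoc, h3, one_mul, mul_assoc]⟩
  · exact ⟨1, one_mem _, _, mul_mem hP rP, 1, one_mem _, by simp⟩
  · induction hP using Submonoid.closure_induction_right with
    | one => exact ⟨i, iD, _, rP, i, iD, by rw [one_mul, h4]⟩
    | mul_right x hx y hy _ =>
      rcases hy with rfl | rfl
      · exact ⟨1, one_mem _, _, mul_mem hx rP, _, mul_mem iD sD, by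
          rw [mul_assoc, h5, one_mul, ← mul_assoc]⟩
      · exact ⟨1, one_mem _, x, hx, 1, one_mem _, by
          rw [mul_inv_cancel_right, one_mul, mul_one]⟩

/-- In a group with the relations of `GL₂(ℤ)`, each element is positive up to signed
permutations on both sides. -/
theorem exists_positive (hs : s * s = 1) (hi : i * i = 1) (h1 : i * l * i = l⁻¹)
    (h2 : s * i * s * l * (s * i * s) = l⁻¹) (h3 : s * l * s * l⁻¹ = l * (s * i)) {g : G}
    (hg : g ∈ Subgroup.closure {s, i, l}) :
    ∃ ε ∈ Subgroup.closure {s, i}, ∃ P ∈ Submonoid.closure {l, s * l * s},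
      ∃ δ ∈ Subgroup.closure {s, i}, g = ε * P * δ := by
  have sD : s ∈ Subgroup.closure {s, i} := Subgroup.subset_closure (by simp)
  have iD : i ∈ Subgroup.closure {s, i} := Subgroup.subset_closure (by simp)
  have step : ∀ t ∈ ({l, l⁻¹, s * l * s, (s * l * s)⁻¹} : Set G), ∀ g,
      (∃ ε ∈ Subgroup.closure {s, i}, ∃ P ∈ Submonoid.closure {l, s * l * s},
        ∃ δ ∈ Subgroup.closure {s, i}, g = ε * P * δ) →
      ∃ ε ∈ Subgroup.closure {s, i}, ∃ P ∈ Submonoid.closure {l, s * l * s},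
        ∃ δ ∈ Subgroup.closure {s, i}, g * t = ε * P * δ := by
    rintro t ht g ⟨ε, hε, P, hP, δ, hδ, rfl⟩
    have ht' := transvection_conj hs hi h1 h2 hδ t ht
    obtain ⟨ε', hε', Q, hQ, δ', hδ', h⟩ := positive_mul_transvection hs h1 h2 h3 hP ht'
    refine ⟨_, mul_mem hε hε', Q, hQ, _, mul_mem hδ' hδ, ?_⟩
    calc ε * P * δ * t = ε * (P * (δ * t * δ⁻¹)) * δ := by group
      _ = _ := by rw [h]; group
  induction hg using Subgroup.closure_induction_right with
  | one => exact ⟨1, one_mem _, 1, one_mem _, 1, one_mem _, by simp⟩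
  | mul_right x _ y hy ih =>
    rcases hy with rfl | rfl | rfl
    · obtain ⟨ε, hε, P, hP, δ, hδ, rfl⟩ := ih
      exact ⟨ε, hε, P, hP, _, mul_mem hδ sD, by rw [mul_assoc]⟩
    · obtain ⟨ε, hε, P, hP, δ, hδ, rfl⟩ := ih
      exact ⟨ε, hε, P, hP, _, mul_mem hδ iD, by rw [mul_assoc]⟩
    · exact step _ (by simp) _ ih
  | mul_inv_cancel x _ y hy ih =>
    rcases hy with rfl | rfl | rfl
    · obtain ⟨ε, hε, P, hP, δ, hδ, rfl⟩ := ih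
      exact ⟨ε, hε, P, hP, _, mul_mem hδ (inv_mem sD), by rw [mul_assoc]⟩
    · obtain ⟨ε, hε, P, hP, δ, hδ, rfl⟩ := ih
      exact ⟨ε, hε, P, hP, _, mul_mem hδ (inv_mem iD), by rw [mul_assoc]⟩
    · exact step _ (by simp) _ ih

end NormalForm

/-! ### Homology classes and the matrix of an automorphism -/

/-- The abelianization of `F2`. -/
def abHom : F2 →* Multiplicative (ℤ × ℤ) :=
  FreeGroup.lift ![Multiplicative.ofAdd (1, 0), Multiplicative.ofAdd (0, 1)]

/-- The homology class of an element of `F2`. -/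
def vec (g : F2) : ℤ × ℤ := (abHom g).toAdd

@[simp] theorem vec_genA : vec genA = (1, 0) := by simp [vec, abHom, genA]
@[simp] theorem vec_genB : vec genB = (0, 1) := by simp [vec, abHom, genB]
@[simp] theorem vec_mul (g h : F2) : vec (g * h) = vec g + vec h := by simp [vec]
@[simp] theorem vec_inv (g : F2) : vec g⁻¹ = -vec g := by simp [vec]
@[simp] theorem vec_zpow (g : F2) (n : ℤ) : vec (g ^ n) = n • vec g := by simp [vec]
@[simp] theorem vec_pow (g : F2) (n : ℕ) : vec (g ^ n) = n • vec g := by simp [vec]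

theorem vec_map (f : F2 →* F2) (g : F2) :
    vec (f g) = (vec g).1 • vec (f genA) + (vec g).2 • vec (f genB) := by
  have : abHom.comp f =
      (AddMonoidHom.toMultiplicative
        ((zmultiplesHom _ (vec (f genA))).comp (AddMonoidHom.fst ℤ ℤ) +
          (zmultiplesHom _ (vec (f genB))).comp (AddMonoidHom.snd ℤ ℤ))).comp abHom :=
    hom_ext (by simp [abHom, genA]; rfl) (by simp [abHom, genB]; rfl)
  exact DFunLike.congr_fun this g

theorem vec_aut (φ : MulAut F2) (g : F2) :
    vec (φ g) = (vec g).1 • vec (φ genA) + (vec g).2 • vec (φ genB) := vec_map φ.toMonoidHom g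

/-- The sum of the moduli of the entries of the matrix of an automorphism. -/
def matSize (φ : MulAut F2) : ℤ :=
  |(vec (φ genA)).1| + |(vec (φ genA)).2| + |(vec (φ genB)).1| + |(vec (φ genB)).2|

theorem matSize_mul_signedPerm {δ : MulAut F2} (hδ : δ ∈ Subgroup.closure {swapAut, invAut}) :
    ∀ φ, matSize (φ * δ) = matSize φ ∧ matSize (δ * φ) = matSize φ := by
  have hsv : ∀ g, vec (swapAut g) = ((vec g).2, (vec g).1) := by
    intro g; rw [vec_aut]; ext <;> simp
  have hiv : ∀ g, vec (invAut g) = ((vec g).1, -(vec g).2) := by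
    intro g; rw [vec_aut]; ext <;> simp
  induction hδ using Subgroup.closure_induction with
  | mem x hx =>
    rcases hx with rfl | rfl
    · intro φ
      simp only [matSize, MulAut.mul_apply, hsv, swapAut_genA, swapAut_genB]
      constructor <;> ring
    · intro φ
      simp [matSize, MulAut.mul_apply, hiv]
  | one => simp
  | mul x y _ _ hx hy =>
    intro φ
    rw [← mul_assoc, (hy _).1, (hx _).1, mul_assoc, (hx _).2, (hy _).2]
    exact ⟨rfl, rfl⟩
  | inv x _ hx =>
    intro φ
    have h1 := (hx (φ * x⁻¹)).1
    have h2 := (hx (x⁻¹ * φ)).2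
    rw [inv_mul_cancel_right] at h1
    rw [mul_inv_cancel_left] at h2
    exact ⟨h1.symm, h2.symm⟩

/-- Each positive factor adds one column of the matrix to the other. Determinant one keeps the
columns nonzero, so the size strictly increases from its value 2 at the identity. -/
theorem matSize_positive {P : MulAut F2}
    (hP : P ∈ Submonoid.closure {mulAut, swapAut * mulAut * swapAut}) :
    0 ≤ (vec (P genA)).1 ∧ 0 ≤ (vec (P genA)).2 ∧ 0 ≤ (vec (P genB)).1 ∧ 0 ≤ (vec (P genB)).2 ∧
      (vec (P genA)).1 * (vec (P genB)).2 - (vec (P genB)).1 * (vec (P genA)).2 = 1 ∧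
      (P = 1 ∨ 3 ≤ matSize P) := by
  induction hP using Submonoid.closure_induction_right with
  | one => simp
  | mul_right x _ y hy ih =>
    obtain ⟨h1, h2, h3, h4, h5, h6⟩ := ih
    have hx : 2 ≤ matSize x := by
      rcases h6 with rfl | h6
      · simp [matSize]
      · omega
    rw [matSize, abs_of_nonneg h1, abs_of_nonneg h2, abs_of_nonneg h3, abs_of_nonneg h4] at hx
    rcases hy with rfl | rfl
    · simp only [MulAut.mul_apply, mulAut_genA, mulAut_genB, map_mul, vec_mul, Prod.fst_add,
        Prod.snd_add, matSize]
      refine ⟨h1, h2, by positivity, by positivity, by linarith, Or.inr ?_⟩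
      rw [abs_of_nonneg h1, abs_of_nonneg h2, abs_of_nonneg (add_nonneg h1 h3),
        abs_of_nonneg (add_nonneg h2 h4)]
      have : 0 < (vec (x genA)).1 + (vec (x genA)).2 := by
        by_contra hc
        have e1 : (vec (x genA)).1 = 0 := by omega
        have e2 : (vec (x genA)).2 = 0 := by omega
        simp [e1, e2] at h5
      omega
    · simp only [MulAut.mul_apply, mulAut_genA, mulAut_genB, map_mul, vec_mul, Prod.fst_add,
        Prod.snd_add, matSize, swapAut_genA, swapAut_genB]
      refine ⟨by positivity, by positivity, h3, h4, by linarith, Or.inr ?_⟩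
      rw [abs_of_nonneg h3, abs_of_nonneg h4, abs_of_nonneg (add_nonneg h3 h1),
        abs_of_nonneg (add_nonneg h4 h2)]
      have : 0 < (vec (x genB)).1 + (vec (x genB)).2 := by
        by_contra hc
        have e1 : (vec (x genB)).1 = 0 := by omega
        have e2 : (vec (x genB)).2 = 0 := by omega
        simp [e1, e2] at h5
      omega

theorem signedPerm_letters {δ : MulAut F2} (hδ : δ ∈ Subgroup.closure {swapAut, invAut}) :
    ∀ x, ∃ y, δ (letter x) = letter y := by
  have la : letter (0, true) = genA := rfl
  have lb : letter (1, true) = genB := rfl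
  have la' : letter (0, false) = genA⁻¹ := rfl
  have lb' : letter (1, false) = genB⁻¹ := rfl
  have hs : swapAut⁻¹ = swapAut :=
    inv_eq_of_mul_eq_one_left (aut_ext (by simp) (by simp))
  have hi : invAut⁻¹ = invAut :=
    inv_eq_of_mul_eq_one_left (aut_ext (by simp) (by simp))
  have base : ∀ x ∈ ({swapAut, invAut} : Set (MulAut F2)), ∀ z, ∃ y, x (letter z) = letter y := by
    rintro x (rfl | rfl) ⟨z1, z2⟩
    · fin_cases z1 <;> cases z2
      · exact ⟨(1, false), by simp [la', lb']⟩
      · exact ⟨(1, true), by simp [la, lb]⟩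
      · exact ⟨(0, false), by simp [la', lb']⟩
      · exact ⟨(0, true), by simp [la, lb]⟩
    · fin_cases z1 <;> cases z2
      · exact ⟨(0, false), by simp [la']⟩
      · exact ⟨(0, true), by simp [la]⟩
      · exact ⟨(1, true), by simp [lb, lb']⟩
      · exact ⟨(1, false), by simp [lb, lb']⟩
  induction hδ using Subgroup.closure_induction_left with
  | one => exact fun x => ⟨x, rfl⟩
  | mul_left x hx y _ ih =>
    intro z
    obtain ⟨z', h⟩ := ih z
    obtain ⟨z'', h'⟩ := base x hx z'
    exact ⟨z'', by rw [MulAut.mul_apply, h, h']⟩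
  | inv_mul_cancel x hx y _ ih =>
    have hx' : x⁻¹ = x := by rcases hx with rfl | rfl <;> assumption
    intro z
    obtain ⟨z', h⟩ := ih z
    obtain ⟨z'', h'⟩ := base x hx z'
    exact ⟨z'', by rw [hx', MulAut.mul_apply, h, h']⟩

theorem vec_letter (x : Fin 2 × Bool) :
    vec (letter x) = (if x.1 = 0 then (cond x.2 1 (-1), 0) else (0, cond x.2 1 (-1))) := by
  have la : letter (0, true) = genA := rfl
  have lb : letter (1, true) = genB := rfl
  have la' : letter (0, false) = genA⁻¹ := rfl
  have lb' : letter (1, false) = genB⁻¹ := rfl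
  obtain ⟨x1, x2⟩ := x
  fin_cases x1 <;> cases x2 <;> simp [la, lb, la', lb']

theorem letter_eq_genA {x : Fin 2 × Bool} (h : vec (letter x) = (1, 0)) : letter x = genA := by
  rw [vec_letter] at h
  obtain ⟨x1, x2⟩ := x
  fin_cases x1 <;> cases x2 <;> simp at h
  rfl

theorem letter_eq_genB {x : Fin 2 × Bool} (h : vec (letter x) = (0, 1)) : letter x = genB := by
  rw [vec_letter] at h
  obtain ⟨x1, x2⟩ := x
  fin_cases x1 <;> cases x2 <;> simp at h
  rfl

theorem conj_range_normal : (MulAut.conj (G := F2)).range.Normal := by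
  constructor
  rintro _ ⟨c, rfl⟩ φ
  refine ⟨φ c, ?_⟩
  ext x
  simp [MulAut.mul_apply]

/-- An automorphism acting trivially on homology is inner. -/
theorem inner_of_vec_eq {φ : MulAut F2} (hA : vec (φ genA) = (1, 0)) (hB : vec (φ genB) = (0, 1)) :
    ∃ c, φ = MulAut.conj c := by
  have := conj_range_normal
  let q := QuotientGroup.mk' (MulAut.conj (G := F2)).range
  have hq : ∀ (c : F2) (ψ χ : MulAut F2), MulAut.conj c * ψ = χ → q ψ = q χ := by
    rintro c ψ _ rfl
    have : q (MulAut.conj c) = 1 := (QuotientGroup.eq_one_iff _).2 ⟨c, rfl⟩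
    rw [map_mul, this, one_mul]
  have hs : swapAut⁻¹ = swapAut :=
    inv_eq_of_mul_eq_one_left (aut_ext (by simp) (by simp))
  -- Modulo inner automorphisms three generators remain; unlike in the full automorphism group, they
  -- satisfy all the relations required by the normal form.
  have hg : q φ ∈ Subgroup.closure {q swapAut, q invAut, q mulAut} := by
    have h1 := mem_elementarySubgroup φ
    have h2 : q φ ∈ elementarySubgroup.map q := ⟨φ, h1, rfl⟩
    rw [elementarySubgroup, MonoidHom.map_closure] at h2
    refine (Subgroup.closure_le _).2 ?_ h2
    rintro _ ⟨x, (hx | ⟨c, rfl⟩), rfl⟩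
    · apply Subgroup.subset_closure
      rcases hx with rfl | rfl | rfl <;> simp
    · have : q (MulAut.conj c) = 1 := (QuotientGroup.eq_one_iff _).2 ⟨c, rfl⟩
      rw [this]
      exact one_mem _
  have hinv : mulAut⁻¹ genA = genA ∧ mulAut⁻¹ genB = genA⁻¹ * genB := by
    constructor <;> apply mulAut.injective <;> simp
  obtain ⟨ε', hε', P', hP', δ', hδ', h⟩ := exists_positive (s := q swapAut) (i := q invAut)
    (l := q mulAut)
    (by rw [← map_mul, ← map_one q]; congr 1; exact aut_ext (by simp) (by simp))
    (by rw [← map_mul, ← map_one q]; congr 1; exact aut_ext (by simp) (by simp))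
    (by
      simp only [← map_mul, ← map_inv]
      exact hq genA⁻¹ _ _ (aut_ext (by simp [hinv]) (by simp [hinv, mul_assoc])))
    (by
      simp only [← map_mul, ← map_inv]
      exact hq 1 _ _ (aut_ext (by simp [hinv]) (by simp [hinv])))
    (by
      simp only [← map_mul, ← map_inv]
      exact hq genA _ _ (aut_ext (by simp [hinv, mul_assoc]) (by simp [hinv]))) hg
  have lift1 : ∀ x ∈ Subgroup.closure {q swapAut, q invAut},
      ∃ y ∈ Subgroup.closure {swapAut, invAut}, q y = x := by
    intro x hx
    rwa [← Set.image_pair, ← MonoidHom.map_closure] at hx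
  have lift2 : ∀ x ∈ Submonoid.closure {q mulAut, q swapAut * q mulAut * q swapAut},
      ∃ y ∈ Submonoid.closure {mulAut, swapAut * mulAut * swapAut}, q y = x := by
    intro x hx
    rwa [← map_mul, ← map_mul, ← Set.image_pair, ← MonoidHom.map_mclosure] at hx
  obtain ⟨ε, hε, rfl⟩ := lift1 _ hε'
  obtain ⟨P, hP, rfl⟩ := lift2 _ hP'
  obtain ⟨δ, hδ, rfl⟩ := lift1 _ hδ'
  have h' : φ⁻¹ * (ε * P * δ) ∈ (MulAut.conj (G := F2)).range := by
    refine QuotientGroup.eq.1 (show q φ = q (ε * P * δ) from ?_)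
    simpa only [map_mul] using h
  obtain ⟨c, hc⟩ := h'
  have hφ : ε * P * δ = φ * MulAut.conj c := by rw [hc]; group
  have hvA : vec ((ε * P * δ) genA) = (1, 0) := by
    rw [hφ, MulAut.mul_apply, vec_aut]; simp [hA, hB]
  have hvB : vec ((ε * P * δ) genB) = (0, 1) := by
    rw [hφ, MulAut.mul_apply, vec_aut]; simp [hA, hB]
  -- Signed permutations do not change the size and the product has identity matrix, so P is too
  -- small to be a nontrivial positive element.
  have hsize : matSize P = 2 := by
    rw [← (matSize_mul_signedPerm hε P).2, ← (matSize_mul_signedPerm hδ _).1, matSize, hvA, hvB]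
    rfl
  have hP1 : P = 1 := by
    rcases (matSize_positive hP).2.2.2.2.2 with h | h
    · exact h
    · omega
  subst hP1
  rw [mul_one] at hφ hvA hvB
  have hεδ : ε * δ = 1 := by
    have hm := mul_mem hε hδ
    obtain ⟨y, hy⟩ := signedPerm_letters hm (0, true)
    obtain ⟨z, hz⟩ := signedPerm_letters hm (1, true)
    change (ε * δ) genA = _ at hy
    change (ε * δ) genB = _ at hz
    rw [hy] at hvA
    rw [hz] at hvB
    exact aut_ext (hy.trans (letter_eq_genA hvA)) (hz.trans (letter_eq_genB hvB))
  refine ⟨c⁻¹, ?_⟩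
  rw [map_inv, eq_inv_iff_mul_eq_one, ← hφ, hεδ]

/-- The determinant of an automorphism. -/
theorem det_sq (φ : MulAut F2) :
    ((vec (φ genA)).1 * (vec (φ genB)).2 - (vec (φ genB)).1 * (vec (φ genA)).2) ^ 2 = 1 := by
  have h1 : vec (φ (φ⁻¹ genA)) = (1, 0) := by simp
  have h2 : vec (φ (φ⁻¹ genB)) = (0, 1) := by simp
  rw [vec_aut] at h1 h2
  simp only [Prod.ext_iff, Prod.fst_add, Prod.snd_add, Prod.smul_fst, Prod.smul_snd,
    smul_eq_mul] at h1 h2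
  have : ((vec (φ genA)).1 * (vec (φ genB)).2 - (vec (φ genB)).1 * (vec (φ genA)).2) *
      ((vec (φ⁻¹ genA)).1 * (vec (φ⁻¹ genB)).2 - (vec (φ⁻¹ genB)).1 * (vec (φ⁻¹ genA)).2) = 1 := by
    linear_combination
      ((vec (φ⁻¹ genB)).1 * (vec (φ genA)).2 + (vec (φ⁻¹ genB)).2 * (vec (φ genB)).2) * h1.1 + h2.2 -
      ((vec (φ⁻¹ genB)).1 * (vec (φ genA)).1 + (vec (φ⁻¹ genB)).2 * (vec (φ genB)).1) * h1.2
  rcases Int.eq_one_or_neg_one_of_mul_eq_one this with h | h <;> rw [h] <;> norm_num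

/-- The automorphism χ = φ⁻¹ψ fixes the class of `genA`, so the class of χ(`genB`) is (n, ±1).
Precomposing with a power of `mulAut`, and `invAut` if needed, does not move χ(`genA`) and makes the
action on homology trivial; the result is inner. -/
theorem isConj_of_vec_eq {φ ψ : MulAut F2} (h : vec (ψ genA) = vec (φ genA)) :
    IsConj (φ genA) (ψ genA) := by
  obtain ⟨χ, rfl⟩ : ∃ χ, ψ = φ * χ := ⟨φ⁻¹ * ψ, by group⟩
  have hA : vec (χ genA) = (1, 0) := by
    have : χ genA = φ⁻¹ ((φ * χ) genA) := by simp [MulAut.mul_apply]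
    rw [this, vec_aut, h, ← vec_aut]
    simp
  have key : ∃ c, χ genA = c * genA * c⁻¹ := by
    have hd := det_sq χ
    rw [hA] at hd
    simp only [one_mul, mul_zero, sub_zero] at hd
    have hl : ∀ n : ℤ, (mulAut ^ n) genA = genA := by
      intro n
      have : mulAut ∈ MulAction.stabilizer (MulAut F2) genA := mulAut_genA
      exact Subgroup.zpow_mem _ this n
    have hl' : ∀ n : ℤ, vec ((mulAut ^ n) genB) = (n, 1) := by
      intro n
      induction n using Int.induction_on with
      | zero => simp
      | succ n ih =>
        rw [zpow_add, zpow_one, MulAut.mul_apply, mulAut_genB, map_mul, vec_mul, ih, hl]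
        simp [add_comm]
      | pred n ih =>
        have : mulAut⁻¹ genB = genA⁻¹ * genB := by
          apply mulAut.injective
          simp
        rw [zpow_sub, zpow_one, MulAut.mul_apply, this, map_mul, vec_mul, ih, map_inv, hl]
        simp [sub_eq_neg_add]
    have hn : vec ((χ * mulAut ^ (-(vec (χ genB)).1)) genB) = (0, (vec (χ genB)).2) := by
      rw [MulAut.mul_apply, vec_aut, hl', hA]
      ext <;> simp
    have hm : (χ * mulAut ^ (-(vec (χ genB)).1)) genA = χ genA := by
      rw [MulAut.mul_apply, hl]
    rcases mul_self_eq_one_iff.1 ((sq _).symm.trans hd) with h | h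
    · obtain ⟨c, hc⟩ := inner_of_vec_eq (φ := χ * mulAut ^ (-(vec (χ genB)).1))
        (by rw [hm, hA]) (by rw [hn, h])
      exact ⟨c, by rw [← hm, hc, MulAut.conj_apply]⟩
    · obtain ⟨c, hc⟩ := inner_of_vec_eq (φ := χ * mulAut ^ (-(vec (χ genB)).1) * invAut)
        (by rw [MulAut.mul_apply, invAut_genA, hm, hA])
        (by rw [MulAut.mul_apply, invAut_genB, map_inv, vec_inv, hn, h]; simp)
      refine ⟨c, ?_⟩
      rw [← hm, ← MulAut.conj_apply, ← hc]
      simp [MulAut.mul_apply]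
  obtain ⟨c, hc⟩ := key
  rw [isConj_iff]
  exact ⟨φ c, by rw [MulAut.mul_apply, hc]; simp⟩

/-! ### The subtractive Euclidean algorithm -/

/-- The number of steps of the subtractive Euclidean algorithm. -/
def euclidDepth : ℕ → ℕ → ℕ
  | 0, _ => 0
  | _ + 1, 0 => 0
  | m + 1, n + 1 => if m ≤ n then euclidDepth (m + 1) (n - m) + 1 else euclidDepth (m - n) (n + 1) + 1
termination_by m n => m + n

@[simp] theorem euclidDepth_zero_left (n : ℕ) : euclidDepth 0 n = 0 := by simp [euclidDepth]

@[simp] theorem euclidDepth_zero_right (n : ℕ) : euclidDepth n 0 = 0 := by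
  cases n <;> simp [euclidDepth]

theorem euclidDepth_of_le {m n : ℕ} (h0 : 0 < m) (h : m ≤ n) :
    euclidDepth m n = euclidDepth m (n - m) + 1 := by
  obtain ⟨m, rfl⟩ := Nat.exists_eq_add_one_of_ne_zero h0.ne'
  obtain ⟨n, rfl⟩ := Nat.exists_eq_add_one_of_ne_zero (by omega : n ≠ 0)
  rw [euclidDepth, if_pos (by omega), Nat.add_sub_add_right]

theorem euclidDepth_comm (m n : ℕ) : euclidDepth m n = euclidDepth n m := by
  induction hk : m + n using Nat.strong_induction_on generalizing m n with
  | _ k ih =>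
  wlog h : m ≤ n generalizing m n with H
  · exact (H n m (by omega) (by omega)).symm
  rcases Nat.eq_zero_or_pos m with rfl | h0
  · simp
  rcases h.eq_or_lt with rfl | h'
  · rfl
  rw [euclidDepth_of_le h0 h]
  obtain ⟨m, rfl⟩ := Nat.exists_eq_add_one_of_ne_zero h0.ne'
  obtain ⟨n, rfl⟩ := Nat.exists_eq_add_one_of_ne_zero (by omega : n ≠ 0)
  rw [euclidDepth, if_neg (by omega), Nat.add_sub_add_right, ih _ _ _ _ rfl]
  omega

theorem euclidDepth_pos {m n : ℕ} (hm : 0 < m) (hn : 0 < n) : 0 < euclidDepth m n := by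
  rcases le_total m n with h | h
  · rw [euclidDepth_of_le hm h]; omega
  · rw [euclidDepth_comm, euclidDepth_of_le hn h]; omega

/-- Two vectors of `ℕ²` span `ℤ²`. -/
def Unimodular (u w : ℕ × ℕ) : Prop := u.1 * w.2 = u.2 * w.1 + 1 ∨ u.2 * w.1 = u.1 * w.2 + 1

/-- Two vectors on the same side of the diagonal undergo the same subtraction as their sum, and it
preserves the determinant. Strictly opposite sides occur only for the standard basis. -/
theorem euclidDepth_add (a b c d : ℕ) (h : a * d = b * c + 1 ∨ b * c = a * d + 1) :
    euclidDepth (a + c) (b + d) = max (euclidDepth a b) (euclidDepth c d) + 1 := by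
  induction hk : a + b + c + d using Nat.strong_induction_on generalizing a b c d with
  | _ k ih =>
  have main : ∀ a b c d : ℕ, a + b + c + d = k → (a * d = b * c + 1 ∨ b * c = a * d + 1) →
      a ≤ b → c ≤ d →
      euclidDepth (a + c) (b + d) = max (euclidDepth a b) (euclidDepth c d) + 1 := by
    intro a b c d hk h h1 h2
    rcases Nat.eq_zero_or_pos a with rfl | ha
    · have hbc : b * c = 1 := by omega
      obtain ⟨rfl, rfl⟩ := mul_eq_one.1 hbc
      rw [euclidDepth_of_le (by omega) (by omega)]
      simp
    rcases Nat.eq_zero_or_pos c with rfl | hc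
    · have had : a * d = 1 := by omega
      obtain ⟨rfl, rfl⟩ := mul_eq_one.1 had
      rw [euclidDepth_of_le (by omega) (by omega)]
      simp
    obtain ⟨b, rfl⟩ := Nat.exists_eq_add_of_le h1
    obtain ⟨d, rfl⟩ := Nat.exists_eq_add_of_le h2
    rw [euclidDepth_of_le (by omega) (by omega : a + c ≤ _), euclidDepth_of_le ha h1,
      euclidDepth_of_le hc h2, show a + b + (c + d) - (a + c) = b + d by omega,
      Nat.add_sub_cancel_left, Nat.add_sub_cancel_left,
      ih (a + b + c + d) (by omega) a b c d (by
        simp only [mul_add, add_mul] at h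
        omega) rfl]
    omega
  rcases le_or_gt a b with h1 | h1 <;> rcases le_or_gt c d with h2 | h2
  · exact main a b c d hk h h1 h2
  · rcases h1.eq_or_lt with rfl | h1
    · rw [euclidDepth_comm, euclidDepth_comm c d]
      have := main a a d c (by omega) (by omega) le_rfl h2.le
      exact this
    · obtain ⟨b, rfl⟩ := Nat.exists_eq_add_of_lt h1
      obtain ⟨c, rfl⟩ := Nat.exists_eq_add_of_lt h2
      -- Off the diagonal on opposite sides, the two products in the determinant differ by 1 plus
      -- nonnegative terms, which must therefore all vanish.
      have : a = 0 ∧ d = 0 ∧ b = 0 ∧ c = 0 := by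
        have : (a + b + 1) * (d + c + 1) =
          a * d + (a * c + a + b * d + b * c + b + d + c + 1) := by ring
        have := Nat.zero_le (a * c)
        have := Nat.zero_le (b * d)
        have := Nat.zero_le (b * c)
        omega
      obtain ⟨rfl, rfl, rfl, rfl⟩ := this
      rw [euclidDepth_of_le (by omega) (by omega)]
      simp
  · rcases h2.eq_or_lt with rfl | h2
    · rw [euclidDepth_comm, euclidDepth_comm a b]
      have := main b a c c (by omega) (by omega) h1.le le_rfl
      exact this
    · obtain ⟨a, rfl⟩ := Nat.exists_eq_add_of_lt h1
      obtain ⟨d, rfl⟩ := Nat.exists_eq_add_of_lt h2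
      have : a = 0 ∧ d = 0 ∧ b = 0 ∧ c = 0 := by
        have : (b + a + 1) * (c + d + 1) =
          b * c + (b * d + b + a * c + a * d + a + c + d + 1) := by ring
        have := Nat.zero_le (a * c)
        have := Nat.zero_le (b * d)
        have := Nat.zero_le (a * d)
        omega
      obtain ⟨rfl, rfl, rfl, rfl⟩ := this
      rw [euclidDepth_of_le (by omega) (by omega)]
      simp
  · rw [euclidDepth_comm, euclidDepth_comm a b, euclidDepth_comm c d]
    exact main b a d c (by omega) (by omega) h1.le h2.le

/-- The depth of a vector. -/
def vecDepth (u : ℕ × ℕ) : ℕ := euclidDepth u.1 u.2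

theorem Unimodular.depth_add {u w : ℕ × ℕ} (h : Unimodular u w) :
    vecDepth (u + w) = max (vecDepth u) (vecDepth w) + 1 := euclidDepth_add _ _ _ _ h

theorem Unimodular.ne {u w : ℕ × ℕ} (h : Unimodular u w) : u ≠ w := by
  rintro rfl
  rcases h with h | h <;> rw [mul_comm] at h <;> omega

/-- Three pairwise unimodular vectors: one of them is the sum of the two others. -/
theorem Unimodular.triple {x y z : ℕ × ℕ} (hxy : Unimodular x y) (hxz : Unimodular x z)
    (hyz : Unimodular y z) : z = x + y ∨ x = y + z ∨ y = x + z := by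
  obtain ⟨a, b⟩ := x
  obtain ⟨c, d⟩ := y
  obtain ⟨e, f⟩ := z
  simp only [Unimodular] at hxy hxz hyz
  simp only [Prod.mk_add_mk, Prod.mk.injEq]
  zify at hxy hxz hyz ⊢
  have h1 : (a * d - b * c : ℤ) = 1 ∨ (a * d - b * c : ℤ) = -1 := by
    rcases hxy with h | h <;> [left; right] <;> linarith
  have h2 : (a * f - b * e : ℤ) = 1 ∨ (a * f - b * e : ℤ) = -1 := by
    rcases hxz with h | h <;> [left; right] <;> linarith
  have h3 : (c * f - d * e : ℤ) = 1 ∨ (c * f - d * e : ℤ) = -1 := by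
    rcases hyz with h | h <;> [left; right] <;> linarith
  have e1 : (a * d - b * c : ℤ) * e = (a * f - b * e) * c - (c * f - d * e) * a := by ring
  have e2 : (a * d - b * c : ℤ) * f = (a * f - b * e) * d - (c * f - d * e) * b := by ring
  have pa : (0 : ℤ) ≤ a := by positivity
  have pb : (0 : ℤ) ≤ b := by positivity
  have pc : (0 : ℤ) ≤ c := by positivity
  have pd : (0 : ℤ) ≤ d := by positivity
  have pe : (0 : ℤ) ≤ e := by positivity
  have pf : (0 : ℤ) ≤ f := by positivity
  rcases h1 with h1 | h1 <;> rcases h2 with h2 | h2 <;> rcases h3 with h3 | h3 <;>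
    rw [h1, h2, h3] at e1 e2 <;> omega

/-! ### Coordinates on the set of curves -/

/-- Each curve comes from an automorphism. -/
theorem exists_curveA (X : Curve) : ∃ φ, curveA φ = X := by
  obtain ⟨q, g, ⟨φ, rfl⟩, h⟩ := X
  exact ⟨φ, Subtype.ext h⟩

theorem curve_ext {X Y : Curve} {g h : F2} (hX : Quotient.mk freeHomotopySetoid g = X.1)
    (hY : Quotient.mk freeHomotopySetoid h = Y.1) (hgh : IsConj g h ∨ IsConj g h⁻¹) : X = Y :=
  Subtype.ext (hX.symm.trans ((Quotient.sound hgh).trans hY))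

theorem vec_eq_of_isConj (θ : MulAut F2) {g h : F2} (hgh : IsConj g h) :
    vec (θ g) = vec (θ h) := by
  obtain ⟨c, rfl⟩ := isConj_iff.1 hgh
  simp

/-- The moduli of the coordinates of a curve in the basis given by an automorphism. -/
def coord (θ : MulAut F2) (X : Curve) : ℕ × ℕ :=
  Quotient.lift (s := freeHomotopySetoid)
    (fun g => ((vec (θ⁻¹ g)).1.natAbs, (vec (θ⁻¹ g)).2.natAbs)) (by
      rintro g h (hgh | hgh)
      · simp only [vec_eq_of_isConj _ hgh]
      · simp only [vec_eq_of_isConj _ hgh, map_inv, vec_inv, Prod.fst_neg, Prod.snd_neg,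
          Int.natAbs_neg]) X.1

theorem coord_curveA (θ φ : MulAut F2) :
    coord θ (curveA φ) = ((vec (θ⁻¹ (φ genA))).1.natAbs, (vec (θ⁻¹ (φ genA))).2.natAbs) := rfl

theorem coord_curveB (θ φ : MulAut F2) :
    coord θ (curveB φ) = ((vec (θ⁻¹ (φ genB))).1.natAbs, (vec (θ⁻¹ (φ genB))).2.natAbs) := rfl

/-- The integers ad and bc differ by one, so they cannot have opposite strict signs; hence their
moduli also differ by one. -/
theorem unimodular_natAbs {a b c d : ℤ} (h : (a * d - b * c) ^ 2 = 1) :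
    Unimodular (a.natAbs, b.natAbs) (c.natAbs, d.natAbs) := by
  have h1 := mul_self_eq_one_iff.1 ((sq _).symm.trans h)
  have h2 : 0 ≤ (a * d) * (b * c) := by
    rcases h1 with h1 | h1
    · have : a * d = b * c + 1 := by linarith
      rw [this]
      rcases le_or_gt 0 (b * c) with h | h <;> nlinarith
    · have : b * c = a * d + 1 := by linarith
      rw [this]
      rcases le_or_gt 0 (a * d) with h | h <;> nlinarith
  simp only [Unimodular]
  rw [← Int.natAbs_mul, ← Int.natAbs_mul]
  generalize a * d = p at *
  generalize b * c = q at *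
  rcases le_or_gt 0 p with hp | hp <;> rcases le_or_gt 0 q with hq | hq
  · omega
  · rcases hp.eq_or_lt with rfl | hp
    · omega
    · nlinarith
  · rcases hq.eq_or_lt with rfl | hq
    · omega
    · nlinarith
  · omega

theorem unimodular_coord (θ φ : MulAut F2) : Unimodular (coord θ (curveA φ)) (coord θ (curveB φ)) := by
  rw [coord_curveA, coord_curveB]
  apply unimodular_natAbs
  rw [mul_comm (vec (θ⁻¹ (φ genA))).2]
  exact det_sq (θ⁻¹ * φ)

theorem adj_curveAB (φ : MulAut F2) : curveGraph.Adj (curveA φ) (curveB φ) := by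
  rw [curveGraph, SimpleGraph.fromRel_adj]
  refine ⟨fun h => (unimodular_coord 1 φ).ne (by rw [h]), Or.inl ⟨φ, rfl, rfl⟩⟩

theorem exists_of_adj {X Y : Curve} (h : curveGraph.Adj X Y) :
    (∃ φ, curveA φ = X ∧ curveB φ = Y) ∨ ∃ φ, curveA φ = Y ∧ curveB φ = X := by
  rw [curveGraph, SimpleGraph.fromRel_adj] at h
  exact h.2

theorem curveA_swap (φ : MulAut F2) : curveA (φ * swapAut) = curveB φ := by
  refine curve_ext (g := (φ * swapAut) genA) (h := φ genB) rfl rfl (Or.inl ?_)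
  rw [MulAut.mul_apply, swapAut_genA]

theorem curveB_swap (φ : MulAut F2) : curveB (φ * swapAut) = curveA φ := by
  refine curve_ext (g := (φ * swapAut) genB) (h := φ genA) rfl rfl (Or.inl ?_)
  rw [MulAut.mul_apply, swapAut_genB]

theorem exists_curveAB_of_adj {X Y : Curve} (h : curveGraph.Adj X Y) :
    ∃ φ, curveA φ = X ∧ curveB φ = Y := by
  rcases exists_of_adj h with h | ⟨φ, rfl, rfl⟩
  · exact h
  · exact ⟨φ * swapAut, curveA_swap φ, curveB_swap φ⟩

theorem unimodular_of_adj (θ : MulAut F2) {X Y : Curve} (h : curveGraph.Adj X Y) :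
    Unimodular (coord θ X) (coord θ Y) := by
  obtain ⟨φ, rfl, rfl⟩ := exists_curveAB_of_adj h
  exact unimodular_coord θ φ

/-- Curves with the same homology class up to sign are equal. -/
theorem curveA_eq_of_vec {φ ψ : MulAut F2}
    (h : vec (φ genA) = vec (ψ genA) ∨ vec (φ genA) = -vec (ψ genA)) : curveA φ = curveA ψ := by
  refine curve_ext (g := φ genA) (h := ψ genA) rfl rfl ?_
  rcases h with h | h
  · exact Or.inl (isConj_of_vec_eq h.symm)
  · right
    have hs : (ψ * (swapAut * invAut * swapAut)) genA = (ψ genA)⁻¹ := by simp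
    rw [← hs]
    apply isConj_of_vec_eq
    rw [hs, vec_inv, h]

theorem vec_inv_apply_eq (θ : MulAut F2) {g h : F2} (H : vec (θ⁻¹ g) = vec (θ⁻¹ h)) :
    vec g = vec h := by
  have := vec_aut θ (θ⁻¹ g)
  rw [H, ← vec_aut] at this
  simpa using this

theorem curveA_eq_of_relVec (θ : MulAut F2) {φ ψ : MulAut F2}
    (h : vec (θ⁻¹ (φ genA)) = vec (θ⁻¹ (ψ genA)) ∨ vec (θ⁻¹ (φ genA)) = -vec (θ⁻¹ (ψ genA))) :
    curveA φ = curveA ψ := by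
  apply curveA_eq_of_vec
  rcases h with h | h
  · exact Or.inl (vec_inv_apply_eq θ h)
  · right
    rw [← vec_inv, ← map_inv] at h
    rw [← vec_inv]
    exact vec_inv_apply_eq θ h

theorem eq_curveA_of_coord {θ : MulAut F2} {X : Curve} (h : coord θ X = (1, 0)) : X = curveA θ := by
  obtain ⟨φ, rfl⟩ := exists_curveA X
  rw [coord_curveA, Prod.mk.injEq, Int.natAbs_eq_iff, Int.natAbs_eq_zero] at h
  apply curveA_eq_of_relVec θ
  rw [MulAut.inv_apply_self, vec_genA]
  rcases h with ⟨h1 | h1, h2⟩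
  · exact Or.inl (Prod.ext h1 h2)
  · exact Or.inr (Prod.ext h1 (by simpa using h2))

theorem eq_curveB_of_coord {θ : MulAut F2} {X : Curve} (h : coord θ X = (0, 1)) : X = curveB θ := by
  rw [← curveA_swap]
  apply eq_curveA_of_coord
  obtain ⟨φ, rfl⟩ := exists_curveA X
  rw [coord_curveA] at h ⊢
  have : (θ * swapAut)⁻¹ (φ genA) = swapAut (θ⁻¹ (φ genA)) := by
    apply (θ * swapAut).injective
    have hss : ∀ x, swapAut (swapAut x) = x := fun x => by
      rw [← MulAut.mul_apply, show swapAut * swapAut = 1 from aut_ext (by simp) (by simp)]; rfl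
    rw [MulAut.apply_inv_self, MulAut.mul_apply, hss, MulAut.apply_inv_self]
  rw [this, vec_aut swapAut]
  simp only [Prod.mk.injEq] at h
  refine Prod.ext ?_ ?_
  · simpa using h.2
  · simpa using h.1

theorem curveA_mulAut (ψ : MulAut F2) : curveA (ψ * mulAut) = curveA ψ :=
  curve_ext (g := (ψ * mulAut) genA) (h := ψ genA) rfl rfl
    (Or.inl (by rw [MulAut.mul_apply, mulAut_genA]))

theorem mulAut_inv_genB : mulAut⁻¹ genB = genA⁻¹ * genB := mulAut.injective (by simp)

/-- The transvection `α ↦ α β`, `β ↦ β`. -/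
def mulAutR : MulAut F2 :=
  MonoidHom.toMulEquiv (endo (genA * genB) genB) (endo (genA * genB⁻¹) genB)
    (hom_ext (by simp) (by simp)) (hom_ext (by simp) (by simp))

@[simp] theorem mulAutR_genA : mulAutR genA = genA * genB := endo_genA (genA * genB) genB
@[simp] theorem mulAutR_genB : mulAutR genB = genB := endo_genB (genA * genB) genB

theorem mulAutR_inv_genA : mulAutR⁻¹ genA = genA * genB⁻¹ := mulAutR.injective (by simp)

theorem curveB_mulAutR (ψ : MulAut F2) : curveB (ψ * mulAutR) = curveB ψ :=
  curve_ext (g := (ψ * mulAutR) genB) (h := ψ genB) rfl rfl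
    (Or.inl (by rw [MulAut.mul_apply, mulAutR_genB]))

theorem curveA_mulAutR (ψ : MulAut F2) : curveA (ψ * mulAutR) = curveB (ψ * mulAut) :=
  curve_ext (g := (ψ * mulAutR) genA) (h := (ψ * mulAut) genB) rfl rfl
    (Or.inl (by rw [MulAut.mul_apply, MulAut.mul_apply, mulAutR_genA, mulAut_genB]))

theorem curveB_mulAut_inv (ψ : MulAut F2) :
    curveB (ψ * mulAut⁻¹) = curveA (ψ * mulAutR⁻¹) := by
  refine curve_ext (g := (ψ * mulAut⁻¹) genB) (h := (ψ * mulAutR⁻¹) genA) rfl rfl (Or.inr ?_)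
  rw [MulAut.mul_apply, MulAut.mul_apply, mulAut_inv_genB, mulAutR_inv_genA, isConj_iff]
  exact ⟨ψ genA, by simp⟩

theorem isTriangle_mul (ψ : MulAut F2) :
    IsTriangle (curveA ψ) (curveB ψ) (curveB (ψ * mulAut)) := by
  refine ⟨adj_curveAB ψ, ?_, ?_⟩
  · have := adj_curveAB (ψ * mulAut)
    rwa [curveA_mulAut] at this
  · have := adj_curveAB (ψ * mulAutR)
    rw [curveA_mulAutR, curveB_mulAutR] at this
    exact this.symm

theorem isTriangle_mul_inv (ψ : MulAut F2) :
    IsTriangle (curveA ψ) (curveB ψ) (curveB (ψ * mulAut⁻¹)) := by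
  refine ⟨adj_curveAB ψ, ?_, ?_⟩
  · have := adj_curveAB (ψ * mulAut⁻¹)
    have h := curveA_mulAut (ψ * mulAut⁻¹)
    rw [inv_mul_cancel_right] at h
    rwa [← h] at this
  · have := adj_curveAB (ψ * mulAutR⁻¹)
    have h := curveB_mulAutR (ψ * mulAutR⁻¹)
    rw [inv_mul_cancel_right] at h
    rw [← h] at this
    rw [curveB_mulAut_inv]
    exact this.symm

/-- Two adjacent curves lie in a triangle in which the third curve is not the sum, unless they are
the two curves of the basis. -/
theorem exists_triangle_sub (θ : MulAut F2) {X Y : Curve} (h : curveGraph.Adj X Y)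
    (h0 : 0 < vecDepth (coord θ X) ∨ 0 < vecDepth (coord θ Y)) :
    ∃ Z, IsTriangle X Y Z ∧
      (coord θ X = coord θ Y + coord θ Z ∨ coord θ Y = coord θ X + coord θ Z) := by
  obtain ⟨ψ, rfl, rfl⟩ := exists_curveAB_of_adj h
  have hu := unimodular_coord θ ψ
  have t1 := isTriangle_mul ψ
  have t2 := isTriangle_mul_inv ψ
  rcases hu.triple (unimodular_of_adj θ t1.2.1) (unimodular_of_adj θ t1.2.2) with e1 | e1
  swap
  · exact ⟨_, t1, e1⟩
  rcases hu.triple (unimodular_of_adj θ t2.2.1) (unimodular_of_adj θ t2.2.2) with e2 | e2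
  swap
  · exact ⟨_, t2, e2⟩
  -- If both third curves, of classes x + y and y - x, had coordinates |x| + |y|, then in each
  -- coordinate x or y would vanish, and both curves would have depth zero.
  exfalso
  rw [coord_curveA, coord_curveB, coord_curveB, MulAut.mul_apply] at e1 e2
  rw [mulAut_genB] at e1
  rw [mulAut_inv_genB] at e2
  rw [coord_curveA, coord_curveB] at h0 hu
  simp only [map_mul, map_inv, vec_mul, vec_inv, Prod.fst_add, Prod.snd_add, Prod.fst_neg,
    Prod.snd_neg, Prod.mk_add_mk, Prod.mk.injEq] at e1 e2
  generalize vec (θ⁻¹ (ψ genA)) = x at *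
  generalize vec (θ⁻¹ (ψ genB)) = y at *
  have h1 : x.1 = 0 ∨ y.1 = 0 := by omega
  have h2 : x.2 = 0 ∨ y.2 = 0 := by omega
  simp only [vecDepth] at h0
  simp only [Unimodular] at hu
  rcases h1 with h1 | h1 <;> rcases h2 with h2 | h2 <;> simp [h1, h2] at h0 hu

/-- A curve of positive depth has two parents. -/
theorem exists_parents (θ : MulAut F2) (Z : Curve) (h : 0 < vecDepth (coord θ Z)) :
    ∃ X Y, IsTriangle X Y Z ∧ coord θ Z = coord θ X + coord θ Y := by
  have key : ∀ n, ∀ Y, curveGraph.Adj Z Y → (coord θ Y).1 + (coord θ Y).2 = n →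
      ∃ X Y, IsTriangle X Y Z ∧ coord θ Z = coord θ X + coord θ Y := by
    intro n
    induction n using Nat.strong_induction_on with
    | _ n ih =>
    intro Y hY hn
    obtain ⟨W, hW, e | e⟩ := exists_triangle_sub θ hY (Or.inl h)
    · exact ⟨Y, W, ⟨hW.2.2, hY.symm, hW.2.1.symm⟩, e⟩
    · refine ih _ ?_ W hW.2.1 rfl
      rw [← hn, e]
      have : (coord θ Z).1 ≠ 0 := fun h0 => by simp [vecDepth, h0] at h
      simp only [Prod.fst_add, Prod.snd_add]
      omega
  obtain ⟨φ, rfl⟩ := exists_curveA Z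
  exact key _ _ (adj_curveAB φ) rfl

theorem coord_of_depth_eq_zero {θ : MulAut F2} {Z : Curve} (h : vecDepth (coord θ Z) = 0) :
    coord θ Z = (1, 0) ∨ coord θ Z = (0, 1) := by
  obtain ⟨φ, rfl⟩ := exists_curveA Z
  have hu := unimodular_coord θ φ
  generalize coord θ (curveA φ) = x at *
  generalize coord θ (curveB φ) = y at *
  obtain ⟨a, b⟩ := x
  simp only [Unimodular] at hu
  rcases Nat.eq_zero_or_pos a with rfl | ha
  · right
    rw [zero_mul] at hu
    have : b * y.1 = 1 := by omega
    rw [(mul_eq_one.1 this).1]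
  · rcases Nat.eq_zero_or_pos b with rfl | hb
    · left
      rw [zero_mul] at hu
      have : a * y.2 = 1 := by omega
      rw [(mul_eq_one.1 this).1]
    · exact absurd h (euclidDepth_pos ha hb).ne'

/-! ### Distances in the edge graph -/

/-- The depth of an edge. -/
def edgeDepth (θ : MulAut F2) (e : EdgeVertex) : ℕ :=
  Sym2.lift ⟨fun X Y => max (vecDepth (coord θ X)) (vecDepth (coord θ Y)), fun _ _ => max_comm _ _⟩
    e.1

theorem edgeDepth_mk (θ : MulAut F2) {e : EdgeVertex} {X Y : Curve} (h : e.1 = s(X, Y)) :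
    edgeDepth θ e = max (vecDepth (coord θ X)) (vecDepth (coord θ Y)) := by
  rw [edgeDepth, h]; rfl

theorem depth_triangle (θ : MulAut F2) {X Y Z : Curve} (h : IsTriangle X Y Z) :
    (coord θ Z = coord θ X + coord θ Y ∧ vecDepth (coord θ Z) =
      max (vecDepth (coord θ X)) (vecDepth (coord θ Y)) + 1) ∨
    (coord θ X = coord θ Y + coord θ Z ∧ vecDepth (coord θ X) =
      max (vecDepth (coord θ Y)) (vecDepth (coord θ Z)) + 1) ∨
    (coord θ Y = coord θ X + coord θ Z ∧ vecDepth (coord θ Y) =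
      max (vecDepth (coord θ X)) (vecDepth (coord θ Z)) + 1) := by
  have h1 := unimodular_of_adj θ h.1
  have h2 := unimodular_of_adj θ h.2.1
  have h3 := unimodular_of_adj θ h.2.2
  rcases h1.triple h2 h3 with e | e | e
  · exact Or.inl ⟨e, by rw [e, h1.depth_add]⟩
  · exact Or.inr (Or.inl ⟨e, by rw [e, h3.depth_add]⟩)
  · exact Or.inr (Or.inr ⟨e, by rw [e, h2.depth_add]⟩)

theorem edgeDepth_le_of_adj (θ : MulAut F2) {e f : EdgeVertex} (h : edgeGraph.Adj e f) :
    edgeDepth θ f ≤ edgeDepth θ e + 1 := by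
  rw [edgeGraph, SimpleGraph.fromRel_adj] at h
  obtain ⟨X, Y, Z, ht, h1, h2⟩ | ⟨X, Y, Z, ht, h1, h2⟩ := h.2 <;>
    rw [edgeDepth_mk θ h1, edgeDepth_mk θ h2] <;>
    rcases depth_triangle θ ht with ⟨_, h⟩ | ⟨_, h⟩ | ⟨_, h⟩ <;> omega

/-- An edge of positive depth has a neighbour of depth one less, obtained by replacing the sum by
the third curve of the triangle; depth zero characterises v. As depth changes by at most one along
an edge of `edgeGraph`, these walks are geodesics. -/
theorem exists_walk (θ : MulAut F2) (v : EdgeVertex) (hv : v.1 = s(curveA θ, curveB θ))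
    (e : EdgeVertex) : ∃ w : edgeGraph.Walk v e, w.length = edgeDepth θ e := by
  induction hn : edgeDepth θ e using Nat.strong_induction_on generalizing e with
  | _ n ih =>
  subst hn
  obtain ⟨e, he⟩ := e
  induction e using Sym2.ind with
  | _ X Y =>
  have hXY : curveGraph.Adj X Y := he
  have hd := edgeDepth_mk θ (e := ⟨s(X, Y), he⟩) rfl
  rcases Nat.eq_zero_or_pos (edgeDepth θ ⟨s(X, Y), he⟩) with h0 | h0
  · have hX : vecDepth (coord θ X) = 0 := by omega
    have hY : vecDepth (coord θ Y) = 0 := by omega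
    have hne := (unimodular_of_adj θ hXY).ne
    have : v = ⟨s(X, Y), he⟩ := by
      apply Subtype.ext
      rw [hv]
      rcases coord_of_depth_eq_zero hX with h1 | h1 <;>
        rcases coord_of_depth_eq_zero hY with h2 | h2
      · exact absurd (h1.trans h2.symm) hne
      · simp only [eq_curveA_of_coord h1, eq_curveB_of_coord h2]
      · simp only [eq_curveA_of_coord h2, eq_curveB_of_coord h1]
        exact Sym2.eq_swap
      · exact absurd (h1.trans h2.symm) hne
    subst this
    exact ⟨SimpleGraph.Walk.nil, h0.symm⟩
  · obtain ⟨Z, ht, hs⟩ := exists_triangle_sub θ hXY (by omega)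
    have key : ∀ X Y (he : s(X, Y) ∈ curveGraph.edgeSet), IsTriangle X Y Z →
        coord θ X = coord θ Y + coord θ Z →
        ∃ f, edgeGraph.Adj f ⟨s(X, Y), he⟩ ∧ edgeDepth θ f + 1 = edgeDepth θ ⟨s(X, Y), he⟩ := by
      intro X Y he ht hs
      refine ⟨⟨s(Y, Z), ht.2.2⟩, ?_, ?_⟩
      · rw [edgeGraph, SimpleGraph.fromRel_adj]
        refine ⟨fun h => ?_, Or.inl ⟨Y, Z, X, ⟨ht.2.2, ht.1.symm, ht.2.1.symm⟩, rfl, Sym2.eq_swap⟩⟩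
        have h' := congrArg Subtype.val h
        simp only [Sym2.eq_iff] at h'
        have := ht.1.ne
        have := ht.2.1.ne
        grind
      · rw [edgeDepth_mk θ (e := ⟨s(Y, Z), ht.2.2⟩) rfl, edgeDepth_mk θ (e := ⟨s(X, Y), he⟩) rfl, hs,
          (unimodular_of_adj θ ht.2.2).depth_add]
        omega
    have : ∃ f, edgeGraph.Adj f ⟨s(X, Y), he⟩ ∧
        edgeDepth θ f + 1 = edgeDepth θ ⟨s(X, Y), he⟩ := by
      rcases hs with hs | hs
      · exact key X Y he ht hs
      · have := key Y X hXY.symm ⟨ht.1.symm, ht.2.2, ht.2.1⟩ hs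
        have hsw : (⟨s(Y, X), hXY.symm⟩ : EdgeVertex) = ⟨s(X, Y), he⟩ := Subtype.ext Sym2.eq_swap
        rwa [hsw] at this
    obtain ⟨f, hf, hfd⟩ := this
    obtain ⟨w, hw⟩ := ih (edgeDepth θ f) (by omega) f rfl
    exact ⟨w.concat hf, by rw [SimpleGraph.Walk.length_concat, hw, hfd]⟩

theorem edgeDepth_le_length (θ : MulAut F2) {e f : EdgeVertex} (w : edgeGraph.Walk e f) :
    edgeDepth θ f ≤ edgeDepth θ e + w.length := by
  induction w with
  | nil => simp
  | cons h p ih =>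
    have := edgeDepth_le_of_adj θ h
    rw [SimpleGraph.Walk.length_cons]
    omega

theorem coord_self_A (θ : MulAut F2) : coord θ (curveA θ) = (1, 0) := by simp [coord_curveA]

theorem coord_self_B (θ : MulAut F2) : coord θ (curveB θ) = (0, 1) := by simp [coord_curveB]

theorem dist_eq_edgeDepth (θ : MulAut F2) {v : EdgeVertex} (hv : v.1 = s(curveA θ, curveB θ))
    (e : EdgeVertex) : edgeGraph.dist v e = edgeDepth θ e := by
  obtain ⟨w, hw⟩ := exists_walk θ v hv e
  apply le_antisymm
  · rw [← hw]; exact SimpleGraph.dist_le w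
  · obtain ⟨p, hp⟩ := w.reachable.exists_walk_length_eq_dist
    have h1 := edgeDepth_le_length θ p
    have h2 : edgeDepth θ v = 0 := by
      rw [edgeDepth_mk θ hv, coord_self_A, coord_self_B]; simp [vecDepth]
    omega

/-- A curve joined to one of its parents forms an edge of the same depth as the curve, and no edge
containing the curve has smaller depth. -/
theorem regionDist_eq_depth (θ : MulAut F2) {v : EdgeVertex} (hv : v.1 = s(curveA θ, curveB θ))
    (X : Curve) : regionDist v X = vecDepth (coord θ X) := by
  have hmem : ∃ w : EdgeVertex, X ∈ w.1 ∧ edgeGraph.dist v w = vecDepth (coord θ X) := by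
    rcases Nat.eq_zero_or_pos (vecDepth (coord θ X)) with h | h
    · refine ⟨v, ?_, by rw [SimpleGraph.dist_self, h]⟩
      rw [hv]
      rcases coord_of_depth_eq_zero h with h | h
      · rw [eq_curveA_of_coord h]; simp
      · rw [eq_curveB_of_coord h]; simp
    · obtain ⟨Y, Z, ht, hs⟩ := exists_parents θ X h
      refine ⟨⟨s(Y, X), ht.2.1⟩, by simp, ?_⟩
      rw [dist_eq_edgeDepth θ hv, edgeDepth_mk θ (e := ⟨s(Y, X), ht.2.1⟩) rfl, hs,
        (unimodular_of_adj θ ht.1).depth_add]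
      omega
  apply le_antisymm
  · exact Nat.sInf_le hmem
  · have hne : {n | ∃ w : EdgeVertex, X ∈ w.1 ∧ edgeGraph.dist v w = n}.Nonempty := ⟨_, hmem⟩
    refine le_csInf hne fun n hn => ?_
    have hn' : ∃ w : EdgeVertex, X ∈ w.1 ∧ edgeGraph.dist v w = n := hn
    obtain ⟨⟨w, hw⟩, hX, rfl⟩ := hn'
    rw [dist_eq_edgeDepth θ hv]
    obtain ⟨Y, rfl⟩ := Sym2.mem_iff_exists.1 hX
    rw [edgeDepth_mk θ (e := ⟨s(X, Y), hw⟩) rfl]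
    exact le_max_left _ _

/-- The Fibonacci function is the sum of the moduli of the coordinates. -/
theorem fib_eq_coord (θ : MulAut F2) {v : EdgeVertex} (hv : v.1 = s(curveA θ, curveB θ))
    (Z : Curve) : fib v Z = (coord θ Z).1 + (coord θ Z).2 := by
  induction hn : vecDepth (coord θ Z) using Nat.strong_induction_on generalizing Z with
  | _ n ih =>
  subst hn
  rw [fib]
  split_ifs with h
  · obtain ⟨ht, h1, h2⟩ := h.choose_spec
    rw [regionDist_eq_depth θ hv, regionDist_eq_depth θ hv] at h1 h2
    rw [ih _ h1 _ rfl, ih _ h2 _ rfl]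
    rcases depth_triangle θ ht with ⟨e, _⟩ | ⟨_, e⟩ | ⟨_, e⟩
    · rw [e, Prod.fst_add, Prod.snd_add]
      exact add_add_add_comm _ _ _ _
    · omega
    · omega
  · rcases Nat.eq_zero_or_pos (vecDepth (coord θ Z)) with h0 | h0
    · rcases coord_of_depth_eq_zero h0 with h | h <;> simp [h]
    · exfalso
      obtain ⟨X, Y, ht, hs⟩ := exists_parents θ Z h0
      refine h ⟨(X, Y), ht, ?_, ?_⟩ <;>
        rw [regionDist_eq_depth θ hv, regionDist_eq_depth θ hv, hs,
          (unimodular_of_adj θ ht.1).depth_add] <;> dsimp only <;> omega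

theorem exists_basis (v : EdgeVertex) : ∃ θ : MulAut F2, v.1 = s(curveA θ, curveB θ) := by
  obtain ⟨e, he⟩ := v
  induction e using Sym2.ind with
  | _ X Y =>
  obtain ⟨θ, rfl, rfl⟩ := exists_curveAB_of_adj (show curveGraph.Adj X Y from he)
  exact ⟨θ, rfl⟩

/-! ### Traces in `SU(2,1)` -/

/-- The fundamental trace identity for `3 × 3` matrices. -/
theorem trace_fundamental {R : Type*} [CommRing R] (A B C D : Matrix (Fin 3) (Fin 3) R) :
    (A * B * C * D).trace + (A * B * D * C).trace + (A * C * B * D).trace +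
      (A * C * D * B).trace + (A * D * B * C).trace + (A * D * C * B).trace =
    A.trace * ((B * C * D).trace + (B * D * C).trace) +
      B.trace * ((A * C * D).trace + (A * D * C).trace) +
      C.trace * ((A * B * D).trace + (A * D * B).trace) +
      D.trace * ((A * B * C).trace + (A * C * B).trace) +
      (A * B).trace * (C * D).trace + (A * C).trace * (B * D).trace +
      (A * D).trace * (B * C).trace -
    ((A * B).trace * C.trace * D.trace + (A * C).trace * B.trace * D.trace +
      (A * D).trace * B.trace * C.trace + (B * C).trace * A.trace * D.trace +
      (B * D).trace * A.trace * C.trace + (C * D).trace * A.trace * B.trace) +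
    A.trace * B.trace * C.trace * D.trace := by
  simp only [Matrix.trace_fin_three, Matrix.mul_apply, Fin.sum_univ_three]
  ring

theorem tr_one : tr 1 = 3 := by
  change (1 : Matrix (Fin 3) (Fin 3) ℂ).trace = 3
  simp

theorem tr_mul_comm (A B : SU21) : tr (A * B) = tr (B * A) := by
  have := tr_conj (A * B) A⁻¹
  rw [← this]; congr 1; group

theorem tr_fundamental (A B C D : SU21) :
    tr (A * B * C * D) + tr (A * B * D * C) + tr (A * C * B * D) + tr (A * C * D * B) +
      tr (A * D * B * C) + tr (A * D * C * B) =
    tr A * (tr (B * C * D) + tr (B * D * C)) + tr B * (tr (A * C * D) + tr (A * D * C)) +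
      tr C * (tr (A * B * D) + tr (A * D * B)) + tr D * (tr (A * B * C) + tr (A * C * B)) +
      tr (A * B) * tr (C * D) + tr (A * C) * tr (B * D) + tr (A * D) * tr (B * C) -
    (tr (A * B) * tr C * tr D + tr (A * C) * tr B * tr D + tr (A * D) * tr B * tr C +
      tr (B * C) * tr A * tr D + tr (B * D) * tr A * tr C + tr (C * D) * tr A * tr B) +
    tr A * tr B * tr C * tr D :=
  trace_fundamental A.1.1 B.1.1 C.1.1 D.1.1

/-- The sum of the traces of a commutator and of its inverse. -/
theorem tr_commutator_add (A B : SU21) :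
    tr (A * B * A⁻¹ * B⁻¹) + star (tr (A * B * A⁻¹ * B⁻¹)) =
      tr A * star (tr A) * (tr B * star (tr B)) + tr A * star (tr A) + tr B * star (tr B) +
      tr (A * B) * star (tr (A * B)) + tr (A * B⁻¹) * star (tr (A * B⁻¹)) -
      (tr (A * B) * star (tr A) * star (tr B) + star (tr (A * B)) * tr A * tr B +
        tr (A * B⁻¹) * star (tr A) * tr B + star (tr (A * B⁻¹)) * tr A * star (tr B)) - 3 := by
  -- Of the six products on the left, four collapse to the identity; the others are the commutator
  -- and a conjugate of its inverse.
  have h := tr_fundamental A A⁻¹ B B⁻¹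
  have e1 : tr (A * B⁻¹ * A⁻¹ * B) = star (tr (A * B * A⁻¹ * B⁻¹)) := by
    rw [← tr_inv, ← tr_conj (A * B * A⁻¹ * B⁻¹)⁻¹ B⁻¹]
    congr 1; group
  have e2 : A * A⁻¹ * B * B⁻¹ = 1 := by group
  have e3 : A * A⁻¹ * B⁻¹ * B = 1 := by group
  have e4 : A * B * B⁻¹ * A⁻¹ = 1 := by group
  have e5 : A * B⁻¹ * B * A⁻¹ = 1 := by group
  have e6 : A⁻¹ * B * B⁻¹ = A⁻¹ := by group
  have e7 : A⁻¹ * B⁻¹ * B = A⁻¹ := by group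
  have e8 : A * B * B⁻¹ = A := by group
  have e9 : A * B⁻¹ * B = A := by group
  have e10 : A * A⁻¹ * B⁻¹ = B⁻¹ := by group
  have e11 : tr (A * B⁻¹ * A⁻¹) = tr B⁻¹ := tr_conj _ _
  have e12 : A * A⁻¹ * B = B := by group
  have e13 : tr (A * B * A⁻¹) = tr B := tr_conj _ _
  have e14 : A * A⁻¹ = 1 := by group
  have e15 : B * B⁻¹ = 1 := by group
  have e16 : tr (A⁻¹ * B⁻¹) = star (tr (A * B)) := by
    rw [tr_mul_comm A B, ← tr_inv]; congr 1; group
  have e17 : tr (A⁻¹ * B) = star (tr (A * B⁻¹)) := by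
    rw [tr_mul_comm A, ← tr_inv]; congr 1; group
  rw [e1, e2, e3, e4, e5, e6, e7, e8, e9, e10, e11, e12, e13, e14, e15, e16, e17, tr_one,
    tr_inv, tr_inv] at h
  linear_combination h

/-- The edge relation. -/
theorem edge_relation (A B : SU21) :
    ‖tr (A * B) - tr A * tr B‖ ^ 2 + ‖tr (A * B⁻¹) - tr A * star (tr B)‖ ^ 2 =
      ‖tr A‖ ^ 2 * ‖tr B‖ ^ 2 - ‖tr A‖ ^ 2 - ‖tr B‖ ^ 2 +
        2 * (tr (A * B * A⁻¹ * B⁻¹)).re + 3 := by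
  have h := tr_commutator_add A B
  have h2 := Complex.add_conj (tr (A * B * A⁻¹ * B⁻¹))
  apply Complex.ofReal_injective
  push_cast at h2 ⊢
  simp only [← Complex.mul_conj', ← h2, map_sub, map_mul, Complex.star_def, Complex.conj_conj] at h ⊢
  linear_combination -h

theorem det_scalar_sub (A : SU21) (x : ℂ) :
    (x • (1 : Matrix (Fin 3) (Fin 3) ℂ) - A.1.1).det =
      x ^ 3 - tr A * x ^ 2 + star (tr A) * x - 1 := by
  have h1 : star (tr A) = (A.1.1.adjugate).trace := by
    rw [← tr_inv, ← Matrix.SpecialLinearGroup.coe_inv]; rfl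
  have key : ∀ M : Matrix (Fin 3) (Fin 3) ℂ, (x • (1 : Matrix (Fin 3) (Fin 3) ℂ) - M).det =
      x ^ 3 - M.trace * x ^ 2 + M.adjugate.trace * x - M.det := by
    intro M
    rw [Matrix.trace_fin_three, Matrix.trace_fin_three, Matrix.adjugate_fin_three,
      Matrix.det_fin_three, Matrix.det_fin_three]
    simp
    ring
  rw [h1, key, A.1.2]
  rfl

theorem exists_eigenvector_iff (A : SU21) (x : ℂ) :
    (∃ v : Fin 3 → ℂ, v ≠ 0 ∧ A.1.1 *ᵥ v = x • v) ↔
      x ^ 3 - tr A * x ^ 2 + star (tr A) * x - 1 = 0 := by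
  rw [← det_scalar_sub, ← Matrix.exists_mulVec_eq_zero_iff]
  simp only [Matrix.sub_mulVec, Matrix.smul_mulVec, Matrix.one_mulVec, sub_eq_zero, eq_comm]

theorem unitary_mul (A : SU21) : A.1.1ᴴ * J * A.1.1 = J := by
  have h : (A.1⁻¹).1 = J * A.1.1ᴴ * J := A.2
  have h2 : (A.1⁻¹).1 * A.1.1 = 1 := by
    rw [← Matrix.SpecialLinearGroup.coe_mul, inv_mul_cancel, Matrix.SpecialLinearGroup.coe_one]
  rw [h] at h2
  calc A.1.1ᴴ * J * A.1.1 = J * J * (A.1.1ᴴ * J * A.1.1) := by rw [J_mul_J, Matrix.one_mul]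
    _ = J * (J * A.1.1ᴴ * J * A.1.1) := by simp only [Matrix.mul_assoc]
    _ = J := by rw [h2, Matrix.mul_one]

/-! ### The function `f` and loxodromic elements -/

/-- For roots with symmetric functions t, t̄, 1, the function f is the discriminant of the
characteristic polynomial. -/
theorem resultantFn_eq_disc {a b c : ℂ} (h3 : a * b * c = 1)
    (h2 : a * b + b * c + c * a = star (a + b + c)) :
    (resultantFn (a + b + c) : ℂ) = ((a - b) * (b - c) * (c - a)) ^ 2 := by
  have e := Complex.add_conj ((a + b + c) ^ 3)
  have e' : ((‖a + b + c‖ : ℂ)) ^ 2 = (a + b + c) * star (a + b + c) := (Complex.mul_conj' _).symm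
  rw [map_pow] at e
  change (a + b + c) ^ 3 + star (a + b + c) ^ 3 = _ at e
  rw [← h2] at e e'
  rw [resultantFn]
  push_cast at e ⊢
  rw [show ((‖a + b + c‖ : ℂ)) ^ 4 = ((‖a + b + c‖ : ℂ) ^ 2) ^ 2 by ring, e']
  linear_combination 4 * e + (4 * (a + b + c) ^ 3 -
    18 * (a + b + c) * (a * b + b * c + c * a) + 27 * (a * b * c + 1)) * h3

theorem one_lt_norm_of_resultantFn_pos {t : ℂ} (h : 0 < resultantFn t) : 1 < ‖t‖ := by
  by_contra hc
  push Not at hc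
  have h0 := norm_nonneg t
  have h1 := Complex.abs_re_le_norm (t ^ 3)
  rw [norm_pow] at h1
  have h2 := (abs_le.1 h1).1
  have h3 : ‖t‖ ^ 2 ≤ 1 := pow_le_one₀ h0 hc
  have h4 : ‖t‖ ^ 3 ≤ 1 := pow_le_one₀ h0 hc
  have h5 : ‖t‖ ^ 4 ≤ 1 := pow_le_one₀ h0 hc
  rw [resultantFn] at h
  linarith

theorem conj_eq_inv {z : ℂ} (h : ‖z‖ = 1) : star z = z⁻¹ := by
  rw [Complex.inv_def, Complex.normSq_eq_norm_sq, h]; simp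

theorem inv_disc {a b c : ℂ} (h : a * b * c = 1) :
    (a⁻¹ - b⁻¹) * (b⁻¹ - c⁻¹) * (c⁻¹ - a⁻¹) = -((a - b) * (b - c) * (c - a)) := by
  have ha : a⁻¹ = b * c := inv_eq_of_mul_eq_one_right (by linear_combination h)
  have hb : b⁻¹ = a * c := inv_eq_of_mul_eq_one_right (by linear_combination h)
  have hc : c⁻¹ = a * b := inv_eq_of_mul_eq_one_right (by linear_combination h)
  rw [ha, hb, hc]
  linear_combination (-((a - b) * (b - c) * (c - a))) * h

theorem root_conj_inv {t x : ℂ} (h : x ^ 3 - t * x ^ 2 + star t * x - 1 = 0) :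
    (star x)⁻¹ ^ 3 - t * (star x)⁻¹ ^ 2 + star t * (star x)⁻¹ - 1 = 0 := by
  have hx : star x ≠ 0 := by
    rw [Ne, star_eq_zero]; rintro rfl; simp at h
  have h' := congrArg star h
  simp only [star_sub, star_add, star_mul', star_pow, star_star, star_one, star_zero] at h'
  field_simp
  linear_combination -h'

/-- If all roots had modulus one, conjugation would invert them and negate the square root of the
discriminant, making f nonpositive. A root off the unit circle can then be moved outside by x ↦
1/x̄, which preserves the set of roots. -/
theorem exists_root_norm_gt_one {t : ℂ} (h : 0 < resultantFn t) :
    ∃ a : ℂ, 1 < ‖a‖ ∧ a ^ 3 - t * a ^ 2 + star t * a - 1 = 0 := by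
  have key : ∃ a : ℂ, ‖a‖ ≠ 1 ∧ a ^ 3 - t * a ^ 2 + star t * a - 1 = 0 := by
    by_contra hc
    push Not at hc
    have hroot : ∀ x : ℂ, x ^ 3 - t * x ^ 2 + star t * x - 1 = 0 → ‖x‖ = 1 := by
      intro x hx
      by_contra hne
      exact hc x hne hx
    obtain ⟨a, ha⟩ : ∃ a : ℂ, a ^ 3 - t * a ^ 2 + star t * a - 1 = 0 := by
      have hd : (Polynomial.X ^ 3 - Polynomial.C t * Polynomial.X ^ 2 +
          Polynomial.C (star t) * Polynomial.X - 1 : Polynomial ℂ).natDegree = 3 := by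
        compute_degree!
      obtain ⟨a, ha⟩ := Complex.exists_root (f := (Polynomial.X ^ 3 - Polynomial.C t *
        Polynomial.X ^ 2 + Polynomial.C (star t) * Polynomial.X - 1 : Polynomial ℂ))
        (Polynomial.natDegree_pos_iff_degree_pos.1 (by rw [hd]; norm_num))
      refine ⟨a, ?_⟩
      simpa [Polynomial.IsRoot] using ha
    obtain ⟨b, hb⟩ : ∃ b : ℂ, 1 * (b * b) + (a - t) * b + (a ^ 2 - t * a + star t) = 0 := by
      obtain ⟨s, hs⟩ := IsAlgClosed.exists_pow_nat_eq
        (discrim 1 (a - t) (a ^ 2 - t * a + star t)) (n := 2) (by norm_num)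
      exact exists_quadratic_eq_zero one_ne_zero ⟨s, by rw [← hs, sq]⟩
    obtain ⟨c, hcdef⟩ : ∃ c, c = t - a - b := ⟨_, rfl⟩
    have ht : t = a + b + c := by rw [hcdef]; ring
    have h2 : a * b + b * c + c * a = star t := by rw [hcdef]; linear_combination -hb
    have h3 : a * b * c = 1 := by rw [hcdef]; linear_combination ha - a * hb
    have hbr : b ^ 3 - t * b ^ 2 + star t * b - 1 = 0 := by
      rw [← h2, ht]; linear_combination h3
    have hcr : c ^ 3 - t * c ^ 2 + star t * c - 1 = 0 := by
      rw [← h2, ht]; linear_combination h3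
    have a0 : a ≠ 0 := by rintro rfl; simp at h3
    have b0 : b ≠ 0 := by rintro rfl; simp at h3
    have c0 : c ≠ 0 := by rintro rfl; simp at h3
    rw [ht] at h2 h
    have hdisc := resultantFn_eq_disc h3 h2
    have hconj : star ((a - b) * (b - c) * (c - a)) = -((a - b) * (b - c) * (c - a)) := by
      simp only [star_mul', star_sub, conj_eq_inv (hroot a ha), conj_eq_inv (hroot b hbr),
        conj_eq_inv (hroot c hcr)]
      exact inv_disc h3
    set w := (a - b) * (b - c) * (c - a)
    have hw : w.re = 0 := by
      have := congrArg Complex.re hconj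
      simp at this
      linarith
    have h5 := congrArg Complex.re hdisc
    rw [Complex.ofReal_re, sq, Complex.mul_re, hw] at h5
    nlinarith [sq_nonneg w.im]
  obtain ⟨a, ha, hr⟩ := key
  rcases lt_or_gt_of_ne ha with h1 | h1
  · refine ⟨(star a)⁻¹, ?_, root_conj_inv hr⟩
    have ha0 : a ≠ 0 := by rintro rfl; simp at hr
    rw [norm_inv, norm_star]
    exact (one_lt_inv₀ (norm_pos_iff.2 ha0)).2 h1
  · exact ⟨a, h1, hr⟩

theorem third_root {t a b : ℂ} (hab : a ≠ b) (ha : a ^ 3 - t * a ^ 2 + star t * a - 1 = 0)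
    (hb : b ^ 3 - t * b ^ 2 + star t * b - 1 = 0) :
    a * b * (t - a - b) = 1 ∧ a * b + b * (t - a - b) + (t - a - b) * a = star t := by
  have h1 : a ^ 2 + a * b + b ^ 2 - t * (a + b) + star t = 0 := by
    apply mul_left_cancel₀ (sub_ne_zero.2 hab)
    linear_combination ha - hb
  constructor
  · linear_combination ha - a * h1
  · linear_combination -h1

/-- The roots are a, 1/ā and ā/a, of distinct moduli. Conjugation exchanges the inverses of the
first two, so the square root of the discriminant is real and nonzero. -/
theorem resultantFn_pos_of_root {t a : ℂ} (hn : ‖a‖ ≠ 1)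
    (ha : a ^ 3 - t * a ^ 2 + star t * a - 1 = 0) : 0 < resultantFn t := by
  have a0 : a ≠ 0 := by rintro rfl; simp at ha
  have hpos : 0 < ‖a‖ := norm_pos_iff.2 a0
  have sa0 : star a ≠ 0 := by rwa [Ne, star_eq_zero]
  have hb := root_conj_inv ha
  set b := (star a)⁻¹ with hbdef
  have hbn : ‖b‖ = ‖a‖⁻¹ := by rw [hbdef, norm_inv, norm_star]
  have hab : a ≠ b := by
    intro h
    have h1 := congrArg norm h
    rw [hbn, ← one_div, eq_div_iff hpos.ne'] at h1
    rcases mul_self_eq_one_iff.1 h1 with h2 | h2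
    · exact hn h2
    · linarith
  obtain ⟨h3, h2⟩ := third_root hab ha hb
  obtain ⟨c, hcdef⟩ : ∃ c, c = t - a - b := ⟨_, rfl⟩
  rw [← hcdef] at h3 h2
  have ht : t = a + b + c := by rw [hcdef]; ring
  have b0 : b ≠ 0 := by rintro h0; simp [h0] at h3
  have hc : c = star a / a := by
    have : a * b ≠ 0 := mul_ne_zero a0 b0
    apply mul_left_cancel₀ this
    rw [h3, hbdef]; field_simp
  have hcn : ‖c‖ = 1 := by rw [hc, norm_div, norm_star, div_self hpos.ne']
  have hac : a ≠ c := fun h => hn (by rw [h, hcn])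
  have hbc : b ≠ c := fun h => hn (by
    have := congrArg norm h
    rw [hbn, hcn] at this
    exact inv_eq_one.1 this)
  have c0 : c ≠ 0 := by rw [← norm_pos_iff, hcn]; norm_num
  have hsb : star b = a⁻¹ := by rw [hbdef, star_inv₀, star_star]
  have hsa : star a = b⁻¹ := by rw [hbdef, inv_inv]
  rw [ht] at h2 ⊢
  have hdisc := resultantFn_eq_disc h3 h2
  have hconj : star ((a - b) * (b - c) * (c - a)) = (a - b) * (b - c) * (c - a) := by
    simp only [star_mul', star_sub, hsa, hsb, conj_eq_inv hcn]
    linear_combination -inv_disc h3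
  have hw0 : (a - b) * (b - c) * (c - a) ≠ 0 :=
    mul_ne_zero (mul_ne_zero (sub_ne_zero.2 hab) (sub_ne_zero.2 hbc)) (sub_ne_zero.2 hac.symm)
  set w := (a - b) * (b - c) * (c - a)
  have hw : w.im = 0 := by
    have := congrArg Complex.im hconj
    simp at this
    linarith
  have hwr : w.re ≠ 0 := fun h => hw0 (Complex.ext h hw)
  have h5 := congrArg Complex.re hdisc
  rw [Complex.ofReal_re, sq, Complex.mul_re, hw] at h5
  rw [h5]
  have := mul_self_pos.2 hwr
  linarith

/-! ### Isotropic vectors and boundary fixed points -/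

theorem hermForm_eq (v w : Fin 3 → ℂ) : hermForm v w = star w ⬝ᵥ (J *ᵥ v) := by
  simp [hermForm, J, dotProduct, Fin.sum_univ_three, Matrix.mulVec_diagonal]
  ring

theorem hermForm_mulVec (A : SU21) (v w : Fin 3 → ℂ) :
    hermForm (A.1.1 *ᵥ v) (A.1.1 *ᵥ w) = hermForm v w := by
  rw [hermForm_eq, hermForm_eq, Matrix.star_mulVec, ← Matrix.dotProduct_mulVec,
    Matrix.mulVec_mulVec, Matrix.mulVec_mulVec, Matrix.mul_assoc, ← Matrix.mul_assoc, unitary_mul]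

theorem hermForm_smul_smul (x y : ℂ) (v w : Fin 3 → ℂ) :
    hermForm (x • v) (y • w) = x * star y * hermForm v w := by
  simp [hermForm]; ring

/-- Two isotropic orthogonal vectors are proportional. -/
theorem hermForm_ne_zero {v w : Fin 3 → ℂ} (hv : hermForm v v = 0) (hw : hermForm w w = 0)
    (h : LinearIndependent ℂ ![v, w]) : hermForm v w ≠ 0 := by
  intro h0
  have hw0 : w ≠ 0 := h.ne_zero 1
  -- This combination is isotropic with vanishing last coordinate, where the form is positive
  -- definite, so it is zero.
  set u := w 2 • v - v 2 • w with hu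
  have h1 : hermForm u u = 0 := by
    have h0' : hermForm w v = 0 := by
      have : hermForm w v = star (hermForm v w) := by simp [hermForm]; ring
      rw [this, h0, star_zero]
    have : hermForm u u = w 2 * star (w 2) * hermForm v v - w 2 * star (v 2) * hermForm v w -
        v 2 * star (w 2) * hermForm w v + v 2 * star (v 2) * hermForm w w := by
      simp [hermForm, hu]; ring
    rw [this, hv, hw, h0, h0']; ring
  have isotropic : ∀ u : Fin 3 → ℂ, u 2 = 0 → hermForm u u = 0 → u = 0 := by
    intro u h2 h1
    rw [hermForm, h2] at h1
    simp only [Complex.star_def, Complex.mul_conj, zero_mul, sub_zero] at h1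
    norm_cast at h1
    have e0 := Complex.normSq_nonneg (u 0)
    have e1 := Complex.normSq_nonneg (u 1)
    have z0 : u 0 = 0 := Complex.normSq_eq_zero.1 (by linarith)
    have z1 : u 1 = 0 := Complex.normSq_eq_zero.1 (by linarith)
    ext i
    fin_cases i
    · exact z0
    · exact z1
    · exact h2
  have hu0 := isotropic u (by simp [hu]; ring) h1
  have hw2 : w 2 ≠ 0 := fun h2 => hw0 (isotropic w h2 hw)
  rw [LinearIndependent.pair_iff] at h
  have := (h (w 2) (-v 2) (by rw [neg_smul, ← sub_eq_add_neg]; exact hu0)).1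
  exact hw2 this

/-- The eigenvalues at the two fixed points satisfy μν̄ = 1. If they had modulus one they would
coincide, and every isotropic line in the span would be fixed, producing a third fixed point. -/
theorem IsLoxodromic.resultantFn_pos {A : SU21} (h : IsLoxodromic A) :
    0 < resultantFn (tr A) := by
  obtain ⟨p, q, hpq, hset⟩ := Set.encard_eq_two.1 h
  obtain ⟨hp0, μ, hp⟩ : p ∈ boundaryFixedPoints A := by rw [hset]; simp
  obtain ⟨hq0, ν, hq⟩ : q ∈ boundaryFixedPoints A := by rw [hset]; simp
  have hind : LinearIndependent ℂ ![p.rep, q.rep] := by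
    have := (Projectivization.independent_pair_iff_ne p q).2 hpq
    rw [Projectivization.independent_iff] at this
    have he : Projectivization.rep ∘ ![p, q] = ![p.rep, q.rep] := by
      ext i; fin_cases i <;> rfl
    rwa [he] at this
  have hne := hermForm_ne_zero hp0 hq0 hind
  have hμ : μ * star ν = 1 := by
    have := hermForm_mulVec A p.rep q.rep
    rw [hp, hq, hermForm_smul_smul] at this
    exact mul_right_cancel₀ hne (by rw [this, one_mul])
  refine resultantFn_pos_of_root (a := μ) ?_
    ((exists_eigenvector_iff A μ).1 ⟨p.rep, p.rep_nonzero, hp⟩)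
  intro hn
  have hνμ : ν = μ := by
    have h1 : ‖ν‖ = 1 := by
      have := congrArg norm hμ
      rwa [norm_mul, hn, one_mul, norm_star, norm_one] at this
    have hν0 : ν ≠ 0 := by rw [← norm_pos_iff, h1]; norm_num
    rw [conj_eq_inv h1] at hμ
    field_simp at hμ
    exact hμ.symm
  subst hνμ
  -- The factor i makes the two cross terms of the form at p + s q cancel.
  set s : ℂ := Complex.I * hermForm p.rep q.rep with hs
  have hs0 : s ≠ 0 := mul_ne_zero Complex.I_ne_zero hne
  set x := p.rep + s • q.rep with hx
  have hx0 : x ≠ 0 := by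
    intro h0
    rw [LinearIndependent.pair_iff] at hind
    exact one_ne_zero (hind 1 s (by rw [one_smul]; exact h0)).1
  have hxx : hermForm x x = 0 := by
    have e1 : hermForm x x = hermForm p.rep p.rep + star s * hermForm p.rep q.rep +
        s * star (hermForm p.rep q.rep) + s * star s * hermForm q.rep q.rep := by
      simp [hermForm, hx]; ring
    rw [e1, hp0, hq0, hs]
    simp
    ring
  have hAx : A.1.1 *ᵥ x = ν • x := by
    rw [hx, Matrix.mulVec_add, Matrix.mulVec_smul, hp, hq, smul_add, smul_comm]
  obtain ⟨c, hc⟩ := Projectivization.exists_smul_eq_mk_rep ℂ x hx0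
  have hmem : Projectivization.mk ℂ x hx0 ∈ boundaryFixedPoints A := by
    constructor
    · rw [← hc, Units.smul_def, hermForm_smul_smul, hxx, mul_zero]
    · exact ⟨ν, by rw [← hc, Units.smul_def, Matrix.mulVec_smul, hAx, smul_comm]⟩
  rw [hset] at hmem
  rw [LinearIndependent.pair_iff] at hind
  rcases hmem with h1 | h1
  · have h2 : (c : ℂ) • x = p.rep := by rw [← h1]; exact hc
    rw [hx, smul_add, smul_smul] at h2
    have := (hind ((c : ℂ) - 1) (c * s) (by
      rw [sub_smul, one_smul, sub_add_eq_add_sub, h2, sub_self])).2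
    exact mul_ne_zero c.ne_zero hs0 this
  · have h2 : (c : ℂ) • x = q.rep := by rw [← (show _ = q from h1)]; exact hc
    rw [hx, smul_add, smul_smul] at h2
    have := (hind (c : ℂ) (c * s - 1) (by
      rw [sub_smul, one_smul, ← add_sub_assoc, h2, sub_self])).1
    exact c.ne_zero this

/-! ### Traces around a region -/

/-- An isometry of a Hermitian form with two isotropic basis vectors that sends one of them
to the other line fixes the third direction up to a unit. -/
theorem norm_entry_eq_one {B : Matrix (Fin 3) (Fin 3) ℂ} {G : Matrix (Fin 3) (Fin 3) ℂ}
    (hG : Bᴴ * G * B = G) (hB : B.det = 1) (h00 : G 0 0 = 0) (h11 : G 1 1 = 0) (h02 : G 0 2 = 0)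
    (h12 : G 1 2 = 0) (h20 : G 2 0 = 0) (h21 : G 2 1 = 0) (h22 : G 2 2 ≠ 0) (h10 : G 1 0 ≠ 0)
    (h01 : ‖G 0 1‖ = ‖G 1 0‖) (h : B 0 0 = 0 ∨ B 1 1 = 0) : ‖B 2 2‖ = 1 := by
  have h01' : G 0 1 ≠ 0 := by rwa [← norm_pos_iff, h01, norm_pos_iff]
  have entry : ∀ i j, star (B 0 i) * G 0 1 * B 1 j + star (B 1 i) * G 1 0 * B 0 j +
      star (B 2 i) * G 2 2 * B 2 j = G i j := by
    intro i j
    conv_rhs => rw [← hG]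
    simp only [Matrix.mul_apply, Fin.sum_univ_three, Matrix.conjTranspose_apply, h00, h11, h02,
      h12, h20, h21]
    ring
  rw [Matrix.det_fin_three] at hB
  have e00 := entry 0 0
  have e11 := entry 1 1
  have e01 := entry 0 1
  have e10 := entry 1 0
  have e02 := entry 0 2
  have e12 := entry 1 2
  have fin : ∀ {x y : ℂ}, ‖x‖ * ‖y‖ = 1 → -(x * y * B 2 2) = 1 → ‖B 2 2‖ = 1 := by
    intro x y hxy h
    have := congrArg norm h
    rwa [norm_neg, norm_mul, norm_mul, hxy, one_mul, norm_one] at this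
  -- A zero diagonal entry forces the entry below it in the third row to vanish. The form then gives
  -- |B₀₁||B₁₀| = 1 and kills an entry of the third column, so the determinant reduces to
  -- -B₀₁B₁₀B₂₂.
  rcases h with h | h
  · have b20 : B 2 0 = 0 := by
      rw [h, h00] at e00
      simpa [h22] using e00
    rw [h, b20] at e01 e02
    simp only [star_zero, zero_mul, zero_add, add_zero] at e01 e02
    have hn : ‖B 0 1‖ * ‖B 1 0‖ = 1 := by
      have := congrArg norm e01
      rw [norm_mul, norm_mul, norm_star, h01] at this
      have hp := norm_pos_iff.2 h10
      apply mul_right_cancel₀ hp.ne'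
      linarith
    have b10 : B 1 0 ≠ 0 := by rintro h0; simp [h0] at hn
    have b02 : B 0 2 = 0 := by
      rw [h02] at e02
      simpa [h10, b10] using e02
    refine fin hn ?_
    rw [h, b20, b02] at hB
    linear_combination hB
  · have b21 : B 2 1 = 0 := by
      rw [h, h11] at e11
      simpa [h22] using e11
    rw [h, b21] at e10 e12
    simp only [star_zero, zero_mul, add_zero] at e10 e12
    have hn : ‖B 0 1‖ * ‖B 1 0‖ = 1 := by
      have := congrArg norm e10
      rw [norm_mul, norm_mul, norm_star, h01] at this
      have hp := norm_pos_iff.2 h10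
      apply mul_right_cancel₀ hp.ne'
      linarith
    have b01 : B 0 1 ≠ 0 := by rintro h0; simp [h0] at hn
    have b12 : B 1 2 = 0 := by
      rw [h12] at e12
      simpa [h01', b01] using e12
    refine fin hn ?_
    rw [h, b21, b12] at hB
    linear_combination hB

/-- The traces around a region whose value has positive `f`. -/
theorem exists_trace_formula {A : SU21} (hA : 0 < resultantFn (tr A)) (B : SU21) :
    ∃ a b c α β γ : ℂ, 1 < ‖a‖ ∧ ‖b‖ = ‖a‖⁻¹ ∧ ‖c‖ = 1 ∧
      (∀ n : ℤ, tr (A ^ n * B) = a ^ n * α + b ^ n * β + c ^ n * γ) ∧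
      (α = 0 ∨ β = 0 → ‖γ‖ = 1) := by
  obtain ⟨a, ha1, ha⟩ := exists_root_norm_gt_one hA
  have a0 : a ≠ 0 := by rintro rfl; simp at ha
  have hpos : 0 < ‖a‖ := norm_pos_iff.2 a0
  have sa0 : star a ≠ 0 := by rwa [Ne, star_eq_zero]
  have hb := root_conj_inv ha
  obtain ⟨b, hbdef⟩ : ∃ b, b = (star a)⁻¹ := ⟨_, rfl⟩
  rw [← hbdef] at hb
  have hbn : ‖b‖ = ‖a‖⁻¹ := by rw [hbdef, norm_inv, norm_star]
  have hb1 : ‖b‖ < 1 := by rw [hbn]; exact inv_lt_one_of_one_lt₀ ha1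
  have hab : a ≠ b := by rintro rfl; linarith
  obtain ⟨h3, h2⟩ := third_root hab ha hb
  obtain ⟨c, hcdef⟩ : ∃ c, c = tr A - a - b := ⟨_, rfl⟩
  rw [← hcdef] at h3 h2
  have b0 : b ≠ 0 := by rintro h0; simp [h0] at h3
  have c0 : c ≠ 0 := by rintro h0; simp [h0] at h3
  have hcn : ‖c‖ = 1 := by
    have hc : c = star a / a := by
      apply mul_left_cancel₀ (mul_ne_zero a0 b0)
      rw [h3, hbdef]; field_simp
    rw [hc, norm_div, norm_star, div_self hpos.ne']
  have hc : c ^ 3 - tr A * c ^ 2 + star (tr A) * c - 1 = 0 := by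
    have ht : tr A = a + b + c := by rw [hcdef]; ring
    rw [← h2, ht]; linear_combination h3
  have hac : a ≠ c := by rintro rfl; linarith
  have hbc : b ≠ c := by rintro rfl; linarith
  obtain ⟨e0, he0, hE0⟩ := (exists_eigenvector_iff A a).2 ha
  obtain ⟨e1, he1, hE1⟩ := (exists_eigenvector_iff A b).2 hb
  obtain ⟨e2, he2, hE2⟩ := (exists_eigenvector_iff A c).2 hc
  let d : Fin 3 → ℂ := ![a, b, c]
  let e : Fin 3 → Fin 3 → ℂ := ![e0, e1, e2]
  have hd0 : ∀ i, d i ≠ 0 := by intro i; fin_cases i <;> assumption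
  have hdinj : Function.Injective d := by
    intro i j hij
    fin_cases i <;> fin_cases j <;> simp [d] at hij ⊢ <;> tauto
  have hEv : ∀ i, A.1.1 *ᵥ e i = d i • e i := by intro i; fin_cases i <;> assumption
  have hlin : LinearIndependent ℂ e := by
    refine Module.End.eigenvectors_linearIndependent' (Matrix.toLin' A.1.1) d hdinj e ?_
    intro i
    rw [Module.End.hasEigenvector_iff, Module.End.mem_eigenspace_iff]
    refine ⟨by rw [Matrix.toLin'_apply]; exact hEv i, ?_⟩
    fin_cases i <;> assumption
  let Q : Matrix (Fin 3) (Fin 3) ℂ := (Matrix.of e)ᵀ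
  have hQ : IsUnit Q := by
    rw [← Matrix.linearIndependent_cols_iff_isUnit]
    exact hlin
  have hQd : IsUnit Q.det := (Matrix.isUnit_iff_isUnit_det Q).1 hQ
  have hAQ : A.1.1 * Q = Q * Matrix.diagonal d := by
    ext i j
    rw [Matrix.mul_diagonal]
    have := congrFun (hEv j) i
    simpa [Q, Matrix.mul_apply, Matrix.mulVec, dotProduct, mul_comm] using this
  have hAn : ∀ n : ℤ, (A ^ n).1.1 * Q = Q * Matrix.diagonal (fun i => d i ^ n) := by
    have hstep : ∀ (X : SU21) (n : ℤ), X.1.1 * Q = Q * Matrix.diagonal (fun i => d i ^ n) →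
        (X * A).1.1 * Q = Q * Matrix.diagonal (fun i => d i ^ (n + 1)) := by
      intro X n h
      change X.1.1 * A.1.1 * Q = _
      rw [Matrix.mul_assoc, hAQ, ← Matrix.mul_assoc, h, Matrix.mul_assoc,
        Matrix.diagonal_mul_diagonal]
      congr 2
      funext i
      rw [zpow_add_one₀ (hd0 i)]
    have hAinv : (A⁻¹).1.1 * Q = Q * Matrix.diagonal (fun i => (d i)⁻¹) := by
      have h1 : (A⁻¹).1.1 * A.1.1 = 1 := by
        change (A⁻¹ * A).1.1 = 1
        rw [inv_mul_cancel]; rfl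
      have h2 : Matrix.diagonal d * Matrix.diagonal (fun i => (d i)⁻¹) = 1 := by
        rw [Matrix.diagonal_mul_diagonal, ← Matrix.diagonal_one]
        congr 1; funext i; exact mul_inv_cancel₀ (hd0 i)
      calc (A⁻¹).1.1 * Q = (A⁻¹).1.1 * (Q * Matrix.diagonal d) *
            Matrix.diagonal (fun i => (d i)⁻¹) := by
              rw [Matrix.mul_assoc, Matrix.mul_assoc Q, h2, Matrix.mul_one]
        _ = _ := by rw [← hAQ, ← Matrix.mul_assoc, h1, Matrix.one_mul]
    intro n
    induction n using Int.induction_on with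
    | zero => simp
    | succ n ih => rw [zpow_add_one]; exact hstep _ _ ih
    | pred n ih =>
      rw [zpow_sub_one]
      change (A ^ (-(n : ℤ))).1.1 * (A⁻¹).1.1 * Q = _
      rw [Matrix.mul_assoc, hAinv, ← Matrix.mul_assoc, ih, Matrix.mul_assoc,
        Matrix.diagonal_mul_diagonal]
      congr 2
      funext i
      rw [zpow_sub_one₀ (hd0 i)]
  -- The coefficients α, β, γ are the diagonal entries of B in an eigenbasis of A.
  obtain ⟨C, hC⟩ : ∃ C, C = Q⁻¹ * B.1.1 * Q := ⟨_, rfl⟩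
  have hQC : Q * C = B.1.1 * Q := by
    rw [hC, Matrix.mul_assoc, Matrix.mul_nonsing_inv_cancel_left _ _ hQd]
  refine ⟨a, b, c, C 0 0, C 1 1, C 2 2, ha1, hbn, hcn, ?_, ?_⟩
  · intro n
    have h1 : tr (A ^ n * B) = (Matrix.diagonal (fun i => d i ^ n) * C).trace := by
      change ((A ^ n).1.1 * B.1.1).trace = _
      have : B.1.1 = Q * C * Q⁻¹ := by rw [hQC, Matrix.mul_nonsing_inv_cancel_right _ _ hQd]
      rw [this, ← Matrix.mul_assoc, ← Matrix.mul_assoc, hAn, Matrix.mul_assoc Q, Matrix.mul_assoc Q,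
        Matrix.trace_mul_comm, Matrix.mul_assoc, Matrix.nonsing_inv_mul _ hQd, Matrix.mul_one]
    rw [h1, Matrix.trace_fin_three]
    simp [Matrix.diagonal_mul, d]
  · intro h0
    let G := Qᴴ * J * Q
    have hJdet : IsUnit J.det := by
      rw [J, Matrix.det_diagonal]
      simp [Fin.prod_univ_three]
    have hGA : ∀ i j, star (d i) * d j * G i j = G i j := by
      have h1 : (Matrix.diagonal d)ᴴ * G * Matrix.diagonal d = G := by
        calc (Matrix.diagonal d)ᴴ * (Qᴴ * J * Q) * Matrix.diagonal d
            = (Q * Matrix.diagonal d)ᴴ * J * (Q * Matrix.diagonal d) := by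
              rw [Matrix.conjTranspose_mul]; simp only [Matrix.mul_assoc]
          _ = Qᴴ * (A.1.1ᴴ * J * A.1.1) * Q := by
              rw [← hAQ, Matrix.conjTranspose_mul]; simp only [Matrix.mul_assoc]
          _ = G := by rw [unitary_mul]
      intro i j
      have := congrFun (congrFun h1 i) j
      rw [Matrix.mul_diagonal, Matrix.diagonal_conjTranspose, Matrix.diagonal_mul] at this
      conv_rhs => rw [← this]
      rw [Pi.star_apply]
      ring
    -- Invariance makes eigenvectors orthogonal unless the moduli of their eigenvalues multiply to
    -- one. The Gram matrix thus pairs the first two vectors and leaves the third orthogonal to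
    -- both.
    have hGz : ∀ i j, ‖d i‖ * ‖d j‖ ≠ 1 → G i j = 0 := by
      intro i j hij
      by_contra hne
      apply hij
      have := mul_right_cancel₀ hne ((hGA i j).trans (one_mul _).symm)
      have := congrArg norm this
      rwa [norm_mul, norm_star, norm_one] at this
    have hGstar : ∀ i j, G j i = star (G i j) := by
      have hJ : Jᴴ = J := by
        rw [J, Matrix.diagonal_conjTranspose]
        congr 1
        funext i
        fin_cases i <;> simp
      have h1 : Gᴴ = G := by
        simp only [G, Matrix.conjTranspose_mul, Matrix.conjTranspose_conjTranspose, hJ,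
          Matrix.mul_assoc]
      intro i j
      rw [← Matrix.conjTranspose_apply, h1]
    have hGB : Cᴴ * G * C = G := by
      calc Cᴴ * (Qᴴ * J * Q) * C = (Q * C)ᴴ * J * (Q * C) := by
            rw [Matrix.conjTranspose_mul]; simp only [Matrix.mul_assoc]
        _ = Qᴴ * (B.1.1ᴴ * J * B.1.1) * Q := by
            rw [hQC, Matrix.conjTranspose_mul]; simp only [Matrix.mul_assoc]
        _ = G := by rw [unitary_mul]
    have hCdet : C.det = 1 := by
      have h1 := congrArg Matrix.det hQC
      rw [Matrix.det_mul, Matrix.det_mul, B.1.2, one_mul] at h1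
      exact mul_left_cancel₀ hQd.ne_zero (by rw [h1, mul_one])
    have hGdet : G.det ≠ 0 := by
      simp only [G, Matrix.det_mul, Matrix.det_conjTranspose]
      exact mul_ne_zero (mul_ne_zero (star_ne_zero.2 hQd.ne_zero) hJdet.ne_zero) hQd.ne_zero
    have g00 : G 0 0 = 0 := hGz 0 0 (by
      change ‖a‖ * ‖a‖ ≠ 1
      nlinarith)
    have g11 : G 1 1 = 0 := hGz 1 1 (by
      change ‖b‖ * ‖b‖ ≠ 1
      have := norm_nonneg b
      nlinarith)
    have g02 : G 0 2 = 0 := hGz 0 2 (by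
      change ‖a‖ * ‖c‖ ≠ 1
      rw [hcn]; linarith)
    have g12 : G 1 2 = 0 := hGz 1 2 (by
      change ‖b‖ * ‖c‖ ≠ 1
      rw [hcn]; linarith)
    have g20 : G 2 0 = 0 := by rw [hGstar 0 2, g02, star_zero]
    have g21 : G 2 1 = 0 := by rw [hGstar 1 2, g12, star_zero]
    rw [Matrix.det_fin_three, g00, g11, g02, g12, g20, g21] at hGdet
    exact norm_entry_eq_one hGB hCdet g00 g11 g02 g12 g20 g21
      (by rintro h; simp [h] at hGdet) (by rintro h; simp [h] at hGdet)
      (by rw [hGstar 1 0, norm_star]) h0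

/-- The term aⁿα dominates as n → +∞ and bⁿβ as n → -∞. -/
theorem growsExponentially_of_formula {u : ℤ → ℂ} {a b c α β γ : ℂ} (ha : 1 < ‖a‖)
    (hb : ‖b‖ = ‖a‖⁻¹) (hc : ‖c‖ = 1) (hu : ∀ n, u n = a ^ n * α + b ^ n * β + c ^ n * γ)
    (hα : α ≠ 0) (hβ : β ≠ 0) : GrowsExponentially u := by
  have hα' := norm_pos_iff.2 hα
  have hβ' := norm_pos_iff.2 hβ
  -- Beyond N, half of the dominant term absorbs the other two; this explains the factor 2 here and
  -- the constant half the minimum below.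
  obtain ⟨N, hN⟩ := (tendsto_pow_atTop_atTop_of_one_lt ha).eventually_ge_atTop
    (2 * (‖α‖ + ‖β‖ + ‖γ‖) / min ‖α‖ ‖β‖) |>.exists_forall_of_atTop
  have hm : 0 < min ‖α‖ ‖β‖ := lt_min hα' hβ'
  refine ⟨min ‖α‖ ‖β‖ / 2, by positivity, ‖a‖, ha, N, fun n hn => ?_⟩
  have h1 := hN n.natAbs hn
  rw [div_le_iff₀ hm] at h1
  have hr : (1 : ℝ) ≤ ‖a‖ ^ n.natAbs := one_le_pow₀ ha.le
  have hγ : ‖c ^ n * γ‖ = ‖γ‖ := by rw [norm_mul, norm_zpow, hc, one_zpow, one_mul]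
  have hinv : (‖a‖ ^ n.natAbs)⁻¹ ≤ 1 := inv_le_one_of_one_le₀ hr
  have hinv0 : 0 ≤ (‖a‖ ^ n.natAbs)⁻¹ := by positivity
  have tri : ∀ x y z : ℂ, ‖x‖ - ‖y‖ - ‖z‖ ≤ ‖x + y + z‖ := by
    intro x y z
    have h1 := norm_sub_le (x + y + z) y
    have h2 := norm_sub_le (x + y + z - y) z
    have h3 : x + y + z - y - z = x := by ring
    rw [h3] at h2
    linarith
  have hm1 := min_le_left ‖α‖ ‖β‖
  have hm2 := min_le_right ‖α‖ ‖β‖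
  set m := min ‖α‖ ‖β‖
  set r := ‖a‖ ^ n.natAbs
  rw [hu]
  rcases Int.natAbs_eq n with h | h
  · have e1 : ‖a ^ n * α‖ = r * ‖α‖ := by
      rw [norm_mul, norm_zpow, h, zpow_natCast]
    have e2 : ‖b ^ n * β‖ = r⁻¹ * ‖β‖ := by
      rw [norm_mul, norm_zpow, hb, h, zpow_natCast, inv_pow]
    have := tri (a ^ n * α) (b ^ n * β) (c ^ n * γ)
    rw [e1, e2, hγ] at this
    nlinarith [norm_nonneg γ]
  · have e1 : ‖b ^ n * β‖ = r * ‖β‖ := by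
      rw [norm_mul, norm_zpow, hb, h, zpow_neg, zpow_natCast, inv_pow, inv_inv]
    have e2 : ‖a ^ n * α‖ = r⁻¹ * ‖α‖ := by
      rw [norm_mul, norm_zpow, h, zpow_neg, zpow_natCast]
    have := tri (b ^ n * β) (a ^ n * α) (c ^ n * γ)
    rw [e1, e2, hγ, add_comm (b ^ n * β)] at this
    nlinarith [norm_nonneg γ]

/-- The constant `2` is admissible for every boundary trace. -/
theorem isNeighborConstant_two (c : ℂ) : IsNeighborConstant c 2 := by
  intro ρ _ φ hf hgrow
  obtain ⟨a, b, c, α, β, γ, ha, hb, hc, hu, hγ⟩ :=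
    exists_trace_formula hf (ρ (φ genB))
  have hu' : ∀ n : ℤ, tr (ρ (φ genA ^ n * φ genB)) = a ^ n * α + b ^ n * β + c ^ n * γ := by
    intro n
    rw [map_mul, map_zpow, hu]
  by_cases hαβ : α = 0 ∨ β = 0
  swap
  · push Not at hαβ
    exact absurd (growsExponentially_of_formula ha hb hc hu' hαβ.1 hαβ.2) hgrow
  have hγ1 := hγ hαβ
  have hlim := (tendsto_pow_atTop_nhds_zero_of_lt_one (inv_nonneg.2 (norm_nonneg a))
    (inv_lt_one_of_one_lt₀ ha)).mul_const (‖α‖ + ‖β‖)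
  rw [zero_mul] at hlim
  obtain ⟨N, hN⟩ := (hlim.eventually_lt_const one_pos).exists_forall_of_atTop
  have hcn : ∀ n : ℤ, ‖c ^ n * γ‖ = 1 := fun n => by
    rw [norm_mul, norm_zpow, hc, one_zpow, one_mul, hγ1]
  -- The remaining nonunimodular term decays towards +∞ if α = 0 and towards -∞ if β = 0, while cⁿγ
  -- keeps modulus one. Any constant above 1 would serve.
  rcases hαβ with h0 | h0
  · refine Set.infinite_of_injective_forall_mem (f := fun n : ℕ => ((n + N : ℕ) : ℤ))
      (fun x y h => by simpa using h) (fun n => ?_)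
    change ‖_‖ < 2
    have h1 := hN (n + N) (by omega)
    rw [hu', h0, mul_zero, zero_add]
    refine (norm_add_le _ _).trans_lt ?_
    rw [hcn, norm_mul, zpow_natCast, norm_pow, hb]
    rw [h0, norm_zero, zero_add] at h1
    linarith
  · refine Set.infinite_of_injective_forall_mem (f := fun n : ℕ => -((n + N : ℕ) : ℤ))
      (fun x y h => by simpa using h) (fun n => ?_)
    change ‖_‖ < 2
    have h1 := hN (n + N) (by omega)
    rw [hu', h0, mul_zero, add_zero]
    refine (norm_add_le _ _).trans_lt ?_
    rw [hcn, norm_mul, zpow_neg, zpow_natCast, norm_inv, norm_pow, ← inv_pow]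
    rw [h0, norm_zero, add_zero] at h1
    linarith

/-! ### The boundary trace in other bases -/

/-- Automorphisms preserve the peripheral class. -/
theorem map_commutator (φ : MulAut F2) :
    freeHomotopySetoid (φ (genA * genB * genA⁻¹ * genB⁻¹)) (genA * genB * genA⁻¹ * genB⁻¹) := by
  have hmap : ∀ (ψ : MulAut F2) {g h : F2}, freeHomotopySetoid g h →
      freeHomotopySetoid (ψ g) (ψ h) := by
    intro ψ g h hgh
    rcases hgh with hgh | hgh
    · exact Or.inl (MonoidHom.map_isConj ψ.toMonoidHom hgh)
    · right
      rw [← map_inv]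
      exact MonoidHom.map_isConj ψ.toMonoidHom hgh
  induction mem_elementarySubgroup φ using Subgroup.closure_induction with
  | mem x hx =>
    rcases hx with (rfl | rfl | rfl) | ⟨c, rfl⟩
    · exact Or.inr (isConj_iff.2 ⟨1, by simp [mul_assoc]⟩)
    · exact Or.inr (isConj_iff.2 ⟨genB, by simp [mul_assoc]⟩)
    · exact Or.inl (isConj_iff.2 ⟨genA⁻¹, by simp [mul_assoc]⟩)
    · exact Or.inl (isConj_iff.2 ⟨c⁻¹, by simp [mul_assoc]⟩)
  | one => exact freeHomotopySetoid.refl _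
  | mul x y _ _ hx hy => exact freeHomotopySetoid.trans (hmap x hy) hx
  | inv x _ hx =>
    have := hmap x⁻¹ (freeHomotopySetoid.symm hx)
    rwa [MulAut.inv_apply_self] at this

/-- An automorphism may invert the peripheral class, which conjugates its trace; only the real part
is invariant, and only it enters the edge relation. -/
theorem re_tr_commutator (ρ : F2 →* SU21) (φ : MulAut F2) :
    (tr (ρ (φ genA) * ρ (φ genB) * (ρ (φ genA))⁻¹ * (ρ (φ genB))⁻¹)).re =
      (boundaryTrace ρ).re := by
  have key : ∀ g h : F2, IsConj g h → tr (ρ g) = tr (ρ h) := by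
    intro g h hgh
    obtain ⟨c, rfl⟩ := isConj_iff.1 hgh
    rw [map_mul, map_mul, map_inv, tr_conj]
  have h1 : ρ (φ genA) * ρ (φ genB) * (ρ (φ genA))⁻¹ * (ρ (φ genB))⁻¹ =
      ρ (φ (genA * genB * genA⁻¹ * genB⁻¹)) := by simp only [map_mul, map_inv]
  rw [h1, boundaryTrace]
  rcases map_commutator φ with h | h
  · rw [key _ _ h]
  · rw [key _ _ h, map_inv, tr_inv]
    simp

/-! ### Cones of curves -/

/-- The curve `Z` has coordinates `(p, q)` in the basis `ψ`, for suitable orientations. -/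
def InCone (ψ : MulAut F2) (p q : ℕ) (Z : Curve) : Prop :=
  ∃ φ, curveA φ = Z ∧ vec (φ genA) = p • vec (ψ genA) + q • vec (ψ genB)

theorem vec_apply_eq (θ : MulAut F2) {g h : F2} (H : vec g = vec h) : vec (θ g) = vec (θ h) := by
  rw [vec_aut, H, ← vec_aut]

theorem InCone.coord_eq {ψ : MulAut F2} {p q : ℕ} {Z : Curve} (h : InCone ψ p q Z) :
    coord ψ Z = (p, q) := by
  obtain ⟨φ, rfl, hv⟩ := h
  have h1 : vec (φ genA) = vec (ψ (genA ^ p * genB ^ q)) := by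
    rw [hv]; simp only [map_mul, map_pow, vec_mul, vec_pow]
  rw [coord_curveA, vec_apply_eq ψ⁻¹ h1, MulAut.inv_apply_self]
  simp

theorem InCone.eq_of_eq {ψ χ : MulAut F2} {p q : ℕ} {Z : Curve} (h : InCone ψ p q Z)
    (hv : p • vec (ψ genA) + q • vec (ψ genB) = vec (χ genA)) : Z = curveA χ := by
  obtain ⟨φ, rfl, hφ⟩ := h
  exact curveA_eq_of_vec (Or.inl (hφ.trans hv))

theorem inCone_mulAut_iff {ψ : MulAut F2} {p q : ℕ} {Z : Curve} :
    InCone (ψ * mulAut) p q Z ↔ InCone ψ (p + q) q Z := by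
  unfold InCone
  simp only [MulAut.mul_apply, mulAut_genA, mulAut_genB, map_mul, vec_mul, smul_add, add_smul,
    add_assoc]

theorem inCone_mulAutR_iff {ψ : MulAut F2} {p q : ℕ} {Z : Curve} :
    InCone (ψ * mulAutR) p q Z ↔ InCone ψ p (p + q) Z := by
  unfold InCone
  simp only [MulAut.mul_apply, mulAutR_genA, mulAutR_genB, map_mul, vec_mul, smul_add, add_smul,
    add_assoc]

theorem inCone_swap_iff {ψ : MulAut F2} {p q : ℕ} {Z : Curve} :
    InCone (ψ * swapAut) p q Z ↔ InCone ψ q p Z := by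
  unfold InCone
  simp only [MulAut.mul_apply, swapAut_genA, swapAut_genB, add_comm]

theorem inCone_fwd (ψ : MulAut F2) : InCone ψ 1 1 (curveB (ψ * mulAut)) :=
  ⟨ψ * mulAut * swapAut, curveA_swap _, by simp [MulAut.mul_apply]⟩

/-- One step of the subtractive Euclidean algorithm. Coordinates of a curve are coprime, so a zero
or a tie leaves only the two basis curves and their sum. -/
theorem InCone.cases {ψ : MulAut F2} {p q : ℕ} {Z : Curve} (h : InCone ψ p q Z) :
    (p = 1 ∧ q = 0 ∧ Z = curveA ψ) ∨ (p = 0 ∧ q = 1 ∧ Z = curveB ψ) ∨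
    (p = 1 ∧ q = 1 ∧ Z = curveB (ψ * mulAut)) ∨
    (0 < q ∧ q < p ∧ InCone (ψ * mulAut) (p - q) q Z) ∨
    (0 < p ∧ p < q ∧ InCone (ψ * mulAutR) p (q - p) Z) := by
  have hc := h.coord_eq
  obtain ⟨w, hw⟩ : ∃ w, Unimodular (p, q) w := by
    obtain ⟨φ, rfl, _⟩ := h
    exact ⟨_, hc ▸ unimodular_coord ψ φ⟩
  simp only [Unimodular] at hw
  rcases Nat.eq_zero_or_pos q with rfl | hq
  · have : p * w.2 = 1 := by rw [zero_mul] at hw; omega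
    obtain rfl : p = 1 := (mul_eq_one.1 this).1
    exact Or.inl ⟨rfl, rfl, h.eq_of_eq (by simp)⟩
  rcases Nat.eq_zero_or_pos p with rfl | hp
  · have : q * w.1 = 1 := by rw [zero_mul] at hw; omega
    obtain rfl : q = 1 := (mul_eq_one.1 this).1
    refine Or.inr (Or.inl ⟨rfl, rfl, ?_⟩)
    rw [← curveA_swap]
    exact h.eq_of_eq (by simp [MulAut.mul_apply])
  rcases lt_trichotomy p q with hpq | rfl | hpq
  · refine Or.inr (Or.inr (Or.inr (Or.inr ⟨hp, hpq, ?_⟩)))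
    rw [inCone_mulAutR_iff, Nat.add_sub_cancel' hpq.le]
    exact h
  · obtain rfl : p = 1 := by
      rcases hw with hw | hw
      · have : p ∣ 1 := (Nat.dvd_add_right ⟨w.1, rfl⟩).1 (hw ▸ ⟨w.2, rfl⟩)
        exact Nat.dvd_one.1 this
      · have : p ∣ 1 := (Nat.dvd_add_right ⟨w.2, rfl⟩).1 (hw ▸ ⟨w.1, rfl⟩)
        exact Nat.dvd_one.1 this
    refine Or.inr (Or.inr (Or.inl ⟨rfl, rfl, ?_⟩))
    rw [← curveA_swap]
    exact h.eq_of_eq (by simp [MulAut.mul_apply])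
  · refine Or.inr (Or.inr (Or.inr (Or.inl ⟨hq, hpq, ?_⟩)))
    rw [inCone_mulAut_iff, Nat.sub_add_cancel hpq.le]
    exact h

/-- Each curve lies in one of the two cones of a basis. -/
theorem inCone_or (θ : MulAut F2) (Z : Curve) :
    InCone θ (coord θ Z).1 (coord θ Z).2 Z ∨
      InCone (θ * invAut) (coord θ Z).1 (coord θ Z).2 Z := by
  obtain ⟨φ, rfl⟩ := exists_curveA Z
  have key : ∀ φ : MulAut F2, 0 ≤ (vec (θ⁻¹ (φ genA))).1 →
      InCone θ (coord θ (curveA φ)).1 (coord θ (curveA φ)).2 (curveA φ) ∨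
      InCone (θ * invAut) (coord θ (curveA φ)).1 (coord θ (curveA φ)).2 (curveA φ) := by
    intro φ h1
    have hv : vec (φ genA) = (vec (θ⁻¹ (φ genA))).1 • vec (θ genA) +
        (vec (θ⁻¹ (φ genA))).2 • vec (θ genB) := by
      rw [← vec_aut, MulAut.apply_inv_self]
    rw [coord_curveA]
    generalize vec (θ⁻¹ (φ genA)) = x at *
    obtain ⟨x, y⟩ := x
    rcases le_total 0 y with h2 | h2
    · left
      refine ⟨φ, rfl, ?_⟩
      lift x to ℕ using h1
      lift y to ℕ using h2
      simpa using hv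
    · right
      refine ⟨φ, rfl, ?_⟩
      lift x to ℕ using h1
      obtain ⟨y, rfl⟩ : ∃ z : ℕ, y = -(z : ℤ) := ⟨y.natAbs, by omega⟩
      rw [hv]
      simp [MulAut.mul_apply]
  rcases le_total 0 (vec (θ⁻¹ (φ genA))).1 with h | h
  · exact key φ h
  · have hs : (φ * (swapAut * invAut * swapAut)) genA = (φ genA)⁻¹ := by simp [MulAut.mul_apply]
    have hA : curveA φ = curveA (φ * (swapAut * invAut * swapAut)) :=
      curveA_eq_of_vec (Or.inr (by rw [hs, vec_inv, neg_neg]))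
    rw [hA]
    apply key
    rw [hs, map_inv, vec_inv]
    simpa using h

/-! ### The upper bound -/

/-- Submultiplicativity of three times the largest entry. -/
theorem entry_bound_mul {A B : Matrix (Fin 3) (Fin 3) ℂ} {x y : ℝ} (hx : 0 ≤ x)
    (hA : ∀ i j, 3 * ‖A i j‖ ≤ x) (hB : ∀ i j, 3 * ‖B i j‖ ≤ y) (i j : Fin 3) :
    3 * ‖(A * B) i j‖ ≤ x * y := by
  have h : ∀ k, 3 * ‖A i k * B k j‖ ≤ x * y / 3 := by
    intro k
    rw [norm_mul]
    have := mul_le_mul (hA i k) (hB k j) (by positivity) hx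
    linarith
  rw [Matrix.mul_apply, Fin.sum_univ_three]
  have h1 := norm_add₃_le (a := A i 0 * B 0 j) (b := A i 1 * B 1 j) (c := A i 2 * B 2 j)
  have := h 0
  have := h 1
  have := h 2
  linarith

theorem exists_entry_bound (A : SU21) : ∃ s : ℝ, 0 ≤ s ∧ ∀ i j, 3 * ‖A.1.1 i j‖ ≤ Real.exp s := by
  refine ⟨∑ i, ∑ j, 3 * ‖A.1.1 i j‖, by positivity, fun i j => ?_⟩
  have h1 : 3 * ‖A.1.1 i j‖ ≤ ∑ j, 3 * ‖A.1.1 i j‖ :=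
    Finset.single_le_sum (f := fun j => 3 * ‖A.1.1 i j‖) (fun _ _ => by positivity)
      (Finset.mem_univ j)
  have h2 : ∑ j, 3 * ‖A.1.1 i j‖ ≤ ∑ i, ∑ j, 3 * ‖A.1.1 i j‖ :=
    Finset.single_le_sum (f := fun i => ∑ j, 3 * ‖A.1.1 i j‖) (fun _ _ => by positivity)
      (Finset.mem_univ i)
  have h3 := Real.add_one_le_exp (∑ i, ∑ j, 3 * ‖A.1.1 i j‖)
  linarith

theorem norm_tr_le {A : SU21} {x : ℝ} (hA : ∀ i j, 3 * ‖A.1.1 i j‖ ≤ x) : ‖tr A‖ ≤ x := by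
  rw [tr, Matrix.trace_fin_three]
  have h1 := norm_add₃_le (a := A.1.1 0 0) (b := A.1.1 1 1) (c := A.1.1 2 2)
  have := hA 0 0
  have := hA 1 1
  have := hA 2 2
  linarith

/-- Three times the largest entry is submultiplicative and bounds the trace. The exponents add when
the basis is transvected, so ps + qt is unchanged along the Euclidean algorithm. -/
theorem absTrace_le_exp (ρ : F2 →* SU21) (n : ℕ) : ∀ (ψ : MulAut F2) (s t : ℝ) (p q : ℕ)
    (Z : Curve), p + q = n → InCone ψ p q Z →
    (∀ i j, 3 * ‖(ρ (ψ genA)).1.1 i j‖ ≤ Real.exp s) →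
    (∀ i j, 3 * ‖(ρ (ψ genB)).1.1 i j‖ ≤ Real.exp t) →
    absTrace ρ Z ≤ Real.exp (p * s + q * t) := by
  induction n using Nat.strong_induction_on with
  | _ n ih =>
  intro ψ s t p q Z hn hZ hs ht
  have hst : ∀ i j, 3 * ‖(ρ (ψ (genA * genB))).1.1 i j‖ ≤ Real.exp (s + t) := by
    intro i j
    rw [map_mul, map_mul, Real.exp_add]
    exact entry_bound_mul (Real.exp_pos s).le hs ht i j
  rcases hZ.cases with ⟨rfl, rfl, rfl⟩ | ⟨rfl, rfl, rfl⟩ | ⟨rfl, rfl, rfl⟩ | ⟨h0, h1, h2⟩ |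
    ⟨h0, h1, h2⟩
  · rw [Nat.cast_one, Nat.cast_zero, one_mul, zero_mul, add_zero]
    exact norm_tr_le hs
  · rw [Nat.cast_one, Nat.cast_zero, one_mul, zero_mul, zero_add]
    exact norm_tr_le ht
  · have := norm_tr_le hst
    rw [Nat.cast_one, one_mul, one_mul]
    rw [← mulAut_genB] at this
    exact this
  · have := ih p (by omega) (ψ * mulAut) s (s + t) (p - q) q Z (by omega) h2
      (by simpa [MulAut.mul_apply] using hs)
      (by rw [MulAut.mul_apply, mulAut_genB]; exact hst)
    convert this using 2
    rw [Nat.cast_sub h1.le]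
    ring
  · have := ih q (by omega) (ψ * mulAutR) (s + t) t p (q - p) Z (by omega) h2
      (by rw [MulAut.mul_apply, mulAutR_genA]; exact hst)
      (by simpa [MulAut.mul_apply] using ht)
    convert this using 2
    rw [Nat.cast_sub h1.le]
    ring

theorem hasUpperFibBound (ρ : F2 →* SU21) (v : EdgeVertex) :
    HasUpperFibBound v (logPlusTrace ρ) Set.univ := by
  obtain ⟨θ, hθ⟩ := exists_basis v
  have cone : ∀ ψ : MulAut F2, ∃ κ : ℝ, 0 ≤ κ ∧ ∀ p q Z, InCone ψ p q Z →
      logPlusTrace ρ Z ≤ κ * ((p + q : ℕ) : ℝ) := by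
    intro ψ
    obtain ⟨s, hs0, hs⟩ := exists_entry_bound (ρ (ψ genA))
    obtain ⟨t, ht0, ht⟩ := exists_entry_bound (ρ (ψ genB))
    refine ⟨s + t, by positivity, fun p q Z hZ => ?_⟩
    have h1 := absTrace_le_exp ρ _ ψ s t p q Z rfl hZ hs ht
    have hp : (0 : ℝ) ≤ p := p.cast_nonneg
    have hq : (0 : ℝ) ≤ q := q.cast_nonneg
    have h2 : p * s + q * t ≤ (s + t) * ((p + q : ℕ) : ℝ) := by
      push_cast
      nlinarith [mul_nonneg hp ht0, mul_nonneg hq hs0]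
    have h3 : 0 ≤ p * s + q * t := by positivity
    refine le_trans ?_ h2
    rw [logPlusTrace, Real.posLog]
    refine max_le h3 ?_
    have h0 : 0 ≤ absTrace ρ Z := by
      obtain ⟨φ, rfl⟩ := exists_curveA Z
      exact norm_nonneg _
    rcases h0.eq_or_lt with h0 | h0
    · rw [← h0, Real.log_zero]; exact h3
    · exact (Real.log_le_iff_le_exp h0).2 h1
  obtain ⟨κ₁, h1, hc1⟩ := cone θ
  obtain ⟨κ₂, h2, hc2⟩ := cone (θ * invAut)
  refine ⟨κ₁ + κ₂ + 1, by positivity, fun X _ => ?_⟩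
  rw [fib_eq_coord θ hθ]
  rcases inCone_or θ X with h | h
  · refine (hc1 _ _ _ h).trans (mul_le_mul_of_nonneg_right (by linarith) (Nat.cast_nonneg _))
  · refine (hc2 _ _ _ h).trans (mul_le_mul_of_nonneg_right (by linarith) (Nat.cast_nonneg _))

/-! ### The lower bound -/

theorem one_lt_absTrace {ρ : F2 →* SU21} (h : ∀ g : F2, IsPrimitive g → IsLoxodromic (ρ g))
    (X : Curve) : 1 < absTrace ρ X := by
  obtain ⟨φ, rfl⟩ := exists_curveA X
  exact one_lt_norm_of_resultantFn_pos (h _ ⟨φ, rfl⟩).resultantFn_pos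

theorem curveA_mulAut_mulAutR_inv (ψ : MulAut F2) :
    curveA (ψ * mulAut * mulAutR⁻¹) = curveB ψ := by
  rw [← curveB_mulAut_inv, mul_inv_cancel_right]

/-- The properties of Bowditch representations which imply the lower bound, for the
threshold `M`. -/
structure TraceConditions (ρ : F2 →* SU21) (M : ℝ) : Prop where
  six_le : 6 ≤ M
  re_le : (boundaryTrace ρ).re ≤ M ^ 2
  one_lt : ∀ X, 1 < absTrace ρ X
  growth : ∀ ψ : MulAut F2, GrowsExponentially (fun n : ℤ => tr (ρ (ψ genA ^ n * ψ genB)))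

variable {ρ : F2 →* SU21} {M : ℝ} {ψ : MulAut F2}

/-- If the traces of two adjacent curves are large, then so is the trace of one of their two
common neighbours. -/
theorem TraceConditions.fork (H : TraceConditions ρ M) (hA : M ≤ absTrace ρ (curveA ψ))
    (hB : M ≤ absTrace ρ (curveB ψ)) :
    2 / 7 * (absTrace ρ (curveA ψ) * absTrace ρ (curveB ψ)) ≤
      max (absTrace ρ (curveB (ψ * mulAut))) (absTrace ρ (curveA (ψ * mulAutR⁻¹))) := by
  have h6 := H.six_le
  have hc := H.re_le
  have e1 : absTrace ρ (curveB (ψ * mulAut)) = ‖tr (ρ (ψ genA) * ρ (ψ genB))‖ := by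
    rw [← map_mul, ← map_mul, ← mulAut_genB]; rfl
  have e2 : absTrace ρ (curveA (ψ * mulAutR⁻¹)) = ‖tr (ρ (ψ genA) * (ρ (ψ genB))⁻¹)‖ := by
    rw [← map_inv, ← map_inv, ← map_mul, ← map_mul, ← mulAutR_inv_genA]; rfl
  have h := edge_relation (ρ (ψ genA)) (ρ (ψ genB))
  rw [re_tr_commutator] at h
  rw [e1, e2]
  change M ≤ ‖tr (ρ (ψ genA))‖ at hA
  change M ≤ ‖tr (ρ (ψ genB))‖ at hB
  change 2 / 7 * (‖tr (ρ (ψ genA))‖ * ‖tr (ρ (ψ genB))‖) ≤ _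
  -- Otherwise both differences in the edge relation are at least 5/7 xy, and 50/49 x²y² is at most
  -- x²y² - x² - y² + 2 Re c + 3. Since Re c ≤ M² ≤ x², y², this leaves x²y² ≤ 147, impossible when
  -- xy ≥ 36.
  by_contra hlt
  rw [not_le, max_lt_iff] at hlt
  have h1 := norm_sub_norm_le (tr (ρ (ψ genA)) * tr (ρ (ψ genB)))
    (tr (ρ (ψ genA) * ρ (ψ genB)))
  have h2 := norm_sub_norm_le (tr (ρ (ψ genA)) * star (tr (ρ (ψ genB))))
    (tr (ρ (ψ genA) * (ρ (ψ genB))⁻¹))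
  rw [norm_sub_rev, norm_mul] at h1 h2
  rw [norm_star] at h2
  generalize ‖tr (ρ (ψ genA) * ρ (ψ genB)) - tr (ρ (ψ genA)) * tr (ρ (ψ genB))‖ = d at *
  generalize ‖tr (ρ (ψ genA) * (ρ (ψ genB))⁻¹) - tr (ρ (ψ genA)) * star (tr (ρ (ψ genB)))‖ = e
    at *
  generalize ‖tr (ρ (ψ genA))‖ = x at *
  generalize ‖tr (ρ (ψ genB))‖ = y at *
  have hxy : 36 ≤ x * y := by nlinarith
  have hx2 : M ^ 2 ≤ x ^ 2 := by nlinarith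
  have hy2 : M ^ 2 ≤ y ^ 2 := by nlinarith
  have hd : 5 / 7 * (x * y) ≤ d := by linarith [hlt.1]
  have he : 5 / 7 * (x * y) ≤ e := by linarith [hlt.2]
  have hd2 : (5 / 7 * (x * y)) ^ 2 ≤ d ^ 2 := pow_le_pow_left₀ (by positivity) hd 2
  have he2 : (5 / 7 * (x * y)) ^ 2 ≤ e ^ 2 := pow_le_pow_left₀ (by positivity) he 2
  nlinarith

/-- The traces of the basis `ψ` are large, and do not decrease from the previous neighbour to the
next one. -/
structure IsAscending (ρ : F2 →* SU21) (M : ℝ) (ψ : MulAut F2) : Prop where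
  le_left : M ≤ absTrace ρ (curveA ψ)
  le_right : M ≤ absTrace ρ (curveB ψ)
  prev_le_next : absTrace ρ (curveA (ψ * mulAutR⁻¹)) ≤ absTrace ρ (curveB (ψ * mulAut))

theorem TraceConditions.mul_le_product (H : TraceConditions ρ M)
    (hA : M ≤ absTrace ρ (curveA ψ)) (hB : M ≤ absTrace ρ (curveB ψ)) :
    12 / 7 * absTrace ρ (curveA ψ) ≤
        2 / 7 * (absTrace ρ (curveA ψ) * absTrace ρ (curveB ψ)) ∧
      12 / 7 * absTrace ρ (curveB ψ) ≤
        2 / 7 * (absTrace ρ (curveA ψ) * absTrace ρ (curveB ψ)) := by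
  have := H.six_le
  constructor <;> nlinarith

/-- A previous neighbour no larger than a basis trace cannot satisfy the fork bound, which exceeds
both basis traces by a factor 12/7. So the next neighbour satisfies it. -/
theorem TraceConditions.isAscending (H : TraceConditions ρ M)
    (hA : M ≤ absTrace ρ (curveA ψ)) (hB : M ≤ absTrace ρ (curveB ψ))
    (h : absTrace ρ (curveA (ψ * mulAutR⁻¹)) ≤ absTrace ρ (curveA ψ) ∨
      absTrace ρ (curveA (ψ * mulAutR⁻¹)) ≤ absTrace ρ (curveB ψ)) : IsAscending ρ M ψ := by
  refine ⟨hA, hB, ?_⟩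
  have h6 := H.six_le
  have h1 := H.mul_le_product hA hB
  rcases le_max_iff.1 (H.fork hA hB) with h2 | h2
  · rcases h with h | h <;> linarith [h1.1, h1.2]
  · exfalso
    rcases h with h | h <;> linarith [h1.1, h1.2]

theorem IsAscending.product_le (h : IsAscending ρ M ψ) (H : TraceConditions ρ M) :
    2 / 7 * (absTrace ρ (curveA ψ) * absTrace ρ (curveB ψ)) ≤
      absTrace ρ (curveB (ψ * mulAut)) := by
  have := H.fork h.le_left h.le_right
  rwa [max_eq_left h.prev_le_next] at this

/-- The previous neighbour of the new basis is the discarded curve b, smaller than the new basis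
curve. -/
theorem IsAscending.mul_mulAut (h : IsAscending ρ M ψ) (H : TraceConditions ρ M) :
    IsAscending ρ M (ψ * mulAut) := by
  have h1 := h.product_le H
  have h2 := H.mul_le_product h.le_left h.le_right
  have h6 := H.six_le
  have hB := h.le_right
  apply H.isAscending
  · rw [curveA_mulAut]; exact h.le_left
  · linarith [h2.2]
  · right
    rw [curveA_mulAut_mulAutR_inv]
    linarith [h2.2]

theorem IsAscending.mul_mulAutR (h : IsAscending ρ M ψ) (H : TraceConditions ρ M) :
    IsAscending ρ M (ψ * mulAutR) := by
  have h1 := h.product_le H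
  have h2 := H.mul_le_product h.le_left h.le_right
  have h6 := H.six_le
  have hA := h.le_left
  apply H.isAscending
  · rw [curveA_mulAutR]; linarith [h2.1]
  · rw [curveB_mulAutR]; exact h.le_right
  · left
    rw [curveA_mulAutR, mul_inv_cancel_right]
    linarith [h2.1]

theorem TraceConditions.pos (H : TraceConditions ρ M) (X : Curve) : 0 < absTrace ρ X :=
  one_pos.trans (H.one_lt X)

/-- Below an ascending basis the function `log (2/7 |tr|)` dominates the additive function with the
same values on the basis. -/
theorem TraceConditions.add_le_log (H : TraceConditions ρ M) (n : ℕ) :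
    ∀ (ψ : MulAut F2) (p q : ℕ) (Z : Curve), p + q = n → IsAscending ρ M ψ → InCone ψ p q Z →
      p * Real.log (2 / 7 * absTrace ρ (curveA ψ)) + q * Real.log (2 / 7 * absTrace ρ (curveB ψ)) ≤
        Real.log (2 / 7 * absTrace ρ Z) := by
  induction n using Nat.strong_induction_on with
  | _ n ih =>
  intro ψ p q Z hn h hZ
  have hA := H.pos (curveA ψ)
  have hB := H.pos (curveB ψ)
  have hnext : Real.log (2 / 7 * absTrace ρ (curveA ψ)) +
      Real.log (2 / 7 * absTrace ρ (curveB ψ)) ≤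
      Real.log (2 / 7 * absTrace ρ (curveB (ψ * mulAut))) := by
    rw [← Real.log_mul (by positivity) (by positivity)]
    apply Real.log_le_log (by positivity)
    linarith [h.product_le H]
  rcases hZ.cases with ⟨rfl, rfl, rfl⟩ | ⟨rfl, rfl, rfl⟩ | ⟨rfl, rfl, rfl⟩ | ⟨h0, h1, h2⟩ |
    ⟨h0, h1, h2⟩
  · simp
  · simp
  · simpa using hnext
  · have := ih p (by omega) _ (p - q) q Z (by omega) (h.mul_mulAut H) h2
    rw [curveA_mulAut, Nat.cast_sub h1.le] at this
    have hq : (0 : ℝ) ≤ q := q.cast_nonneg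
    nlinarith [mul_le_mul_of_nonneg_left hnext hq]
  · have := ih q (by omega) _ p (q - p) Z (by omega) (h.mul_mulAutR H) h2
    rw [curveA_mulAutR, curveB_mulAutR, Nat.cast_sub h1.le] at this
    have hp : (0 : ℝ) ≤ p := p.cast_nonneg
    nlinarith [mul_le_mul_of_nonneg_left hnext hp]

theorem TraceConditions.log_mul_le (H : TraceConditions ρ M) (X : Curve) :
    Real.log (2 / 7 * absTrace ρ X) ≤ Real.log (absTrace ρ X) := by
  have := H.pos X
  exact Real.log_le_log (by positivity) (by linarith)

theorem TraceConditions.log_le (H : TraceConditions ρ M) {X : Curve} (h : M ≤ absTrace ρ X) :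
    Real.log (12 / 7) ≤ Real.log (2 / 7 * absTrace ρ X) := by
  have := H.six_le
  exact Real.log_le_log (by norm_num) (by linarith)

/-! ### Linear growth in cones that need not be ascending -/

/-- The logarithms of the traces grow at least linearly in the cone of `ψ`. -/
def HasLinearGrowth (ρ : F2 →* SU21) (ψ : MulAut F2) : Prop :=
  ∃ κ : ℝ, 0 < κ ∧ ∀ p q Z, InCone ψ p q Z → κ * (p + q) ≤ Real.log (absTrace ρ Z)

theorem IsAscending.hasLinearGrowth (h : IsAscending ρ M ψ) (H : TraceConditions ρ M) :
    HasLinearGrowth ρ ψ := by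
  refine ⟨Real.log (12 / 7), Real.log_pos (by norm_num), fun p q Z hZ => ?_⟩
  have h1 := H.add_le_log _ ψ p q Z rfl h hZ
  have h2 := mul_le_mul_of_nonneg_left (H.log_le h.le_left) p.cast_nonneg
  have h3 := mul_le_mul_of_nonneg_left (H.log_le h.le_right) q.cast_nonneg
  linarith [H.log_mul_le Z]

/-- The cone consists of three curves and the interiors of two subcones. Passing to a subcone
replaces p + q by max(p, q), hence the loss of a factor 2. -/
theorem TraceConditions.hasLinearGrowth_of_children (H : TraceConditions ρ M)
    (h1 : HasLinearGrowth ρ (ψ * mulAut)) (h2 : HasLinearGrowth ρ (ψ * mulAutR)) :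
    HasLinearGrowth ρ ψ := by
  obtain ⟨κ₁, hκ₁, h1⟩ := h1
  obtain ⟨κ₂, hκ₂, h2⟩ := h2
  have hl : ∀ X, 0 < Real.log (absTrace ρ X) := fun X => Real.log_pos (H.one_lt X)
  set x := Real.log (absTrace ρ (curveA ψ))
  set y := Real.log (absTrace ρ (curveB ψ))
  set z := Real.log (absTrace ρ (curveB (ψ * mulAut)))
  obtain ⟨κ, hκ, a1, a2, a3, a4, a5⟩ : ∃ κ : ℝ, 0 < κ ∧ κ ≤ κ₁ / 2 ∧ κ ≤ κ₂ / 2 ∧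
      κ ≤ x ∧ κ ≤ y ∧ κ ≤ z / 2 := by
    refine ⟨min (min (κ₁ / 2) (κ₂ / 2)) (min (min x y) (z / 2)), ?_, ?_⟩
    · have := hl (curveA ψ)
      have := hl (curveB ψ)
      have := hl (curveB (ψ * mulAut))
      simp only [lt_min_iff]
      refine ⟨⟨?_, ?_⟩, ⟨?_, ?_⟩, ?_⟩ <;> first | assumption | linarith
    · simp only [min_le_iff, le_refl, true_or, or_true, and_self]
  refine ⟨κ, hκ, fun p q Z hZ => ?_⟩
  rcases hZ.cases with ⟨rfl, rfl, rfl⟩ | ⟨rfl, rfl, rfl⟩ | ⟨rfl, rfl, rfl⟩ | ⟨h0, h, hc⟩ |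
    ⟨h0, h, hc⟩
  · simpa using a3
  · simpa using a4
  · push_cast
    linarith
  · have := h1 _ _ _ hc
    rw [Nat.cast_sub h.le, sub_add_cancel] at this
    have h' : (q : ℝ) ≤ p := Nat.cast_le.2 h.le
    have hq : (0 : ℝ) ≤ q := q.cast_nonneg
    nlinarith
  · have := h2 _ _ _ hc
    rw [Nat.cast_sub h.le, add_sub_cancel] at this
    have h' : (p : ℝ) ≤ q := Nat.cast_le.2 h.le
    have hp : (0 : ℝ) ≤ p := p.cast_nonneg
    nlinarith

theorem HasLinearGrowth.of_swap (h : HasLinearGrowth ρ (ψ * swapAut)) : HasLinearGrowth ρ ψ := by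
  obtain ⟨κ, hκ, h⟩ := h
  refine ⟨κ, hκ, fun p q Z hZ => ?_⟩
  rw [add_comm]
  exact h q p Z (inCone_swap_iff.2 hZ)

/-- All traces in the interior of the cone of `ψ` are large. -/
def IsLargeInside (ρ : F2 →* SU21) (M : ℝ) (ψ : MulAut F2) : Prop :=
  ∀ p q Z, 0 < p → 0 < q → InCone ψ p q Z → M ≤ absTrace ρ Z

theorem IsLargeInside.next (h : IsLargeInside ρ M ψ) : M ≤ absTrace ρ (curveB (ψ * mulAut)) :=
  h 1 1 _ one_pos one_pos (inCone_fwd ψ)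

theorem IsLargeInside.mul_mulAut (h : IsLargeInside ρ M ψ) : IsLargeInside ρ M (ψ * mulAut) :=
  fun _ _ Z hp hq hZ => h _ _ Z (Nat.add_pos_left hp _) hq (inCone_mulAut_iff.1 hZ)

theorem IsLargeInside.mul_mulAutR (h : IsLargeInside ρ M ψ) : IsLargeInside ρ M (ψ * mulAutR) :=
  fun _ _ Z hp _ hZ => h _ _ Z hp (Nat.add_pos_left hp _) (inCone_mulAutR_iff.1 hZ)

theorem IsLargeInside.mul_swapAut (h : IsLargeInside ρ M ψ) : IsLargeInside ρ M (ψ * swapAut) :=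
  fun _ _ Z hp hq hZ => h _ _ Z hq hp (inCone_swap_iff.1 hZ)

/-- If the basis is not ascending, the previous neighbour exceeds both basis traces by a factor
12/7. In either subcone one of these basis curves becomes the previous neighbour, so its trace drops
by this factor, and once it is at most 6 ≤ M the basis is ascending. -/
theorem IsLargeInside.hasLinearGrowth_of_large (h : IsLargeInside ρ M ψ)
    (H : TraceConditions ρ M) (hA : M ≤ absTrace ρ (curveA ψ)) (hB : M ≤ absTrace ρ (curveB ψ)) :
    HasLinearGrowth ρ ψ := by
  have h6 := H.six_le
  have key : ∀ (n : ℕ) (ψ : MulAut F2), IsLargeInside ρ M ψ → M ≤ absTrace ρ (curveA ψ) →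
      M ≤ absTrace ρ (curveB ψ) → absTrace ρ (curveA (ψ * mulAutR⁻¹)) ≤ 6 * (12 / 7) ^ n →
      HasLinearGrowth ρ ψ := by
    intro n
    induction n with
    | zero =>
      intro ψ h hA hB hn
      exact (H.isAscending hA hB (Or.inl (by linarith))).hasLinearGrowth H
    | succ n ih =>
      intro ψ h hA hB hn
      by_cases hle : absTrace ρ (curveA (ψ * mulAutR⁻¹)) ≤ absTrace ρ (curveB (ψ * mulAut))
      · exact IsAscending.hasLinearGrowth ⟨hA, hB, hle⟩ H
      · have h1 := H.fork hA hB
        rw [max_eq_right (not_le.1 hle).le] at h1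
        have h2 := H.mul_le_product hA hB
        rw [pow_succ] at hn
        apply H.hasLinearGrowth_of_children
        · refine ih _ h.mul_mulAut (by rwa [curveA_mulAut]) h.next ?_
          rw [curveA_mulAut_mulAutR_inv]
          linarith [h2.2]
        · refine ih _ h.mul_mulAutR (by rw [curveA_mulAutR]; exact h.next)
            (by rwa [curveB_mulAutR]) ?_
          rw [mul_inv_cancel_right]
          linarith [h2.1]
  obtain ⟨n, hn⟩ := pow_unbounded_of_one_lt (absTrace ρ (curveA (ψ * mulAutR⁻¹)) / 6)
    (by norm_num : (1 : ℝ) < 12 / 7)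
  exact key n ψ h hA hB (by linarith)

theorem exists_mul_le_of_eventually {s : ℕ → ℝ} {l b d : ℝ} (hl : 0 < l) (hd : 0 < d)
    (h1 : ∀ n, l ≤ s n) {N : ℕ} (h2 : ∀ n, N ≤ n → b + n * d ≤ s n) :
    ∃ κ : ℝ, 0 < κ ∧ ∀ n : ℕ, κ * (n + 1) ≤ s n := by
  -- From K on, half of the slope absorbs the offset b and the shift from n to n + 1.
  obtain ⟨K, hK⟩ := exists_nat_ge ((d / 2 - b) / (d / 2))
  rw [div_le_iff₀ (by positivity)] at hK
  refine ⟨min (d / 2) (l / ((K + N : ℕ) + 1)), by positivity, fun n => ?_⟩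
  rcases le_total (K + N) n with h | h
  · have hn : (K : ℝ) ≤ n := Nat.cast_le.2 (by omega)
    have := h2 n (by omega)
    have hm := mul_le_mul_of_nonneg_right (min_le_left (d / 2) (l / ((K + N : ℕ) + 1)))
      (by positivity : (0 : ℝ) ≤ n + 1)
    nlinarith
  · have hn : (n : ℝ) ≤ (K + N : ℕ) := Nat.cast_le.2 h
    refine (mul_le_mul (min_le_right _ _) (add_le_add_left hn 1) (by positivity)
      (by positivity)).trans ?_
    rw [div_mul_cancel₀ _ (by positivity)]
    exact h1 n

theorem mulAut_pow_genA (n : ℕ) : (mulAut ^ n) genA = genA := by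
  induction n with
  | zero => rfl
  | succ n ih => rw [pow_succ', MulAut.mul_apply, ih, mulAut_genA]

theorem mulAut_pow_genB (n : ℕ) : (mulAut ^ n) genB = genA ^ n * genB := by
  induction n with
  | zero => simp
  | succ n ih =>
    rw [pow_succ', MulAut.mul_apply, ih, map_mul, map_pow, mulAut_genA, mulAut_genB, pow_succ,
      mul_assoc]

theorem curveA_mulAut_pow (ψ : MulAut F2) (n : ℕ) : curveA (ψ * mulAut ^ n) = curveA ψ :=
  curve_ext (g := (ψ * mulAut ^ n) genA) (h := ψ genA) rfl rfl
    (Or.inl (by rw [MulAut.mul_apply, mulAut_pow_genA]))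

/-- The cone is cut into the subcones between aⁿb and aⁿ⁺¹b. Exponential growth around a makes the
logarithms on these bases linear in n, and superadditivity extends the estimate inside each subcone
with one constant. -/
theorem IsLargeInside.hasLinearGrowth_of_small_left (h : IsLargeInside ρ M ψ)
    (H : TraceConditions ρ M) (hA : absTrace ρ (curveA ψ) < M) (hB : M ≤ absTrace ρ (curveB ψ)) :
    HasLinearGrowth ρ ψ := by
  have h6 := H.six_le
  set y : ℕ → Curve := fun n => curveB (ψ * mulAut ^ n) with hy
  have hL : ∀ n, IsLargeInside ρ M (ψ * mulAut ^ n) := by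
    intro n
    induction n with
    | zero => simpa using h
    | succ n ih => rw [pow_succ, ← mul_assoc]; exact ih.mul_mulAut
  have hsucc : ∀ n, curveB (ψ * mulAut ^ n * mulAut) = y (n + 1) := fun n => by
    rw [hy]; simp only [pow_succ, mul_assoc]
  have hM : ∀ n, M ≤ absTrace ρ (y n) := by
    intro n
    cases n with
    | zero => simpa [hy] using hB
    | succ n => rw [← hsucc]; exact (hL n).next
  -- Each of these bases has a as previous neighbour, and its trace is below M.
  have hasc : ∀ n, IsAscending ρ M (ψ * mulAut ^ n * mulAutR) := by
    intro n
    apply H.isAscending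
    · rw [curveA_mulAutR, hsucc]; exact hM _
    · rw [curveB_mulAutR]; exact hM n
    · right
      rw [mul_inv_cancel_right, curveA_mulAut_pow, curveB_mulAutR]
      exact hA.le.trans (hM n)
  obtain ⟨k, hk, r, hr, N, hN⟩ := H.growth ψ
  obtain ⟨κ, hκ, hlin⟩ := exists_mul_le_of_eventually
    (s := fun n => Real.log (2 / 7 * absTrace ρ (y n))) (l := Real.log (12 / 7))
    (b := Real.log (2 / 7 * k)) (d := Real.log r) (N := N)
    (Real.log_pos (by norm_num)) (Real.log_pos hr) (fun n => H.log_le (hM n)) (by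
      intro n hn
      have h1 := hN n (by simpa using hn)
      have h2 : tr (ρ (ψ genA ^ (n : ℤ) * ψ genB)) = tr (ρ ((ψ * mulAut ^ n) genB)) := by
        rw [MulAut.mul_apply, mulAut_pow_genB, map_mul ψ, map_pow ψ, zpow_natCast]
      beta_reduce at h1
      rw [h2, Int.natAbs_natCast] at h1
      have h0 : 0 < r := by linarith
      rw [← Real.log_pow, ← Real.log_mul (by positivity) (by positivity)]
      apply Real.log_le_log (by positivity)
      change 2 / 7 * k * r ^ n ≤ 2 / 7 * ‖tr (ρ ((ψ * mulAut ^ n) genB))‖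
      linarith)
  -- The weight p + (n + 1) q is the coordinate sum in the original basis ψ.
  have key : ∀ (p n q : ℕ) (Z : Curve), InCone (ψ * mulAut ^ n) p q Z → 0 < q →
      κ * (p + (n + 1) * q) ≤ Real.log (absTrace ρ Z) := by
    intro p
    induction p using Nat.strong_induction_on with
    | _ p ih =>
    intro n q Z hZ hq
    rcases hZ.cases with ⟨rfl, rfl, rfl⟩ | ⟨rfl, rfl, rfl⟩ | ⟨rfl, rfl, rfl⟩ | ⟨h0, h1, h2⟩ |
      ⟨h0, h1, h2⟩
    · exact absurd hq (lt_irrefl _)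
    · simpa using (hlin n).trans (H.log_mul_le _)
    · have := (hlin (n + 1)).trans (H.log_mul_le _)
      rw [hsucc]
      push_cast at this ⊢
      linarith
    · rw [mul_assoc, ← pow_succ] at h2
      have := ih (p - q) (by omega) (n + 1) q Z h2 hq
      rw [Nat.cast_sub h1.le] at this
      push_cast at this
      linarith
    · have h3 := H.add_le_log _ _ p (q - p) Z rfl (hasc n) h2
      rw [curveA_mulAutR, curveB_mulAutR, hsucc, Nat.cast_sub h1.le] at h3
      have h4 := H.log_mul_le Z
      have hpq : (0 : ℝ) ≤ q - p := sub_nonneg.2 (Nat.cast_le.2 h1.le)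
      have h5 := mul_le_mul_of_nonneg_left (hlin (n + 1)) p.cast_nonneg
      have h6 := mul_le_mul_of_nonneg_left (hlin n) hpq
      push_cast at h5
      have e : κ * (p + (n + 1) * q) = p * (κ * (n + 1 + 1)) + (q - p) * (κ * (n + 1)) := by ring
      rw [e]
      linarith
  have hlA := Real.log_pos (H.one_lt (curveA ψ))
  refine ⟨min κ (Real.log (absTrace ρ (curveA ψ))), lt_min hκ hlA, fun p q Z hZ => ?_⟩
  rcases Nat.eq_zero_or_pos q with rfl | hq
  · obtain ⟨rfl, rfl⟩ : p = 1 ∧ Z = curveA ψ := by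
      rcases hZ.cases with h | h | h | h | h
      · exact ⟨h.1, h.2.2⟩
      all_goals omega
    simp
  · have := key p 0 q Z (by simpa using hZ) hq
    refine (mul_le_mul_of_nonneg_right (min_le_left _ _) (by positivity)).trans ?_
    simpa using this

theorem IsLargeInside.hasLinearGrowth (h : IsLargeInside ρ M ψ) (H : TraceConditions ρ M) :
    HasLinearGrowth ρ ψ := by
  have small_right : ∀ {ψ : MulAut F2}, IsLargeInside ρ M ψ → M ≤ absTrace ρ (curveA ψ) →
      absTrace ρ (curveB ψ) < M → HasLinearGrowth ρ ψ := by
    intro ψ h hA hB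
    apply HasLinearGrowth.of_swap
    exact h.mul_swapAut.hasLinearGrowth_of_small_left H (by rwa [curveA_swap])
      (by rwa [curveB_swap])
  rcases le_or_gt M (absTrace ρ (curveA ψ)) with hA | hA <;>
    rcases le_or_gt M (absTrace ρ (curveB ψ)) with hB | hB
  · exact h.hasLinearGrowth_of_large H hA hB
  · exact small_right h hA hB
  · exact h.hasLinearGrowth_of_small_left H hA hB
  · apply H.hasLinearGrowth_of_children
    · exact h.mul_mulAut.hasLinearGrowth_of_small_left H (by rwa [curveA_mulAut]) h.next
    · exact small_right h.mul_mulAutR (by rw [curveA_mulAutR]; exact h.next)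
        (by rwa [curveB_mulAutR])

/-- In a subcone the coordinate sum of an interior curve drops by at least one, so after m
subdivisions no small trace is left in the interior. -/
theorem TraceConditions.hasLinearGrowth_of_le (H : TraceConditions ρ M) (m : ℕ) :
    ∀ ψ : MulAut F2, (∀ p q Z, 0 < p → 0 < q → InCone ψ p q Z → absTrace ρ Z < M → p + q ≤ m) →
      HasLinearGrowth ρ ψ := by
  induction m with
  | zero =>
    intro ψ h
    refine IsLargeInside.hasLinearGrowth (M := M) (fun p q Z hp hq hZ => ?_) H
    by_contra hlt
    have := h p q Z hp hq hZ (not_le.1 hlt)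
    omega
  | succ m ih =>
    intro ψ h
    apply H.hasLinearGrowth_of_children
    · refine ih _ fun p q Z hp hq hZ hlt => ?_
      have := h _ _ Z (by omega) hq (inCone_mulAut_iff.1 hZ) hlt
      omega
    · refine ih _ fun p q Z hp hq hZ hlt => ?_
      have := h _ _ Z hp (by omega) (inCone_mulAutR_iff.1 hZ) hlt
      omega

/-! ### Consequences of the Bowditch conditions -/

theorem exists_coord_le (ψ : MulAut F2) {s : Set Curve} (hs : s.Finite) :
    ∃ m, ∀ X ∈ s, (coord ψ X).1 + (coord ψ X).2 ≤ m := by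
  obtain ⟨m, hm⟩ := (hs.image fun X => (coord ψ X).1 + (coord ψ X).2).bddAbove
  exact ⟨m, fun X hX => hm ⟨X, hX, rfl⟩⟩

theorem mulAut_zpow_genB (n : ℤ) : (mulAut ^ n) genB = genA ^ n * genB := by
  cases n with
  | ofNat n => simpa using mulAut_pow_genB n
  | negSucc n =>
    rw [zpow_negSucc, zpow_negSucc]
    apply (mulAut ^ (n + 1)).injective
    rw [MulAut.apply_inv_self, map_mul, map_inv, map_pow, mulAut_pow_genA, mulAut_pow_genB]
    simp

/-- The curves aⁿb have coordinates (|n|, 1), so only finitely many n give a curve of the finite set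
of small traces; non-growth would produce infinitely many. -/
theorem growsExponentially_of_finite {D : ℝ} (hD : IsNeighborConstant (boundaryTrace ρ) D)
    (hDM : D ≤ M) (hfin : {X | absTrace ρ X < M}.Finite)
    (hf : 0 < resultantFn (tr (ρ (ψ genA)))) :
    GrowsExponentially (fun n : ℤ => tr (ρ (ψ genA ^ n * ψ genB))) := by
  by_contra hg
  obtain ⟨m, hm⟩ := exists_coord_le ψ hfin
  refine hD ρ rfl ψ hf hg ((Set.finite_Icc (-(m : ℤ)) m).subset fun n hn => ?_)
  have hn' : ‖tr (ρ (ψ genA ^ n * ψ genB))‖ < D := hn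
  have e : (ψ * mulAut ^ n) genB = ψ genA ^ n * ψ genB := by
    rw [MulAut.mul_apply, mulAut_zpow_genB, map_mul, map_zpow]
  have h1 := hm (curveB (ψ * mulAut ^ n)) (by
    change ‖tr (ρ ((ψ * mulAut ^ n) genB))‖ < M
    rw [e]
    exact hn'.trans_le hDM)
  rw [coord_curveB, MulAut.mul_apply, MulAut.inv_apply_self, mulAut_zpow_genB, vec_mul,
    vec_zpow] at h1
  simp at h1
  rw [Set.mem_Icc]
  omega

theorem IsBowditch.traceConditions {D : ℂ → ℝ} (hD : ∀ c, IsNeighborConstant c (D c))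
    (h : IsBowditch D ρ) : TraceConditions ρ (threshold D (boundaryTrace ρ)) where
  six_le := le_max_left _ _
  re_le := by
    have h1 : √|(boundaryTrace ρ).re| ≤ threshold D (boundaryTrace ρ) :=
      (le_max_left _ _).trans (le_max_right _ _)
    exact (le_abs_self _).trans ((Real.sqrt_le_left ((Real.sqrt_nonneg _).trans h1)).1 h1)
  one_lt := one_lt_absTrace h.1
  growth ψ := growsExponentially_of_finite (hD _) ((le_max_right _ _).trans (le_max_right _ _))
    h.2 (h.1 _ ⟨ψ, rfl⟩).resultantFn_pos

theorem IsBowditch.hasLowerFibBound {D : ℂ → ℝ} (hD : ∀ c, IsNeighborConstant c (D c))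
    (h : IsBowditch D ρ) (v : EdgeVertex) :
    HasLowerFibBound v (logPlusTrace ρ) Set.univ := by
  have H := h.traceConditions hD
  obtain ⟨θ, hθ⟩ := exists_basis v
  have cone : ∀ ψ, HasLinearGrowth ρ ψ := by
    intro ψ
    obtain ⟨m, hm⟩ := exists_coord_le ψ h.2
    refine H.hasLinearGrowth_of_le m ψ fun p q Z _ _ hZ hlt => ?_
    simpa [hZ.coord_eq] using hm Z hlt
  obtain ⟨κ₁, hκ₁, h1⟩ := cone θ
  obtain ⟨κ₂, hκ₂, h2⟩ := cone (θ * invAut)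
  refine ⟨min κ₁ κ₂, lt_min hκ₁ hκ₂, fun X _ => ?_⟩
  rw [fib_eq_coord θ hθ, logPlusTrace, Real.posLog]
  refine le_max_of_le_right ?_
  push_cast
  rcases inCone_or θ X with hX | hX
  · exact (mul_le_mul_of_nonneg_right (min_le_left _ _) (by positivity)).trans (h1 _ _ _ hX)
  · exact (mul_le_mul_of_nonneg_right (min_le_right _ _) (by positivity)).trans (h2 _ _ _ hX)

end OneHoledTorus

end

theorem mainTheorem5 :
    -- every character has an upper Fibonacci bound
    (∀ (ρ : OneHoledTorus.F2 →* OneHoledTorus.SU21) (v : OneHoledTorus.EdgeVertex),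
      OneHoledTorus.HasUpperFibBound v (OneHoledTorus.logPlusTrace ρ) Set.univ) ∧
    -- the constant `D(c)` entering the definition of Bowditch representations exists
    (∀ c : ℂ, ∃ D : ℝ, OneHoledTorus.IsNeighborConstant c D) ∧
    -- whichever such constants are chosen, Bowditch representations have a lower Fibonacci
    -- bound, hence Fibonacci growth
    (∀ D : ℂ → ℝ, (∀ c : ℂ, OneHoledTorus.IsNeighborConstant c (D c)) →
      ∀ ρ : OneHoledTorus.F2 →* OneHoledTorus.SU21, OneHoledTorus.IsBowditch D ρ →
        ∀ v : OneHoledTorus.EdgeVertex,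
          OneHoledTorus.HasLowerFibBound v (OneHoledTorus.logPlusTrace ρ) Set.univ ∧
          OneHoledTorus.HasFibGrowth v (OneHoledTorus.logPlusTrace ρ) Set.univ) := by
  refine ⟨OneHoledTorus.hasUpperFibBound, fun c => ⟨2, OneHoledTorus.isNeighborConstant_two c⟩, ?_⟩
  intro D hD ρ h v
  have hlow := h.hasLowerFibBound hD v
  exact ⟨hlow, OneHoledTorus.hasUpperFibBound ρ v, hlow⟩
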